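/- Let $k$ be a field, let $H$ be a Hopf algebra over $k$ with bijective antipode $\mathcal S$, and let $R$ be a Hopf algebra with bijective antipode in the braided tensor category ${}^H_H\mathcal{YD}$ of (left-left) Yetter–Drinfeld modules over $H$, that is, of left $H$-modules and left $H$-comodules $V$ with coaction $\rho(v)=v_{(-1)}\otimes v_{(0)}$ satisfying $\rho(h\cdot v)=h_{(1)}v_{(-1)}\mathcal S(h_{(3)})\otimes h_{(2)}\cdot v_{(0)}$, with braiding $v\otimes w\mapsto v_{(-1)}\cdot w\otimes v_{(0)}$. Let ${}^R\mathcal M$ be the category of left comodules over the coalgebra underlying $R$, and let $R^*$ be the linear dual of $R$ with the convolution product $(fg)(x)=f(x^{(1)})g(x^{(2)})$, where $\underline\Delta(x)=x^{(1)}\otimes x^{(2)}$. Call $R$ co-Frobenius if it admits a non-zero left integral, i.e. some $0\neq\lambda\in R^*$ with $f\lambda=f(1)\lambda$ for all $f\in R^*$. A left $R^*$-module $M$ is rational if for every $m\in M$ there are finitely many $m_i\in M$, $c_i\in R$ with $f\cdot m=\sum_i f(c_i)m_i$ for all $f\in R^*$; $\mathrm{Rat}(R^*)$ denotes the largest rational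 submodule of the left $R^*$-module $R^*$. The following assertions are equivalent: (i) $R$ is co-Frobenius. (ii) For every simple $S\in{}^R\mathcal M$, the injective hull $E_R(S)$ of $S$ in ${}^R\mathcal M$ is finite-dimensional. (iii) Every non-zero $M\in{}^R\mathcal M$ has a finite-dimensional non-zero quotient comodule. (iv) Every non-zero injective $M\in{}^R\mathcal M$ has a finite-dimensional non-zero quotient comodule. (v) There is a non-zero injective $M\in{}^R\mathcal M$ that has a finite-dimensional non-zero quotient comodule. (vi) Every object of ${}^R\mathcal M$ has a projective cover. (vii) Every injective object of ${}^R\mathcal M$ is projective. (viii) $\mathrm{Rat}(R^*)\neq 0$. -/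

import Mathlib

open scoped TensorProduct
open Coalgebra

universe u v

/-! ### Left comodules over a coalgebra -/

/-- A left comodule `M` over a `k`-coalgebra `C`, with coaction
`M → C ⊗ M`, `m ↦ m₍₋₁₎ ⊗ m₍₀₎`. -/
class LeftComodule (k C M : Type*) [Field k] [AddCommGroup C] [Module k C] [Coalgebra k C]
    [AddCommGroup M] [Module k M] where
  coact : M →ₗ[k] C ⊗[k] M
  coassoc : (TensorProduct.assoc k C C M).toLinearMap ∘ₗ (comul (R := k)).rTensor M ∘ₗ coact =
    coact.lTensor C ∘ₗ coact
  counit_coact : (TensorProduct.lid k M).toLinearMap ∘ₗ (counit (R := k)).rTensor M ∘ₗ coact =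
    LinearMap.id

namespace LeftComodule

section

variable (k C : Type*) [Field k] [AddCommGroup C] [Module k C] [Coalgebra k C]

/-- A linear map between left `C`-comodules is a comodule morphism. -/
def IsColinear {M N : Type*} [AddCommGroup M] [Module k M] [LeftComodule k C M]
    [AddCommGroup N] [Module k N] [LeftComodule k C N] (f : M →ₗ[k] N) : Prop :=
  coact (C := C) ∘ₗ f = f.lTensor C ∘ₗ coact (C := C)

/-- A subspace `N` of `M` is a subcomodule: the coaction maps `N` into `C ⊗ N`. -/
def IsSubcomodule {M : Type*} [AddCommGroup M] [Module k M] [LeftComodule k C M]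
    (N : Submodule k M) : Prop :=
  ∀ m ∈ N, coact (k := k) (C := C) m ∈ LinearMap.range (N.subtype.lTensor C)

/-- A simple comodule. -/
def IsSimple (M : Type*) [AddCommGroup M] [Module k M] [LeftComodule k C M] : Prop :=
  Nontrivial M ∧ ∀ N : Submodule k M, IsSubcomodule k C N → N = ⊥ ∨ N = ⊤

/-- `M` has a finite-dimensional non-zero quotient comodule. -/
def HasFiniteQuotient (M : Type u) [AddCommGroup M] [Module k M] [LeftComodule k C M] : Prop :=
  ∃ (Q : Type u) (_ : AddCommGroup Q) (_ : Module k Q) (_ : LeftComodule k C Q) (q : M →ₗ[k] Q),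
    IsColinear k C q ∧ Function.Surjective q ∧ Nontrivial Q ∧ FiniteDimensional k Q

/-- `M` is an injective object in the category of left `C`-comodules. -/
def IsInjective (M : Type u) [AddCommGroup M] [Module k M] [LeftComodule k C M] : Prop :=
  ∀ (X Y : Type u) [AddCommGroup X] [Module k X] [LeftComodule k C X]
    [AddCommGroup Y] [Module k Y] [LeftComodule k C Y] (i : X →ₗ[k] Y) (f : X →ₗ[k] M),
    IsColinear k C i → Function.Injective i → IsColinear k C f →
      ∃ g : Y →ₗ[k] M, IsColinear k C g ∧ g ∘ₗ i = f

/-- `M` is a projective object in the category of left `C`-comodules. -/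
def IsProjective (M : Type u) [AddCommGroup M] [Module k M] [LeftComodule k C M] : Prop :=
  ∀ (X Y : Type u) [AddCommGroup X] [Module k X] [LeftComodule k C X]
    [AddCommGroup Y] [Module k Y] [LeftComodule k C Y] (p : X →ₗ[k] Y) (f : M →ₗ[k] Y),
    IsColinear k C p → Function.Surjective p → IsColinear k C f →
      ∃ g : M →ₗ[k] X, IsColinear k C g ∧ p ∘ₗ g = f

/-- `i : M → E` is an injective hull: `E` is injective and `i` is an essential monomorphism. -/
def IsInjectiveHull {M E : Type u} [AddCommGroup M] [Module k M] [LeftComodule k C M]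
    [AddCommGroup E] [Module k E] [LeftComodule k C E] (i : M →ₗ[k] E) : Prop :=
  IsColinear k C i ∧ Function.Injective i ∧ IsInjective k C E ∧
    ∀ N : Submodule k E, IsSubcomodule k C N → N ⊓ LinearMap.range i = ⊥ → N = ⊥

/-- `p : P → M` is a projective cover: `P` is projective and `p` is an epimorphism with
superfluous kernel. -/
def IsProjectiveCover {P M : Type u} [AddCommGroup P] [Module k P] [LeftComodule k C P]
    [AddCommGroup M] [Module k M] [LeftComodule k C M] (p : P →ₗ[k] M) : Prop :=
  IsColinear k C p ∧ Function.Surjective p ∧ IsProjective k C P ∧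
    ∀ N : Submodule k P, IsSubcomodule k C N → N ⊔ LinearMap.ker p = ⊤ → N = ⊤

/-- The injective hull of `M` (unique up to isomorphism) is finite-dimensional. -/
def HasFiniteInjectiveHull (M : Type u) [AddCommGroup M] [Module k M] [LeftComodule k C M] :
    Prop :=
  ∃ (E : Type u) (_ : AddCommGroup E) (_ : Module k E) (_ : LeftComodule k C E) (i : M →ₗ[k] E),
    IsInjectiveHull k C i ∧ FiniteDimensional k E

/-- `M` has a projective cover. -/
def HasProjectiveCover (M : Type u) [AddCommGroup M] [Module k M] [LeftComodule k C M] : Prop :=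
  ∃ (P : Type u) (_ : AddCommGroup P) (_ : Module k P) (_ : LeftComodule k C P) (p : P →ₗ[k] M),
    IsProjectiveCover k C p

end

end LeftComodule

/-! ### The dual algebra of a coalgebra and rational modules -/

/-- The dual `C*` with the convolution product `(f * g)(c) = f(c₍₁₎) g(c₍₂₎)`. -/
abbrev DualAlg (k C : Type*) [Field k] [AddCommGroup C] [Module k C] [Coalgebra k C] :=
  WithConv (C →ₗ[k] k)

section

variable (k C : Type*) [Field k] [AddCommGroup C] [Module k C] [Coalgebra k C]

/-- A left `C*`-module `M` is rational if for each `m` there is `∑ mᵢ ⊗ cᵢ ∈ M ⊗ C` with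
`f • m = ∑ f(cᵢ) mᵢ` for all `f ∈ C*`. -/
def IsRational (M : Type*) [AddCommGroup M] [Module k M] [Module (DualAlg k C) M] : Prop :=
  ∀ m : M, ∃ t : M ⊗[k] C, ∀ f : DualAlg k C,
    f • m = TensorProduct.rid k M (f.ofConv.lTensor M t)

/-- `Rat(C*)`: the largest rational submodule of the left `C*`-module `C*`. -/
noncomputable def ratDual : Submodule (DualAlg k C) (DualAlg k C) :=
  sSup {N | IsRational k C N}

end

/-! ### Yetter-Drinfeld modules -/

section

variable (k H V W : Type*) [Field k] [Ring H] [HopfAlgebra k H]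
  [AddCommGroup V] [Module k V] [Module H V] [IsScalarTower k H V]
  [AddCommGroup W] [Module k W] [Module H W] [IsScalarTower k H W]

/-- The action of `H` on `V` as a linear map `H → End(V)`. -/
noncomputable def actEnd : H →ₗ[k] V →ₗ[k] V := (Algebra.lsmul k k V).toLinearMap

/-- The map `a ⊗ c ↦ (x ↦ a x S(c))`. -/
noncomputable def conjAct : H ⊗[k] H →ₗ[k] H →ₗ[k] H :=
  TensorProduct.lift (LinearMap.mk₂ k
    (fun a c => LinearMap.mulLeft k a ∘ₗ LinearMap.mulRight k (HopfAlgebra.antipode k c))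
    (fun _ _ _ => by ext; simp [add_mul]) (fun _ _ _ => by ext; simp)
    (fun _ _ _ => by ext; simp [mul_add]) (fun _ _ _ => by ext; simp))

/-- The bilinear map `(a ⊗ (b ⊗ c), x ⊗ v) ↦ a x S(c) ⊗ b • v`. -/
noncomputable def ydMap : H ⊗[k] (H ⊗[k] H) →ₗ[k] H ⊗[k] V →ₗ[k] H ⊗[k] V :=
  TensorProduct.map₂ (conjAct k H) (actEnd k H V) ∘ₗ
    (TensorProduct.assoc k H H H).symm.toLinearMap ∘ₗ
    (TensorProduct.comm k H H).toLinearMap.lTensor H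

theorem ydMap_tmul (a b c x : H) (v : V) :
    ydMap k H V (a ⊗ₜ (b ⊗ₜ c)) (x ⊗ₜ v) =
      (a * x * HopfAlgebra.antipode k c) ⊗ₜ (b • v) := by
  simp [ydMap, conjAct, actEnd, mul_assoc]

/-- A (left-left) Yetter-Drinfeld module over `H`: an `H`-module which is a left `H`-comodule, with
`ρ(h • v) = h₍₁₎ v₍₋₁₎ S(h₍₃₎) ⊗ h₍₂₎ • v₍₀₎`. -/
class YetterDrinfeldModule (k H V : Type*) [Field k] [Ring H] [HopfAlgebra k H]
    [AddCommGroup V] [Module k V] [Module H V] [IsScalarTower k H V]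
    extends LeftComodule k H V where
  coact_smul : ∀ (h : H) (v : V), coact (h • v) =
    ydMap k H V ((comul (R := k)).lTensor H (comul (R := k) h)) (coact v)

/-- The action of `H` on `V ⊗ W`: `h • (v ⊗ w) = h₍₁₎ • v ⊗ h₍₂₎ • w`. -/
noncomputable def tensorAct : H →ₗ[k] V ⊗[k] W →ₗ[k] V ⊗[k] W :=
  TensorProduct.map₂ (actEnd k H V) (actEnd k H W) ∘ₗ comul

/-- The coaction of `H` on `V ⊗ W`: `v ⊗ w ↦ v₍₋₁₎ w₍₋₁₎ ⊗ (v₍₀₎ ⊗ w₍₀₎)`. -/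
noncomputable def tensorCoact [LeftComodule k H V] [LeftComodule k H W] :
    V ⊗[k] W →ₗ[k] H ⊗[k] (V ⊗[k] W) :=
  (LinearMap.mul' k H).rTensor (V ⊗[k] W) ∘ₗ
    (TensorProduct.tensorTensorTensorComm k H V H W).toLinearMap ∘ₗ
    TensorProduct.map (LeftComodule.coact (C := H)) (LeftComodule.coact (C := H))

/-- The braiding `V ⊗ W → W ⊗ V`, `v ⊗ w ↦ v₍₋₁₎ • w ⊗ v₍₀₎`. -/
noncomputable def ydBraiding [LeftComodule k H V] : V ⊗[k] W →ₗ[k] W ⊗[k] V :=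
  (TensorProduct.lift (actEnd k H W)).rTensor V ∘ₗ
    (TensorProduct.rightComm k H V W).toLinearMap ∘ₗ
    (LeftComodule.coact (C := H)).rTensor W

end

/-! ### Hopf algebras in the category of Yetter-Drinfeld modules -/

section

variable (k H R : Type*) [Field k] [Ring H] [HopfAlgebra k H]
  [Ring R] [Algebra k R] [Module H R] [IsScalarTower k H R]

/-- The braided product of `R ⊗ R`, `(a ⊗ b) ⊗ (c ⊗ d) ↦ a (b₍₋₁₎ • c) ⊗ b₍₀₎ d`, that is,
`(m ⊗ m)(id ⊗ c ⊗ id)` for the braiding `c`. -/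
noncomputable def braidedMul [LeftComodule k H R] :
    (R ⊗[k] R) ⊗[k] (R ⊗[k] R) →ₗ[k] R ⊗[k] R :=
  TensorProduct.map (LinearMap.mul' k R) (LinearMap.mul' k R) ∘ₗ
    (TensorProduct.assoc k R R (R ⊗[k] R)).symm.toLinearMap ∘ₗ
    ((TensorProduct.assoc k R R R).toLinearMap ∘ₗ
      (ydBraiding k H R R).rTensor R ∘ₗ
      (TensorProduct.assoc k R R R).symm.toLinearMap).lTensor R ∘ₗ
    (TensorProduct.assoc k R R (R ⊗[k] R)).toLinearMap

/-- A Hopf algebra in the braided category of Yetter-Drinfeld modules over `H`: an algebra and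
coalgebra `R` which is a Yetter-Drinfeld module, such that all structure maps are morphisms of
Yetter-Drinfeld modules, `Δ` and `ε` are algebra maps (with respect to the braided product on
`R ⊗ R`), and the identity has a convolution inverse, the antipode. -/
class BraidedHopfAlgebra (k H R : Type*) [Field k] [Ring H] [HopfAlgebra k H]
    [Ring R] [Algebra k R] [Coalgebra k R] [Module H R] [IsScalarTower k H R]
    [YetterDrinfeldModule k H R] where
  -- multiplication and unit are morphisms of Yetter-Drinfeld modules
  smul_mul : ∀ (h : H) (x y : R),
    h • (x * y) = LinearMap.mul' k R (tensorAct k H R R h (x ⊗ₜ[k] y))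
  smul_one : ∀ h : H, h • (1 : R) = counit (R := k) h • (1 : R)
  coact_mul : ∀ x y : R, LeftComodule.coact (k := k) (C := H) (x * y) =
    (LinearMap.mul' k R).lTensor H (tensorCoact k H R R (x ⊗ₜ[k] y))
  coact_one : LeftComodule.coact (k := k) (C := H) (1 : R) = 1 ⊗ₜ[k] 1
  -- comultiplication and counit are morphisms of Yetter-Drinfeld modules
  comul_smul : ∀ (h : H) (x : R),
    comul (R := k) (h • x) = tensorAct k H R R h (comul (R := k) x)
  counit_smul : ∀ (h : H) (x : R),
    counit (R := k) (h • x) = counit (R := k) h * counit (R := k) x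
  coact_comul : ∀ x : R, tensorCoact k H R R (comul (R := k) x) =
    (comul (R := k)).lTensor H (LeftComodule.coact (k := k) (C := H) x)
  coact_counit : ∀ x : R, (counit (R := k)).lTensor H (LeftComodule.coact (k := k) (C := H) x) =
    (1 : H) ⊗ₜ[k] counit (R := k) x
  -- comultiplication and counit are algebra maps
  comul_mul : ∀ x y : R,
    comul (R := k) (x * y) = braidedMul k H R (comul (R := k) x ⊗ₜ[k] comul (R := k) y)
  comul_one : comul (R := k) (1 : R) = 1 ⊗ₜ[k] 1
  counit_mul : ∀ x y : R,
    counit (R := k) (x * y) = counit (R := k) x * counit (R := k) y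
  counit_one : counit (R := k) (1 : R) = 1
  -- the antipode
  antipode (k H) : R →ₗ[k] R
  antipode_smul : ∀ (h : H) (x : R), antipode (h • x) = h • antipode x
  antipode_coact : ∀ x : R, LeftComodule.coact (k := k) (C := H) (antipode x) =
    antipode.lTensor H (LeftComodule.coact (k := k) (C := H) x)
  mul_antipode_rTensor_comul : ∀ x : R,
    LinearMap.mul' k R (antipode.rTensor R (comul (R := k) x)) = algebraMap k R (counit x)
  mul_antipode_lTensor_comul : ∀ x : R,
    LinearMap.mul' k R (antipode.lTensor R (comul (R := k) x)) = algebraMap k R (counit x)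

end

section

variable (k R : Type*) [Field k] [Ring R] [Algebra k R] [Coalgebra k R]

/-- The space of left integrals on `R`: those `l ∈ R*` with `f * l = f(1) l` for all `f ∈ R*`. -/
noncomputable def leftIntegrals : Submodule k (DualAlg k R) where
  carrier := {l | ∀ f : DualAlg k R, f * l = f.ofConv 1 • l}
  add_mem' ha hb f := by rw [mul_add, ha f, hb f, smul_add]
  zero_mem' f := by rw [mul_zero, smul_zero]
  smul_mem' c l hl f := by rw [mul_smul_comm, hl f, smul_comm]

/-- `R` is (left) co-Frobenius: it admits a non-zero left integral. -/
def IsCoFrobenius : Prop := leftIntegrals k R ≠ ⊥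

end

/-! ### Sweedler sums -/

section Sweedler

variable {k : Type*} [Field k]
variable {U V W X Y Z : Type*} [AddCommGroup U] [Module k U] [AddCommGroup V] [Module k V]
  [AddCommGroup W] [Module k W] [AddCommGroup X] [Module k X] [AddCommGroup Y] [Module k Y]
  [AddCommGroup Z] [Module k Z]

/-- The sum `∑ F vᵢ wᵢ` over a chosen representation `t = ∑ vᵢ ⊗ wᵢ`. -/
noncomputable def sw (t : V ⊗[k] W) (F : V → W → Z) : Z :=
  ∑ i, F ((TensorProduct.exists_sum_tmul_eq t).choose_spec.choose i)
    ((TensorProduct.exists_sum_tmul_eq t).choose_spec.choose_spec.choose i)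

variable (k) in
/-- `F` is linear in each of its two arguments. -/
structure Lin₂ (F : V → W → Z) : Prop where
  left : ∀ w, IsLinearMap k fun v => F v w
  right : ∀ v, IsLinearMap k fun w => F v w

variable (k) in
/-- `F` is linear in each of its three arguments. -/
structure Lin₃ (F : V → W → X → Z) : Prop where
  left : ∀ w x, IsLinearMap k fun v => F v w x
  mid : ∀ v x, IsLinearMap k fun w => F v w x
  right : ∀ v w, IsLinearMap k fun x => F v w x

variable (k) in
/-- `F` is linear in each of its four arguments. -/
structure Lin₄ (F : V → W → X → Y → Z) : Prop where
  fst : ∀ w x y, IsLinearMap k fun v => F v w x y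
  snd : ∀ v x y, IsLinearMap k fun w => F v w x y
  trd : ∀ v w y, IsLinearMap k fun x => F v w x y
  fth : ∀ v w x, IsLinearMap k fun y => F v w x y

/-- The linear map on the tensor product given by a bilinear function. -/
noncomputable def Lin₂.lift {F : V → W → Z} (hF : Lin₂ k F) : V ⊗[k] W →ₗ[k] Z :=
  TensorProduct.lift (LinearMap.mk₂ k F (fun a b w => (hF.1 w).map_add a b)
    (fun c a w => (hF.1 w).map_smul c a) (fun v a b => (hF.2 v).map_add a b)
    (fun c v a => (hF.2 v).map_smul c a))

theorem Lin₂.lift_tmul {F : V → W → Z} (hF : Lin₂ k F) (v : V) (w : W) :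
    hF.lift (v ⊗ₜ w) = F v w := by
  simp [Lin₂.lift]

theorem map_sw (φ : Z →ₗ[k] X) (t : V ⊗[k] W) (F : V → W → Z) :
    φ (sw t F) = sw t fun v w => φ (F v w) := by
  simp [sw]

theorem sw_tmul_self (t : V ⊗[k] W) : (sw t fun v w => v ⊗ₜ[k] w) = t :=
  (TensorProduct.exists_sum_tmul_eq t).choose_spec.choose_spec.choose_spec.symm

theorem Lin₂.lift_eq_sw {F : V → W → Z} (hF : Lin₂ k F) (t : V ⊗[k] W) : hF.lift t = sw t F := by
  conv_lhs => rw [← sw_tmul_self t, map_sw]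
  simp only [Lin₂.lift_tmul]

omit [Module k Z] in
theorem sw_congr {t : V ⊗[k] W} {F G : V → W → Z} (h : ∀ v w, F v w = G v w) :
    sw t F = sw t G := by
  simp only [sw, h]

omit [Module k Z] in
theorem sw_comm (t : V ⊗[k] W) (t' : X ⊗[k] Y) (F : V → W → X → Y → Z) :
    (sw t fun v w => sw t' fun x y => F v w x y) = sw t' fun x y => sw t fun v w => F v w x y :=
  Finset.sum_comm

/-- Evaluation of a Sweedler sum over a Sweedler sum of pure tensors. -/
theorem sw_sw (t : V ⊗[k] W) (A : V → W → X) (B : V → W → Y) {F : X → Y → Z} (hF : Lin₂ k F) :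
    sw (sw t fun v w => A v w ⊗ₜ[k] B v w) F = sw t fun v w => F (A v w) (B v w) := by
  rw [← hF.lift_eq_sw, map_sw]
  simp only [hF.lift_tmul]

theorem sw_map (f : V →ₗ[k] X) (g : W →ₗ[k] Y) (t : V ⊗[k] W) {F : X → Y → Z} (hF : Lin₂ k F) :
    sw (TensorProduct.map f g t) F = sw t fun v w => F (f v) (g w) := by
  conv_lhs => rw [← sw_tmul_self t, map_sw]
  exact sw_sw t _ _ hF

theorem isLinearMap_id : IsLinearMap k fun x : V => x := ⟨fun _ _ => rfl, fun _ _ => rfl⟩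

theorem IsLinearMap.linearMap_apply (φ : W →ₗ[k] Z) {f : V → W} (hf : IsLinearMap k f) :
    IsLinearMap k fun x => φ (f x) :=
  ⟨fun a b => by rw [hf.map_add, _root_.map_add], fun c a => by rw [hf.map_smul, _root_.map_smul]⟩

theorem IsLinearMap.mul_const {A : Type*} [Ring A] [Algebra k A] (c : A) {f : V → A}
    (hf : IsLinearMap k f) : IsLinearMap k fun x => f x * c :=
  ⟨fun a b => by rw [hf.map_add, add_mul], fun c a => by rw [hf.map_smul, smul_mul_assoc]⟩

theorem IsLinearMap.const_mul {A : Type*} [Ring A] [Algebra k A] (c : A) {f : V → A}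
    (hf : IsLinearMap k f) : IsLinearMap k fun x => c * f x :=
  ⟨fun a b => by rw [hf.map_add, mul_add], fun c a => by rw [hf.map_smul, mul_smul_comm]⟩

theorem IsLinearMap.smul_const {A M : Type*} [Ring A] [Algebra k A] [AddCommGroup M] [Module k M]
    [Module A M] [IsScalarTower k A M] (c : M) {f : V → A}
    (hf : IsLinearMap k f) : IsLinearMap k fun x => f x • c :=
  ⟨fun a b => by rw [hf.map_add, add_smul], fun c a => by rw [hf.map_smul, smul_assoc]⟩

theorem IsLinearMap.const_smul {A M : Type*} [Ring A] [Algebra k A] [AddCommGroup M] [Module k M]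
    [Module A M] [IsScalarTower k A M] (c : A) {f : V → M}
    (hf : IsLinearMap k f) : IsLinearMap k fun x => c • f x :=
  ⟨fun a b => by rw [hf.map_add, smul_add], fun r a => by
    rw [hf.map_smul, ← algebraMap_smul A r (f a), ← algebraMap_smul A r (c • f a), smul_smul,
      smul_smul, Algebra.commutes]⟩

theorem IsLinearMap.tmul_const (c : W) {f : V → Z} (hf : IsLinearMap k f) :
    IsLinearMap k fun x => f x ⊗ₜ[k] c :=
  ⟨fun a b => by rw [hf.map_add, TensorProduct.add_tmul],
    fun r a => by rw [hf.map_smul, TensorProduct.smul_tmul']⟩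

theorem IsLinearMap.const_tmul (c : W) {f : V → Z} (hf : IsLinearMap k f) :
    IsLinearMap k fun x => c ⊗ₜ[k] f x :=
  ⟨fun a b => by rw [hf.map_add, TensorProduct.tmul_add],
    fun r a => by rw [hf.map_smul, TensorProduct.tmul_smul]⟩

theorem IsLinearMap.sw_left {T : U → V ⊗[k] W} (hT : IsLinearMap k T) {F : V → W → Z}
    (h₁ : ∀ w, IsLinearMap k fun v => F v w) (h₂ : ∀ v, IsLinearMap k fun w => F v w) :
    IsLinearMap k fun x => sw (T x) F := by
  have hF : Lin₂ k F := ⟨h₁, h₂⟩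
  simp only [← hF.lift_eq_sw]
  exact hT.linearMap_apply _

theorem IsLinearMap.sw_right (t : V ⊗[k] W) {F : U → V → W → Z}
    (hF : ∀ v w, IsLinearMap k fun x => F x v w) : IsLinearMap k fun x => sw t (F x) := by
  constructor
  · intro a b
    simp only [sw, (hF _ _).map_add, Finset.sum_add_distrib]
  · intro c a
    simp only [sw, (hF _ _).map_smul, Finset.smul_sum]

theorem sw_mul {A : Type*} [Ring A] [Algebra k A] (t : V ⊗[k] W) (F : V → W → A) (a : A) :
    sw t F * a = sw t fun v w => F v w * a := by
  simp [sw, Finset.sum_mul]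

theorem mul_sw {A : Type*} [Ring A] [Algebra k A] (t : V ⊗[k] W) (F : V → W → A) (a : A) :
    a * sw t F = sw t fun v w => a * F v w := by
  simp [sw, Finset.mul_sum]

theorem sw_smul {A M : Type*} [Ring A] [Algebra k A] [AddCommGroup M] [Module k M]
    [Module A M] [IsScalarTower k A M] (t : V ⊗[k] W) (F : V → W → A) (m : M) :
    sw t F • m = sw t fun v w => F v w • m := by
  simp [sw, Finset.sum_smul]

theorem smul_sw {A M : Type*} [Ring A] [Algebra k A] [AddCommGroup M] [Module k M]
    [Module A M] [IsScalarTower k A M] (t : V ⊗[k] W) (F : V → W → M) (a : A) :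
    a • sw t F = sw t fun v w => a • F v w := by
  simp [sw, Finset.smul_sum]

theorem sw_tmul_right (t : V ⊗[k] W) (F : V → W → X) (y : Y) :
    sw t F ⊗ₜ[k] y = sw t fun v w => F v w ⊗ₜ[k] y := by
  simp [sw, TensorProduct.sum_tmul]

theorem tmul_sw (t : V ⊗[k] W) (F : V → W → X) (y : Y) :
    y ⊗ₜ[k] sw t F = sw t fun v w => y ⊗ₜ[k] F v w := by
  simp [sw, TensorProduct.tmul_sum]

end Sweedler

section

variable {k : Type*} [Field k]
variable {V W X Y Z : Type*} [AddCommGroup V] [Module k V]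
  [AddCommGroup W] [Module k W] [AddCommGroup X] [Module k X] [AddCommGroup Y] [Module k Y]
  [AddCommGroup Z] [Module k Z]

theorem linearEquiv_sw (φ : Z ≃ₗ[k] X) (t : V ⊗[k] W) (F : V → W → Z) :
    φ (sw t F) = sw t fun v w => φ (F v w) :=
  map_sw φ.toLinearMap t F

/-- The linear map on the tensor product given by a trilinear function. -/
noncomputable def Lin₃.lift {F : V → W → X → Z} (hF : Lin₃ k F) : V ⊗[k] (W ⊗[k] X) →ₗ[k] Z :=
  Lin₂.lift (F := fun v (t : W ⊗[k] X) => sw t (F v))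
    ⟨fun t => .sw_right t fun b c => hF.1 b c, fun a =>
      .sw_left isLinearMap_id (fun c => hF.2 a c) (fun b => hF.3 a b)⟩

theorem Lin₃.lift_tmul {F : V → W → X → Z} (hF : Lin₃ k F) (v : V) (w : W) (x : X) :
    hF.lift (v ⊗ₜ (w ⊗ₜ x)) = F v w x := by
  rw [Lin₃.lift, Lin₂.lift_tmul]
  exact (Lin₂.lift_eq_sw ⟨fun c => hF.2 v c, fun b => hF.3 v b⟩ _).symm.trans (Lin₂.lift_tmul _ _ _)

theorem lTensor_eq_sw (f : W →ₗ[k] X) (t : V ⊗[k] W) :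
    f.lTensor V t = sw t fun v w => v ⊗ₜ[k] f w := by
  conv_lhs => rw [← sw_tmul_self t]
  simp only [map_sw, LinearMap.lTensor_tmul]

theorem rTensor_eq_sw (f : V →ₗ[k] X) (t : V ⊗[k] W) :
    f.rTensor W t = sw t fun v w => f v ⊗ₜ[k] w := by
  conv_lhs => rw [← sw_tmul_self t]
  simp only [map_sw, LinearMap.rTensor_tmul]

end

theorem sw_linearMap_apply {k V W X Z : Type*} [Field k] [AddCommGroup V] [Module k V]
    [AddCommGroup W] [Module k W] [AddCommGroup X] [Module k X] [AddCommGroup Z] [Module k Z]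
    (t : V ⊗[k] W) (F : V → W → X →ₗ[k] Z) (x : X) : sw t F x = sw t fun v w => F v w x := by
  simp [sw]

section

variable {k V W Z : Type*} [Field k] [AddCommGroup V] [Module k V] [AddCommGroup W] [Module k W]
  [AddCommGroup Z] [Module k Z]

theorem isLinearMap_auto {F : V → Z} (hF : IsLinearMap k F := by
      repeat' first
        | exact isLinearMap_id | intro _ | apply Lin₂.mk | apply Lin₃.mk
        | apply Lin₄.mk | apply IsLinearMap.sw_right
        | apply IsLinearMap.sw_left | apply IsLinearMap.linearMap_apply
        | apply IsLinearMap.mul_const | apply IsLinearMap.const_mul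
        | apply IsLinearMap.smul_const | apply IsLinearMap.const_smul
        | apply IsLinearMap.tmul_const | apply IsLinearMap.const_tmul) : IsLinearMap k F := hF

theorem lin₂_auto {F : V → W → Z} (hF : Lin₂ k F := by
      repeat' first
        | exact isLinearMap_id | intro _ | apply Lin₂.mk | apply Lin₃.mk
        | apply Lin₄.mk | apply IsLinearMap.sw_right
        | apply IsLinearMap.sw_left | apply IsLinearMap.linearMap_apply
        | apply IsLinearMap.mul_const | apply IsLinearMap.const_mul
        | apply IsLinearMap.smul_const | apply IsLinearMap.const_smul
        | apply IsLinearMap.tmul_const | apply IsLinearMap.const_tmul) : Lin₂ k F := hF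

theorem sw_tmul (v : V) (w : W) {F : V → W → Z} (hF : Lin₂ k F := by
      repeat' first
        | exact isLinearMap_id | intro _ | apply Lin₂.mk | apply Lin₃.mk
        | apply Lin₄.mk | apply IsLinearMap.sw_right
        | apply IsLinearMap.sw_left | apply IsLinearMap.linearMap_apply
        | apply IsLinearMap.mul_const | apply IsLinearMap.const_mul
        | apply IsLinearMap.smul_const | apply IsLinearMap.const_smul
        | apply IsLinearMap.tmul_const | apply IsLinearMap.const_tmul) : sw (v ⊗ₜ[k] w) F = F v w := by
  rw [← hF.lift_eq_sw, hF.lift_tmul]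

end

section CoalgebraSweedler

variable {k C Z : Type*} [Field k] [AddCommGroup C] [Module k C] [Coalgebra k C]
  [AddCommGroup Z] [Module k Z]

theorem sw_comul_counit_left (y : C) {F : C → Z} (hF : IsLinearMap k F := by
      repeat' first
        | exact isLinearMap_id | intro _ | apply Lin₂.mk | apply Lin₃.mk
        | apply Lin₄.mk | apply IsLinearMap.sw_right
        | apply IsLinearMap.sw_left | apply IsLinearMap.linearMap_apply
        | apply IsLinearMap.mul_const | apply IsLinearMap.const_mul
        | apply IsLinearMap.smul_const | apply IsLinearMap.const_smul
        | apply IsLinearMap.tmul_const | apply IsLinearMap.const_tmul) :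
    (sw (comul (R := k) y) fun a b => counit (R := k) a • F b) = F y := by
  have hF' : Lin₂ k fun (a : k) (b : C) => a • F b :=
    ⟨fun b => isLinearMap_id.smul_const _, fun a => hF.const_smul a⟩
  have := congrArg hF'.lift (Coalgebra.rTensor_counit_comul (R := k) y)
  rw [hF'.lift_eq_sw, hF'.lift_tmul, one_smul] at this
  rw [← this, LinearMap.rTensor, sw_map _ _ _ hF']
  rfl

theorem sw_comul_counit_right (y : C) {F : C → Z} (hF : IsLinearMap k F := by
      repeat' first
        | exact isLinearMap_id | intro _ | apply Lin₂.mk | apply Lin₃.mk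
        | apply Lin₄.mk | apply IsLinearMap.sw_right
        | apply IsLinearMap.sw_left | apply IsLinearMap.linearMap_apply
        | apply IsLinearMap.mul_const | apply IsLinearMap.const_mul
        | apply IsLinearMap.smul_const | apply IsLinearMap.const_smul
        | apply IsLinearMap.tmul_const | apply IsLinearMap.const_tmul) :
    (sw (comul (R := k) y) fun a b => counit (R := k) b • F a) = F y := by
  have hF' : Lin₂ k fun (b : C) (a : k) => a • F b :=
    ⟨fun a => hF.const_smul a, fun b => isLinearMap_id.smul_const _⟩
  have := congrArg hF'.lift (Coalgebra.lTensor_counit_comul (R := k) y)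
  rw [hF'.lift_eq_sw, hF'.lift_tmul, one_smul] at this
  rw [← this, LinearMap.lTensor, sw_map _ _ _ hF']
  rfl

end CoalgebraSweedler

section CoalgebraSweedler

variable {k C M Z : Type*} [Field k] [AddCommGroup C] [Module k C] [Coalgebra k C]
  [AddCommGroup M] [Module k M] [LeftComodule k C M] [AddCommGroup Z] [Module k Z]

omit [LeftComodule k C M] [AddCommGroup M] [Module k M] in
theorem sw_comul_assoc (y : C) {F : C → C → C → Z} (hF : Lin₃ k F := by
      repeat' first
        | exact isLinearMap_id | intro _ | apply Lin₂.mk | apply Lin₃.mk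
        | apply Lin₄.mk | apply IsLinearMap.sw_right
        | apply IsLinearMap.sw_left | apply IsLinearMap.linearMap_apply
        | apply IsLinearMap.mul_const | apply IsLinearMap.const_mul
        | apply IsLinearMap.smul_const | apply IsLinearMap.const_smul
        | apply IsLinearMap.tmul_const | apply IsLinearMap.const_tmul) :
    (sw (comul (R := k) y) fun a b => sw (comul (R := k) a) fun a₁ a₂ => F a₁ a₂ b) =
      sw (comul (R := k) y) fun a b => sw (comul (R := k) b) fun b₁ b₂ => F a b₁ b₂ := by
  have h := congrArg hF.lift (Coalgebra.coassoc_apply (R := k) y)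
  rw [lTensor_eq_sw, rTensor_eq_sw, linearEquiv_sw, map_sw, map_sw] at h
  have e : ∀ a b : C, hF.lift (TensorProduct.assoc k C C C (comul (R := k) a ⊗ₜ[k] b)) =
      sw (comul (R := k) a) fun a₁ a₂ => F a₁ a₂ b := fun a b => by
    conv_lhs => rw [← sw_tmul_self (comul (R := k) a)]
    simp only [sw_tmul_right, linearEquiv_sw, map_sw, TensorProduct.assoc_tmul, hF.lift_tmul]
  have e' : ∀ a b : C, hF.lift (a ⊗ₜ[k] (comul (R := k) b)) =
      sw (comul (R := k) b) fun b₁ b₂ => F a b₁ b₂ := fun a b => by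
    conv_lhs => rw [← sw_tmul_self (comul (R := k) b)]
    simp only [tmul_sw, map_sw, hF.lift_tmul]
  simpa only [e, e'] using h

omit [LeftComodule k C M] [AddCommGroup M] [Module k M] in
theorem sw_comul_comul (y : C) {F : C → C → C → C → Z} (hF : Lin₄ k F := by
      repeat' first
        | exact isLinearMap_id | intro _ | apply Lin₂.mk | apply Lin₃.mk
        | apply Lin₄.mk | apply IsLinearMap.sw_right
        | apply IsLinearMap.sw_left | apply IsLinearMap.linearMap_apply
        | apply IsLinearMap.mul_const | apply IsLinearMap.const_mul
        | apply IsLinearMap.smul_const | apply IsLinearMap.const_smul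
        | apply IsLinearMap.tmul_const | apply IsLinearMap.const_tmul) :
    (sw (comul (R := k) y) fun a b => sw (comul (R := k) a) fun a₁ a₂ =>
        sw (comul (R := k) b) fun b₁ b₂ => F a₁ a₂ b₁ b₂) =
      sw (comul (R := k) y) fun a c => sw (comul (R := k) c) fun b d =>
        sw (comul (R := k) b) fun b₁ b₂ => F a b₁ b₂ d := by
  rw [sw_comul_assoc y (F := fun a₁ a₂ b => sw (comul (R := k) b) fun b₁ b₂ => F a₁ a₂ b₁ b₂)
    ⟨fun b c => .sw_right _ fun _ _ => hF.1 _ _ _, fun b c => .sw_right _ fun _ _ => hF.2 _ _ _,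
      fun a b => .sw_left (LinearMap.isLinear _) (fun _ => hF.3 _ _ _) (fun _ => hF.4 _ _ _)⟩]
  exact sw_congr fun a c => (sw_comul_assoc c (F := fun a₂ b₁ b₂ => F a a₂ b₁ b₂)
    ⟨fun _ _ => hF.2 _ _ _, fun _ _ => hF.3 _ _ _, fun _ _ => hF.4 _ _ _⟩).symm

/-- Coassociativity of a coaction in Sweedler form. -/
theorem sw_coact_assoc (m : M) {F : C → C → M → Z} (hF : Lin₃ k F := by
      repeat' first
        | exact isLinearMap_id | intro _ | apply Lin₂.mk | apply Lin₃.mk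
        | apply Lin₄.mk | apply IsLinearMap.sw_right
        | apply IsLinearMap.sw_left | apply IsLinearMap.linearMap_apply
        | apply IsLinearMap.mul_const | apply IsLinearMap.const_mul
        | apply IsLinearMap.smul_const | apply IsLinearMap.const_smul
        | apply IsLinearMap.tmul_const | apply IsLinearMap.const_tmul) :
    (sw (LeftComodule.coact (k := k) (C := C) m) fun a b =>
        sw (comul (R := k) a) fun a₁ a₂ => F a₁ a₂ b) =
      sw (LeftComodule.coact (k := k) (C := C) m) fun a b =>
        sw (LeftComodule.coact (k := k) (C := C) b) fun b₁ b₂ => F a b₁ b₂ := by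
  have h := congrArg hF.lift (LinearMap.congr_fun (LeftComodule.coassoc (k := k) (C := C)) m)
  simp only [LinearMap.comp_apply, LinearEquiv.coe_coe] at h
  rw [lTensor_eq_sw, rTensor_eq_sw, linearEquiv_sw, map_sw, map_sw] at h
  have e : ∀ (a : C) (b : M), hF.lift (TensorProduct.assoc k C C M (comul (R := k) a ⊗ₜ[k] b)) =
      sw (comul (R := k) a) fun a₁ a₂ => F a₁ a₂ b := fun a b => by
    conv_lhs => rw [← sw_tmul_self (comul (R := k) a)]
    simp only [sw_tmul_right, linearEquiv_sw, map_sw, TensorProduct.assoc_tmul, hF.lift_tmul]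
  have e' : ∀ (a : C) (b : M), hF.lift (a ⊗ₜ[k] (LeftComodule.coact (k := k) (C := C) b)) =
      sw (LeftComodule.coact (k := k) (C := C) b) fun b₁ b₂ => F a b₁ b₂ := fun a b => by
    conv_lhs => rw [← sw_tmul_self (LeftComodule.coact (k := k) (C := C) b)]
    simp only [tmul_sw, map_sw, hF.lift_tmul]
  simpa only [e, e'] using h

theorem sw_coact_coact (m : M) {F : C → C → C → M → Z} (hF : Lin₄ k F := by
      repeat' first
        | exact isLinearMap_id | intro _ | apply Lin₂.mk | apply Lin₃.mk
        | apply Lin₄.mk | apply IsLinearMap.sw_right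
        | apply IsLinearMap.sw_left | apply IsLinearMap.linearMap_apply
        | apply IsLinearMap.mul_const | apply IsLinearMap.const_mul
        | apply IsLinearMap.smul_const | apply IsLinearMap.const_smul
        | apply IsLinearMap.tmul_const | apply IsLinearMap.const_tmul) :
    (sw (LeftComodule.coact (k := k) (C := C) m) fun g a => sw (comul (R := k) g) fun g₁ g₂ =>
        sw (LeftComodule.coact (k := k) (C := C) a) fun e c => F g₁ g₂ e c) =
      sw (LeftComodule.coact (k := k) (C := C) m) fun g a =>
        sw (LeftComodule.coact (k := k) (C := C) a) fun f c =>
          sw (comul (R := k) f) fun g₂ e => F g g₂ e c := by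
  rw [sw_coact_assoc m (F := fun g₁ g₂ a =>
    sw (LeftComodule.coact (k := k) (C := C) a) fun e c => F g₁ g₂ e c)
    ⟨fun b c => .sw_right _ fun _ _ => hF.1 _ _ _, fun b c => .sw_right _ fun _ _ => hF.2 _ _ _,
      fun a b => .sw_left (LinearMap.isLinear _) (fun _ => hF.3 _ _ _) (fun _ => hF.4 _ _ _)⟩]
  exact sw_congr fun g a => (sw_coact_assoc a (F := fun g₂ e c => F g g₂ e c)
    ⟨fun _ _ => hF.2 _ _ _, fun _ _ => hF.3 _ _ _, fun _ _ => hF.4 _ _ _⟩).symm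

theorem sw_coact_counit (m : M) {F : M → Z} (hF : IsLinearMap k F := by
      repeat' first
        | exact isLinearMap_id | intro _ | apply Lin₂.mk | apply Lin₃.mk
        | apply Lin₄.mk | apply IsLinearMap.sw_right
        | apply IsLinearMap.sw_left | apply IsLinearMap.linearMap_apply
        | apply IsLinearMap.mul_const | apply IsLinearMap.const_mul
        | apply IsLinearMap.smul_const | apply IsLinearMap.const_smul
        | apply IsLinearMap.tmul_const | apply IsLinearMap.const_tmul) :
    (sw (LeftComodule.coact (k := k) (C := C) m) fun a b => counit (R := k) a • F b) = F m := by
  have h := LinearMap.congr_fun (LeftComodule.counit_coact (k := k) (C := C)) m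
  simp only [LinearMap.comp_apply, LinearEquiv.coe_coe, LinearMap.id_apply, rTensor_eq_sw,
    linearEquiv_sw, TensorProduct.lid_tmul] at h
  have := congrArg hF.mk' h
  simpa only [map_sw, IsLinearMap.mk'_apply, hF.map_smul] using this

end CoalgebraSweedler

section HopfSweedler

variable {k H Z : Type*} [Field k] [Ring H] [HopfAlgebra k H] [AddCommGroup Z] [Module k Z]

theorem sw_comul_mul (g h : H) {F : H → H → Z} (hF : Lin₂ k F := by
      repeat' first
        | exact isLinearMap_id | intro _ | apply Lin₂.mk | apply Lin₃.mk
        | apply Lin₄.mk | apply IsLinearMap.sw_right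
        | apply IsLinearMap.sw_left | apply IsLinearMap.linearMap_apply
        | apply IsLinearMap.mul_const | apply IsLinearMap.const_mul
        | apply IsLinearMap.smul_const | apply IsLinearMap.const_smul
        | apply IsLinearMap.tmul_const | apply IsLinearMap.const_tmul) :
    sw (comul (R := k) (g * h)) F = sw (comul (R := k) g) fun g₁ g₂ =>
      sw (comul (R := k) h) fun h₁ h₂ => F (g₁ * h₁) (g₂ * h₂) := by
  have e : comul (R := k) (g * h) = sw (comul (R := k) g) fun g₁ g₂ =>
      sw (comul (R := k) h) fun h₁ h₂ => (g₁ * h₁) ⊗ₜ[k] (g₂ * h₂) := by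
    rw [Bialgebra.comul_mul]
    conv_lhs => rw [← sw_tmul_self (comul (R := k) g), ← sw_tmul_self (comul (R := k) h)]
    simp only [sw_mul]
    simp only [mul_sw, Algebra.TensorProduct.tmul_mul_tmul]
  rw [← hF.lift_eq_sw, e]
  simp only [map_sw, hF.lift_tmul]

theorem sw_antipode_mul (h : H) {F : H → Z} (hF : IsLinearMap k F := by
      repeat' first
        | exact isLinearMap_id | intro _ | apply Lin₂.mk | apply Lin₃.mk
        | apply Lin₄.mk | apply IsLinearMap.sw_right
        | apply IsLinearMap.sw_left | apply IsLinearMap.linearMap_apply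
        | apply IsLinearMap.mul_const | apply IsLinearMap.const_mul
        | apply IsLinearMap.smul_const | apply IsLinearMap.const_smul
        | apply IsLinearMap.tmul_const | apply IsLinearMap.const_tmul) :
    (sw (comul (R := k) h) fun a b => F (HopfAlgebra.antipode k a * b)) =
      counit (R := k) h • F 1 := by
  have := congrArg hF.mk' (HopfAlgebra.mul_antipode_rTensor_comul_apply (R := k) h)
  simpa only [rTensor_eq_sw, map_sw, LinearMap.mul'_apply, IsLinearMap.mk'_apply,
    Algebra.algebraMap_eq_smul_one, hF.map_smul] using this

theorem sw_mul_antipode (h : H) {F : H → Z} (hF : IsLinearMap k F := by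
      repeat' first
        | exact isLinearMap_id | intro _ | apply Lin₂.mk | apply Lin₃.mk
        | apply Lin₄.mk | apply IsLinearMap.sw_right
        | apply IsLinearMap.sw_left | apply IsLinearMap.linearMap_apply
        | apply IsLinearMap.mul_const | apply IsLinearMap.const_mul
        | apply IsLinearMap.smul_const | apply IsLinearMap.const_smul
        | apply IsLinearMap.tmul_const | apply IsLinearMap.const_tmul) :
    (sw (comul (R := k) h) fun a b => F (a * HopfAlgebra.antipode k b)) =
      counit (R := k) h • F 1 := by
  have := congrArg hF.mk' (HopfAlgebra.mul_antipode_lTensor_comul_apply (R := k) h)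
  simpa only [lTensor_eq_sw, map_sw, LinearMap.mul'_apply, IsLinearMap.mk'_apply,
    Algebra.algebraMap_eq_smul_one, hF.map_smul] using this

end HopfSweedler

section HopfSweedler

open HopfAlgebra

variable {k H Z : Type*} [Field k] [Ring H] [HopfAlgebra k H] [AddCommGroup Z] [Module k Z]

theorem comul_antipode (h : H) : comul (R := k) (antipode k h) =
    sw (comul (R := k) h) fun a b => antipode k b ⊗ₜ[k] antipode k a := by
  have hG : IsLinearMap k fun h : H =>
      sw (comul (R := k) h) fun a b => antipode k b ⊗ₜ[k] antipode k a := isLinearMap_auto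
  have key : WithConv.toConv (hG.mk' _) * WithConv.toConv (comul (R := k) (A := H)) = 1 := by
    ext h
    rw [LinearMap.convMul_apply]
    change _ = algebraMap k (H ⊗[k] H) (counit (R := k) h)
    conv_lhs => rw [← sw_tmul_self (comul (R := k) h)]
    simp only [map_sw, TensorProduct.map_tmul, IsLinearMap.mk'_apply, LinearMap.mul'_apply]
    calc _ = sw (comul (R := k) h) fun a b => sw (comul (R := k) a) fun a₁ a₂ =>
            sw (comul (R := k) b) fun b₁ b₂ =>
              (antipode k a₂ * b₁) ⊗ₜ[k] (antipode k a₁ * b₂) := by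
          refine sw_congr fun a b => ?_
          conv_lhs => rw [← sw_tmul_self (comul (R := k) b)]
          simp only [sw_mul]
          simp only [mul_sw, Algebra.TensorProduct.tmul_mul_tmul]
      _ = sw (comul (R := k) h) fun a b => sw (comul (R := k) b) fun a₁ b =>
            sw (comul (R := k) b) fun b₁ b₂ =>
              (antipode k a₁ * b₁) ⊗ₜ[k] (antipode k a * b₂) := sw_comul_assoc h
      _ = sw (comul (R := k) h) fun a b => (1 : H) ⊗ₜ[k] (antipode k a * b) := by
          refine sw_congr fun a b => ?_
          calc _ = sw (comul (R := k) b) fun b c => sw (comul (R := k) b) fun b₁ b₂ =>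
                  (antipode k b₁ * b₂) ⊗ₜ[k] (antipode k a * c) := (sw_comul_assoc b).symm
            _ = sw (comul (R := k) b) fun b c => counit (R := k) b • (1 : H) ⊗ₜ[k]
                  (antipode k a * c) := sw_congr fun b c =>
                  sw_antipode_mul b (F := fun z => z ⊗ₜ[k] (antipode k a * c))
            _ = _ := sw_comul_counit_left b (by
              apply IsLinearMap.const_tmul; exact isLinearMap_id.const_mul _)
      _ = counit (R := k) h • (1 : H) ⊗ₜ[k] (1 : H) :=
          sw_antipode_mul h (F := fun z => (1 : H) ⊗ₜ[k] z)
      _ = _ := by rw [Algebra.algebraMap_eq_smul_one, Algebra.TensorProduct.one_def]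
  have := left_inv_eq_right_inv key (LinearMap.comul_right_inv (R := k) (C := H))
  exact (LinearMap.congr_fun (congrArg WithConv.ofConv this) h).symm

theorem sw_comul_antipode (h : H) {F : H → H → Z} (hF : Lin₂ k F := by
      repeat' first
        | exact isLinearMap_id | intro _ | apply Lin₂.mk | apply Lin₃.mk
        | apply Lin₄.mk | apply IsLinearMap.sw_right
        | apply IsLinearMap.sw_left | apply IsLinearMap.linearMap_apply
        | apply IsLinearMap.mul_const | apply IsLinearMap.const_mul
        | apply IsLinearMap.smul_const | apply IsLinearMap.const_smul
        | apply IsLinearMap.tmul_const | apply IsLinearMap.const_tmul) :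
    sw (comul (R := k) (antipode k h)) F =
      sw (comul (R := k) h) fun a b => F (antipode k b) (antipode k a) := by
  rw [comul_antipode, sw_sw _ _ _ hF]

variable (k H) in
/-- The inverse of a bijective antipode. -/
noncomputable def antipodeInv (hH : Function.Bijective (antipode k (A := H))) : H →ₗ[k] H :=
  (LinearEquiv.ofBijective (antipode k (A := H)) hH).symm

variable (hH : Function.Bijective (antipode k (A := H)))

theorem antipode_antipodeInv (h : H) : antipode k (antipodeInv k H hH h) = h :=
  (LinearEquiv.ofBijective (antipode k (A := H)) hH).apply_symm_apply h

theorem antipodeInv_antipode (h : H) : antipodeInv k H hH (antipode k h) = h :=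
  (LinearEquiv.ofBijective (antipode k (A := H)) hH).symm_apply_apply h

theorem antipodeInv_mul (g h : H) :
    antipodeInv k H hH (g * h) = antipodeInv k H hH h * antipodeInv k H hH g := by
  apply hH.1
  rw [antipode_mul_antidistrib]
  simp only [antipode_antipodeInv]

theorem antipodeInv_one : antipodeInv k H hH 1 = 1 := by
  apply hH.1
  rw [antipode_antipodeInv, antipode_one]

theorem sw_comul_antipodeInv (h : H) {F : H → H → Z} (hF : Lin₂ k F := by
      repeat' first
        | exact isLinearMap_id | intro _ | apply Lin₂.mk | apply Lin₃.mk
        | apply Lin₄.mk | apply IsLinearMap.sw_right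
        | apply IsLinearMap.sw_left | apply IsLinearMap.linearMap_apply
        | apply IsLinearMap.mul_const | apply IsLinearMap.const_mul
        | apply IsLinearMap.smul_const | apply IsLinearMap.const_smul
        | apply IsLinearMap.tmul_const | apply IsLinearMap.const_tmul) :
    sw (comul (R := k) (antipodeInv k H hH h)) F =
      sw (comul (R := k) h) fun a b => F (antipodeInv k H hH b) (antipodeInv k H hH a) := by
  have hF' : Lin₂ k fun a b => F (antipodeInv k H hH b) (antipodeInv k H hH a) :=
    ⟨fun a => ((hF.2 _).mk' _ ∘ₗ antipodeInv k H hH).isLinear,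
      fun a => ((hF.1 _).mk' _ ∘ₗ antipodeInv k H hH).isLinear⟩
  conv_rhs => rw [← antipode_antipodeInv hH h, sw_comul_antipode _ hF']
  simp only [antipodeInv_antipode]

theorem sw_antipodeInv_mul (h : H) {F : H → Z} (hF : IsLinearMap k F := by
      repeat' first
        | exact isLinearMap_id | intro _ | apply Lin₂.mk | apply Lin₃.mk
        | apply Lin₄.mk | apply IsLinearMap.sw_right
        | apply IsLinearMap.sw_left | apply IsLinearMap.linearMap_apply
        | apply IsLinearMap.mul_const | apply IsLinearMap.const_mul
        | apply IsLinearMap.smul_const | apply IsLinearMap.const_smul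
        | apply IsLinearMap.tmul_const | apply IsLinearMap.const_tmul) :
    (sw (comul (R := k) h) fun a b => F (antipodeInv k H hH b * a)) =
      counit (R := k) h • F 1 := by
  have e : ∀ a b : H, antipodeInv k H hH b * a =
      antipodeInv k H hH (antipode k a * b) := fun a b => by
    rw [antipodeInv_mul, antipodeInv_antipode]
  simp only [e]
  rw [sw_antipode_mul h (F := fun a => F (antipodeInv k H hH a))
    (((hF.mk' _) ∘ₗ antipodeInv k H hH).isLinear), antipodeInv_one]

theorem sw_mul_antipodeInv (h : H) {F : H → Z} (hF : IsLinearMap k F := by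
      repeat' first
        | exact isLinearMap_id | intro _ | apply Lin₂.mk | apply Lin₃.mk
        | apply Lin₄.mk | apply IsLinearMap.sw_right
        | apply IsLinearMap.sw_left | apply IsLinearMap.linearMap_apply
        | apply IsLinearMap.mul_const | apply IsLinearMap.const_mul
        | apply IsLinearMap.smul_const | apply IsLinearMap.const_smul
        | apply IsLinearMap.tmul_const | apply IsLinearMap.const_tmul) :
    (sw (comul (R := k) h) fun a b => F (b * antipodeInv k H hH a)) =
      counit (R := k) h • F 1 := by
  have e : ∀ a b : H, b * antipodeInv k H hH a =
      antipodeInv k H hH (a * antipode k b) := fun a b => by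
    rw [antipodeInv_mul, antipodeInv_antipode]
  simp only [e]
  rw [sw_mul_antipode h (F := fun a => F (antipodeInv k H hH a))
    (((hF.mk' _) ∘ₗ antipodeInv k H hH).isLinear), antipodeInv_one]

end HopfSweedler

section BraidedSweedler

variable {k H R Z : Type*} [Field k] [Ring H] [HopfAlgebra k H]
  [Ring R] [Algebra k R] [Coalgebra k R] [Module H R] [IsScalarTower k H R]
  [YetterDrinfeldModule k H R] [AddCommGroup Z] [Module k Z]

local notation "Δ" => comul (R := k)
local notation "ε" => counit (R := k)
local notation "ρ" => LeftComodule.coact (k := k) (C := H)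
local notation "𝖲" => HopfAlgebra.antipode k (A := H)
local notation "σ" => BraidedHopfAlgebra.antipode k H (R := R)

omit [Coalgebra k R] [YetterDrinfeldModule k H R] in
theorem ydMap_eq_sw (a : H) (t : H ⊗[k] H) (w : H ⊗[k] R) :
    ydMap k H R (a ⊗ₜ t) w =
      sw t fun b c => sw w fun x v => (a * x * 𝖲 c) ⊗ₜ[k] (b • v) := by
  conv_lhs => rw [← sw_tmul_self t, ← sw_tmul_self w]
  simp only [map_sw, tmul_sw]
  simp only [sw_linearMap_apply, ydMap_tmul]
  exact sw_comm _ _ _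

omit [Coalgebra k R] [YetterDrinfeldModule k H R] in
theorem tensorAct_eq_sw (h : H) (t : R ⊗[k] R) :
    tensorAct k H R R h t = sw (Δ h) fun a b => sw t fun v w => (a • v) ⊗ₜ[k] (b • w) := by
  rw [tensorAct, LinearMap.comp_apply]
  conv_lhs => rw [← sw_tmul_self t, ← sw_tmul_self (Δ h)]
  simp only [map_sw, sw_linearMap_apply, TensorProduct.map₂_apply_tmul, TensorProduct.map_tmul]
  exact sw_comm _ _ _

omit [Coalgebra k R] in
theorem tensorCoact_eq_sw (t : R ⊗[k] R) :
    tensorCoact k H R R t = sw t fun v w => sw (ρ v) fun g a => sw (ρ w) fun h b =>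
      (g * h) ⊗ₜ[k] (a ⊗ₜ[k] b) := by
  have e : ∀ v w : R, tensorCoact k H R R (v ⊗ₜ w) = sw (ρ v) fun g a => sw (ρ w) fun h b =>
      (g * h) ⊗ₜ[k] (a ⊗ₜ[k] b) := fun v w => by
    simp only [tensorCoact, LinearMap.comp_apply, TensorProduct.map_tmul, LinearEquiv.coe_coe]
    conv_lhs => rw [← sw_tmul_self (ρ v), ← sw_tmul_self (ρ w)]
    simp only [sw_tmul_right]
    simp only [tmul_sw, map_sw, linearEquiv_sw, TensorProduct.tensorTensorTensorComm_tmul,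
      LinearMap.rTensor_tmul, LinearMap.mul'_apply]
  conv_lhs => rw [← sw_tmul_self t]
  simp only [map_sw, e]

omit [Coalgebra k R] in
theorem ydBraiding_eq_sw (v w : R) :
    ydBraiding k H R R (v ⊗ₜ w) = sw (ρ v) fun g a => (g • w) ⊗ₜ[k] a := by
  simp only [ydBraiding, LinearMap.comp_apply, LinearMap.rTensor_tmul, LinearEquiv.coe_coe]
  conv_lhs => rw [← sw_tmul_self (ρ v)]
  simp only [sw_tmul_right]
  simp only [map_sw, linearEquiv_sw, TensorProduct.rightComm_tmul, LinearMap.rTensor_tmul,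
    TensorProduct.lift.tmul]
  rfl

omit [Coalgebra k R] in
theorem braidedMul_eq_sw (t t' : R ⊗[k] R) :
    braidedMul k H R (t ⊗ₜ t') = sw t fun a b => sw t' fun c d => sw (ρ b) fun h z =>
      (a * (h • c)) ⊗ₜ[k] (z * d) := by
  have e : ∀ a b c d : R, braidedMul k H R ((a ⊗ₜ b) ⊗ₜ (c ⊗ₜ d)) = sw (ρ b) fun h z =>
      (a * (h • c)) ⊗ₜ[k] (z * d) := fun a b c d => by
    simp only [braidedMul, LinearMap.comp_apply, LinearEquiv.coe_coe, TensorProduct.assoc_tmul,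
      LinearMap.lTensor_tmul, TensorProduct.assoc_symm_tmul, LinearMap.rTensor_tmul,
      ydBraiding_eq_sw]
    simp only [sw_tmul_right]
    simp only [map_sw, linearEquiv_sw, tmul_sw, TensorProduct.assoc_tmul,
      TensorProduct.assoc_symm_tmul, TensorProduct.map_tmul, LinearMap.mul'_apply]
  conv_lhs => rw [← sw_tmul_self t, ← sw_tmul_self t']
  simp only [sw_tmul_right]
  simp only [tmul_sw, map_sw, e]

omit [Coalgebra k R] in
theorem sw_coact_smul (h : H) (v : R) {F : H → R → Z} (hF : Lin₂ k F := by
      repeat' first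
        | exact isLinearMap_id | intro _ | apply Lin₂.mk | apply Lin₃.mk
        | apply Lin₄.mk | apply IsLinearMap.sw_right
        | apply IsLinearMap.sw_left | apply IsLinearMap.linearMap_apply
        | apply IsLinearMap.mul_const | apply IsLinearMap.const_mul
        | apply IsLinearMap.smul_const | apply IsLinearMap.const_smul
        | apply IsLinearMap.tmul_const | apply IsLinearMap.const_tmul) :
    sw (ρ (h • v)) F = sw (Δ h) fun h₁ h' => sw (Δ h') fun h₂ h₃ => sw (ρ v) fun g w =>
      F (h₁ * g * 𝖲 h₃) (h₂ • w) := by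
  rw [← hF.lift_eq_sw, YetterDrinfeldModule.coact_smul, lTensor_eq_sw]
  simp only [map_sw, sw_linearMap_apply, ydMap_eq_sw, hF.lift_tmul]

variable [BraidedHopfAlgebra k H R]

theorem smul_mul_eq_sw (h : H) (x y : R) :
    h • (x * y) = sw (Δ h) fun h₁ h₂ => (h₁ • x) * (h₂ • y) := by
  rw [BraidedHopfAlgebra.smul_mul (k := k)]
  conv_lhs => rw [tensorAct_eq_sw]
  simp only [map_sw]
  refine sw_congr fun a b => ?_
  rw [← map_sw, sw_tmul x y (F := fun v w => (a • v) ⊗ₜ[k] (b • w)), LinearMap.mul'_apply]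

theorem sw_comul_smul (h : H) (x : R) {F : R → R → Z} (hF : Lin₂ k F := by
      repeat' first
        | exact isLinearMap_id | intro _ | apply Lin₂.mk | apply Lin₃.mk
        | apply Lin₄.mk | apply IsLinearMap.sw_right
        | apply IsLinearMap.sw_left | apply IsLinearMap.linearMap_apply
        | apply IsLinearMap.mul_const | apply IsLinearMap.const_mul
        | apply IsLinearMap.smul_const | apply IsLinearMap.const_smul
        | apply IsLinearMap.tmul_const | apply IsLinearMap.const_tmul) :
    sw (Δ (h • x)) F = sw (Δ h) fun h₁ h₂ => sw (Δ x) fun x₁ x₂ => F (h₁ • x₁) (h₂ • x₂) := by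
  rw [← hF.lift_eq_sw, BraidedHopfAlgebra.comul_smul, tensorAct_eq_sw]
  simp only [map_sw, hF.lift_tmul]

theorem sw_coact_comul (y : R) {F : H → R → R → Z} (hF : Lin₃ k F := by
      repeat' first
        | exact isLinearMap_id | intro _ | apply Lin₂.mk | apply Lin₃.mk
        | apply Lin₄.mk | apply IsLinearMap.sw_right
        | apply IsLinearMap.sw_left | apply IsLinearMap.linearMap_apply
        | apply IsLinearMap.mul_const | apply IsLinearMap.const_mul
        | apply IsLinearMap.smul_const | apply IsLinearMap.const_smul
        | apply IsLinearMap.tmul_const | apply IsLinearMap.const_tmul) :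
    (sw (ρ y) fun g z => sw (Δ z) fun z₁ z₂ => F g z₁ z₂) =
      sw (Δ y) fun y₁ y₂ => sw (ρ y₁) fun g a => sw (ρ y₂) fun h b => F (g * h) a b := by
  have h := congrArg hF.lift (BraidedHopfAlgebra.coact_comul (k := k) (H := H) y)
  rw [tensorCoact_eq_sw, lTensor_eq_sw] at h
  have e' : ∀ (a : H) (b : R), hF.lift (a ⊗ₜ[k] (Δ b)) =
      sw (Δ b) fun b₁ b₂ => F a b₁ b₂ := fun a b => by
    conv_lhs => rw [← sw_tmul_self (Δ b)]
    simp only [tmul_sw, map_sw, hF.lift_tmul]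
  simpa only [map_sw, hF.lift_tmul, e'] using h.symm

theorem sw_comul_braided (x y : R) {F : R → R → Z} (hF : Lin₂ k F := by
      repeat' first
        | exact isLinearMap_id | intro _ | apply Lin₂.mk | apply Lin₃.mk
        | apply Lin₄.mk | apply IsLinearMap.sw_right
        | apply IsLinearMap.sw_left | apply IsLinearMap.linearMap_apply
        | apply IsLinearMap.mul_const | apply IsLinearMap.const_mul
        | apply IsLinearMap.smul_const | apply IsLinearMap.const_smul
        | apply IsLinearMap.tmul_const | apply IsLinearMap.const_tmul) :
    sw (Δ (x * y)) F = sw (Δ x) fun x₁ x₂ => sw (Δ y) fun y₁ y₂ => sw (ρ x₂) fun h z =>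
      F (x₁ * (h • y₁)) (z * y₂) := by
  rw [← hF.lift_eq_sw, BraidedHopfAlgebra.comul_mul (H := H), braidedMul_eq_sw]
  simp only [map_sw, hF.lift_tmul]

theorem sw_braidedAntipode_mul (y : R) {F : R → Z} (hF : IsLinearMap k F := by
      repeat' first
        | exact isLinearMap_id | intro _ | apply Lin₂.mk | apply Lin₃.mk
        | apply Lin₄.mk | apply IsLinearMap.sw_right
        | apply IsLinearMap.sw_left | apply IsLinearMap.linearMap_apply
        | apply IsLinearMap.mul_const | apply IsLinearMap.const_mul
        | apply IsLinearMap.smul_const | apply IsLinearMap.const_smul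
        | apply IsLinearMap.tmul_const | apply IsLinearMap.const_tmul) :
    (sw (Δ y) fun a b => F (σ a * b)) = ε y • F 1 := by
  have := congrArg hF.mk' (BraidedHopfAlgebra.mul_antipode_rTensor_comul (k := k) (H := H) y)
  simpa only [rTensor_eq_sw, map_sw, LinearMap.mul'_apply, IsLinearMap.mk'_apply,
    Algebra.algebraMap_eq_smul_one, hF.map_smul] using this

theorem sw_mul_braidedAntipode (y : R) {F : R → Z} (hF : IsLinearMap k F := by
      repeat' first
        | exact isLinearMap_id | intro _ | apply Lin₂.mk | apply Lin₃.mk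
        | apply Lin₄.mk | apply IsLinearMap.sw_right
        | apply IsLinearMap.sw_left | apply IsLinearMap.linearMap_apply
        | apply IsLinearMap.mul_const | apply IsLinearMap.const_mul
        | apply IsLinearMap.smul_const | apply IsLinearMap.const_smul
        | apply IsLinearMap.tmul_const | apply IsLinearMap.const_tmul) :
    (sw (Δ y) fun a b => F (a * σ b)) = ε y • F 1 := by
  have := congrArg hF.mk' (BraidedHopfAlgebra.mul_antipode_lTensor_comul (k := k) (H := H) y)
  simpa only [lTensor_eq_sw, map_sw, LinearMap.mul'_apply, IsLinearMap.mk'_apply,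
    Algebra.algebraMap_eq_smul_one, hF.map_smul] using this

theorem sw_coact_braidedAntipode (y : R) {F : H → R → Z} (hF : Lin₂ k F := by
      repeat' first
        | exact isLinearMap_id | intro _ | apply Lin₂.mk | apply Lin₃.mk
        | apply Lin₄.mk | apply IsLinearMap.sw_right
        | apply IsLinearMap.sw_left | apply IsLinearMap.linearMap_apply
        | apply IsLinearMap.mul_const | apply IsLinearMap.const_mul
        | apply IsLinearMap.smul_const | apply IsLinearMap.const_smul
        | apply IsLinearMap.tmul_const | apply IsLinearMap.const_tmul) :
    sw (ρ (σ y)) F = sw (ρ y) fun g z => F g (σ z) := by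
  rw [← hF.lift_eq_sw, BraidedHopfAlgebra.antipode_coact, lTensor_eq_sw]
  simp only [map_sw, hF.lift_tmul]

end BraidedSweedler

section BraidedAntipode

variable {k H R Z : Type*} [Field k] [Ring H] [HopfAlgebra k H]
  [Ring R] [Algebra k R] [Coalgebra k R] [Module H R] [IsScalarTower k H R]
  [YetterDrinfeldModule k H R] [AddCommGroup Z] [Module k Z] [BraidedHopfAlgebra k H R]

local notation "Δ" => comul (R := k)
local notation "ε" => counit (R := k)
local notation "ρ" => LeftComodule.coact (k := k) (C := H)
local notation "𝖲" => HopfAlgebra.antipode k (A := H)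
local notation "σ" => BraidedHopfAlgebra.antipode k H (R := R)

/-- Right multiplication of `u ⊗ v` by `Δ y₍₁₎`, followed by right multiplication by `1 ⊗ σ y₍₂₎` and
`σ y₍₃₎ ⊗ 1`, for the braided product of `R ⊗ R`. -/
theorem sw_braidedMul_cancel (u v y : R) :
    (sw (Δ y) fun a b => sw (Δ a) fun a₁ a₂ => sw (Δ b) fun b₁ b₂ => sw (ρ v) fun h z =>
      sw (ρ (z * a₂ * σ b₁)) fun g w => (u * (h • a₁) * (g • σ b₂)) ⊗ₜ[k] w) =
      ε y • u ⊗ₜ[k] v := by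
  calc _ = sw (Δ y) fun a c => sw (Δ c) fun b d => sw (Δ b) fun b₁ b₂ => sw (ρ v) fun h z =>
            sw (ρ (z * (b₁ * σ b₂))) fun g w => (u * (h • a) * (g • σ d)) ⊗ₜ[k] w := by
        simp only [← mul_assoc]
        exact sw_comul_comul y
    _ = sw (Δ y) fun a c => sw (Δ c) fun b d => ε b • sw (ρ v) fun h z =>
            sw (ρ (z * 1)) fun g w => (u * (h • a) * (g • σ d)) ⊗ₜ[k] w :=
        sw_congr fun a c => sw_congr fun b d => sw_mul_braidedAntipode b
          (F := fun m => sw (ρ v) fun h z =>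
            sw (ρ (z * m)) fun g w => (u * (h • a) * (g • σ d)) ⊗ₜ[k] w)
    _ = sw (Δ y) fun a d => sw (ρ v) fun h z =>
            sw (ρ z) fun g w => (u * (h • a) * (g • σ d)) ⊗ₜ[k] w := by
        simp only [mul_one]
        exact sw_congr fun a c => sw_comul_counit_left c
    _ = sw (Δ y) fun a d => sw (ρ v) fun h z => (u * (h • (a * σ d))) ⊗ₜ[k] z := by
        refine sw_congr fun a d => ?_
        rw [← sw_coact_assoc v (F := fun h g w => (u * (h • a) * (g • σ d)) ⊗ₜ[k] w)]
        simp only [mul_assoc, smul_mul_eq_sw (k := k), mul_sw, sw_tmul_right]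
    _ = ε y • sw (ρ v) fun h z => (u * (h • (1 : R))) ⊗ₜ[k] z :=
        sw_mul_braidedAntipode y (F := fun m => sw (ρ v) fun h z => (u * (h • m)) ⊗ₜ[k] z)
    _ = _ := by
        simp only [BraidedHopfAlgebra.smul_one (k := k), mul_smul_comm, mul_one,
          ← TensorProduct.smul_tmul']
        rw [sw_coact_counit v]

/-- A linear map `R → R ⊗ R` is determined by its braided convolution product with `Δ`. -/
theorem eq_of_braidedMul_comul_eq {A B : R →ₗ[k] R ⊗[k] R}
    (h : ∀ y, (sw (Δ y) fun a b => braidedMul k H R (A a ⊗ₜ Δ b)) =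
      sw (Δ y) fun a b => braidedMul k H R (B a ⊗ₜ Δ b)) : A = B := by
  have hG : ∀ b₁ b₂ : R, Lin₂ k fun u v : R =>
      sw (ρ (v * σ b₁)) fun g w => (u * (g • σ b₂)) ⊗ₜ[k] w := fun b₁ b₂ => lin₂_auto
  have key : ∀ (A : R →ₗ[k] R ⊗[k] R) (y : R), A y =
      sw (Δ y) fun c b => sw (Δ b) fun b₁ b₂ =>
        (hG b₁ b₂).lift (sw (Δ c) fun a a' => braidedMul k H R (A a ⊗ₜ Δ a')) := by
    intro A y
    simp only [map_sw, braidedMul_eq_sw, Lin₂.lift_tmul]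
    symm
    calc _ = sw (Δ y) fun a b => sw (Δ a) fun a₁ a₂ =>
              sw (Δ b) fun b₁ b₂ => sw (A a₁) fun u v => sw (Δ a₂) fun c d =>
                sw (ρ v) fun h z => sw (ρ (z * d * σ b₁)) fun g w =>
                  (u * (h • c) * (g • σ b₂)) ⊗ₜ[k] w :=
          sw_congr fun a b => sw_comm _ _ _
      _ = sw (Δ y) fun a b => sw (Δ b) fun b b' =>
              sw (Δ b') fun b₁ b₂ => sw (A a) fun u v => sw (Δ b) fun c d =>
                sw (ρ v) fun h z => sw (ρ (z * d * σ b₁)) fun g w =>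
                  (u * (h • c) * (g • σ b₂)) ⊗ₜ[k] w := sw_comul_assoc y
      _ = sw (Δ y) fun a b => sw (A a) fun u v => sw (Δ b) fun b b' => sw (Δ b) fun c d =>
              sw (Δ b') fun b₁ b₂ => sw (ρ v) fun h z => sw (ρ (z * d * σ b₁)) fun g w =>
                  (u * (h • c) * (g • σ b₂)) ⊗ₜ[k] w := by
          refine sw_congr fun a b => ?_
          rw [sw_comm (A a)]
          refine sw_congr fun b b' => ?_
          rw [sw_comm]
          exact sw_congr fun u v => sw_comm _ _ _
      _ = sw (Δ y) fun a b => sw (A a) fun u v => ε b • u ⊗ₜ[k] v := by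
          simp only [sw_braidedMul_cancel]
      _ = sw (Δ y) fun a b => ε b • A a := by
          simp only [← smul_sw, sw_tmul_self]
      _ = A y := sw_comul_counit_right y
  ext1 y
  rw [key A, key B]
  simp only [h]

/-- The antipode of a braided Hopf algebra is braided anti-comultiplicative. -/
theorem comul_braidedAntipode (y : R) : Δ (σ y) =
    sw (Δ y) fun a b => sw (ρ a) fun g z => σ (g • b) ⊗ₜ[k] σ z := by
  have hB : IsLinearMap k fun y : R =>
      sw (Δ y) fun a b => sw (ρ a) fun g z => σ (g • b) ⊗ₜ[k] σ z := isLinearMap_auto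
  suffices h : comul (R := k) ∘ₗ σ = hB.mk' _ from LinearMap.congr_fun h y
  apply eq_of_braidedMul_comul_eq (H := H)
  intro y
  trans ε y • (1 : R) ⊗ₜ[k] (1 : R)
  · have h₁ : ∀ a b : R, braidedMul k H R ((comul (R := k) ∘ₗ σ) a ⊗ₜ Δ b) = Δ (σ a * b) :=
      fun a b => (BraidedHopfAlgebra.comul_mul _ _).symm
    simp only [h₁]
    rw [sw_braidedAntipode_mul y (F := fun z => Δ z), 
      BraidedHopfAlgebra.comul_one (k := k) (H := H)]
  · symm
    calc _ = sw (Δ y) fun a b => sw (Δ a) fun a₁ a₂ => sw (Δ b) fun b₁ b₂ => sw (ρ a₁) fun g z =>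
              (g • (σ a₂ * b₁)) ⊗ₜ[k] (σ z * b₂) := by
          refine sw_congr fun a b => ?_
          rw [IsLinearMap.mk'_apply]
          simp only [sw_tmul_right, map_sw]
          refine sw_congr fun a₁ a₂ => ?_
          rw [sw_comm (Δ b)]
          calc _ = sw (ρ a₁) fun g z => sw (ρ z) fun h w => sw (Δ b) fun b₁ b₂ =>
                    ((g • σ a₂) * (h • b₁)) ⊗ₜ[k] (σ w * b₂) := by
                refine sw_congr fun g z => ?_
                rw [braidedMul_eq_sw, sw_tmul _ _ lin₂_auto, sw_comm]
                simp only [BraidedHopfAlgebra.antipode_smul]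
                exact sw_coact_braidedAntipode z
            _ = sw (ρ a₁) fun g z => sw (Δ g) fun g₁ g₂ => sw (Δ b) fun b₁ b₂ =>
                    ((g₁ • σ a₂) * (g₂ • b₁)) ⊗ₜ[k] (σ z * b₂) := (sw_coact_assoc a₁).symm
            _ = _ := by
                simp only [smul_mul_eq_sw (k := k), sw_tmul_right]
                exact sw_congr fun g z => sw_comm _ _ _
      _ = sw (Δ y) fun a c => sw (Δ c) fun b d => sw (Δ b) fun b₁ b₂ => sw (ρ a) fun g z =>
              (g • (σ b₁ * b₂)) ⊗ₜ[k] (σ z * d) := sw_comul_comul y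
      _ = sw (Δ y) fun a c => sw (Δ c) fun b d => ε b • sw (ρ a) fun g z =>
              (g • (1 : R)) ⊗ₜ[k] (σ z * d) :=
          sw_congr fun a c => sw_congr fun b d => sw_braidedAntipode_mul b
            (F := fun m => sw (ρ a) fun g z => (g • m) ⊗ₜ[k] (σ z * d))
      _ = sw (Δ y) fun a d => sw (ρ a) fun g z => (g • (1 : R)) ⊗ₜ[k] (σ z * d) :=
          sw_congr fun a c => sw_comul_counit_left c
      _ = sw (Δ y) fun a d => (1 : R) ⊗ₜ[k] (σ a * d) := by
          refine sw_congr fun a d => ?_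
          simp only [BraidedHopfAlgebra.smul_one (k := k), ← TensorProduct.smul_tmul']
          exact sw_coact_counit a
      _ = _ := sw_braidedAntipode_mul y (F := fun m => (1 : R) ⊗ₜ[k] m)

theorem sw_comul_braidedAntipode (y : R) {F : R → R → Z} (hF : Lin₂ k F := by
      repeat' first
        | exact isLinearMap_id | intro _ | apply Lin₂.mk | apply Lin₃.mk
        | apply Lin₄.mk | apply IsLinearMap.sw_right
        | apply IsLinearMap.sw_left | apply IsLinearMap.linearMap_apply
        | apply IsLinearMap.mul_const | apply IsLinearMap.const_mul
        | apply IsLinearMap.smul_const | apply IsLinearMap.const_smul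
        | apply IsLinearMap.tmul_const | apply IsLinearMap.const_tmul) :
    sw (Δ (σ y)) F = sw (Δ y) fun a b => sw (ρ a) fun g z => F (σ (g • b)) (σ z) := by
  rw [← hF.lift_eq_sw, comul_braidedAntipode]
  simp only [map_sw, hF.lift_tmul]

theorem counit_braidedAntipode (y : R) : ε (σ y) = ε y := by
  calc ε (σ y) = sw (Δ y) fun a b => ε b • ε (σ a) := (sw_comul_counit_right y (F := fun a => ε (σ a))).symm
    _ = sw (Δ y) fun a b => ε (σ a * b) := sw_congr fun a b => by
        rw [BraidedHopfAlgebra.counit_mul (k := k) (H := H), smul_eq_mul, mul_comm]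
    _ = ε y := by
        rw [sw_braidedAntipode_mul y (F := fun z => ε z),
          BraidedHopfAlgebra.counit_one (k := k) (H := H), smul_eq_mul, mul_one]

end BraidedAntipode

section Twist

variable {k H R Z : Type*} [Field k] [Ring H] [HopfAlgebra k H]
  [Ring R] [Algebra k R] [Module H R] [IsScalarTower k H R]
  [YetterDrinfeldModule k H R] [AddCommGroup Z] [Module k Z]

local notation "Δ" => comul (R := k)
local notation "ε" => counit (R := k)
local notation "ρ" => LeftComodule.coact (k := k) (C := H)
local notation "𝖲" => HopfAlgebra.antipode k (A := H)

variable (k H R) in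
/-- The map `z ↦ S(z₍₋₁₎) • z₍₀₎`. -/
noncomputable def twist : R →ₗ[k] R :=
  (isLinearMap_auto (F := fun z : R => sw (ρ z) fun g w => 𝖲 g • w)).mk' _

theorem twist_apply (z : R) : twist k H R z = sw (ρ z) fun g w => 𝖲 g • w := rfl

theorem coact_twist (z : R) :
    ρ (twist k H R z) = sw (ρ z) fun g w => 𝖲 (𝖲 g) ⊗ₜ[k] twist k H R w := by
  have e : ∀ (g : H) (w : R), ρ (𝖲 g • w) = sw (Δ g) fun a b => sw (Δ b) fun a₂ b =>
      sw (ρ w) fun e v => (𝖲 b * e * 𝖲 (𝖲 a)) ⊗ₜ[k] (𝖲 a₂ • v) := fun g w => by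
    rw [← sw_tmul_self (ρ (𝖲 g • w)), sw_coact_smul, sw_comul_antipode g,
      ← sw_comul_assoc g (F := fun a a₂ b => sw (ρ w) fun e v =>
        (𝖲 b * e * 𝖲 (𝖲 a)) ⊗ₜ[k] (𝖲 a₂ • v))]
    exact sw_congr fun a b => sw_comul_antipode a
  rw [twist_apply, map_sw]
  simp only [e]
  calc _ = sw (ρ z) fun a w => sw (ρ w) fun c w => sw (Δ c) fun a₂ b => sw (ρ w) fun e v =>
            (𝖲 b * e * 𝖲 (𝖲 a)) ⊗ₜ[k] (𝖲 a₂ • v) := sw_coact_assoc z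
    _ = sw (ρ z) fun a w => sw (ρ w) fun a₂ w => sw (ρ w) fun f v => sw (Δ f) fun b e =>
            (𝖲 b * e * 𝖲 (𝖲 a)) ⊗ₜ[k] (𝖲 a₂ • v) := sw_congr fun a w => sw_coact_coact w
    _ = sw (ρ z) fun a w => sw (ρ w) fun a₂ w => sw (ρ w) fun f v =>
            ε f • (1 * 𝖲 (𝖲 a)) ⊗ₜ[k] (𝖲 a₂ • v) :=
        sw_congr fun a w => sw_congr fun a₂ w => sw_congr fun f v =>
          sw_antipode_mul f (F := fun m => (m * 𝖲 (𝖲 a)) ⊗ₜ[k] (𝖲 a₂ • v))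
    _ = sw (ρ z) fun a w => sw (ρ w) fun a₂ w => 𝖲 (𝖲 a) ⊗ₜ[k] (𝖲 a₂ • w) := by
        simp only [one_mul]
        exact sw_congr fun a w => sw_congr fun a₂ w => sw_coact_counit w
    _ = _ := by simp only [twist_apply, tmul_sw]

theorem sw_coact_twist (z : R) {F : H → R → Z} (hF : Lin₂ k F := by
      repeat' first
        | exact isLinearMap_id | intro _ | apply Lin₂.mk | apply Lin₃.mk
        | apply Lin₄.mk | apply IsLinearMap.sw_right
        | apply IsLinearMap.sw_left | apply IsLinearMap.linearMap_apply
        | apply IsLinearMap.mul_const | apply IsLinearMap.const_mul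
        | apply IsLinearMap.smul_const | apply IsLinearMap.const_smul
        | apply IsLinearMap.tmul_const | apply IsLinearMap.const_tmul) :
    sw (ρ (twist k H R z)) F = sw (ρ z) fun g w => F (𝖲 (𝖲 g)) (twist k H R w) := by
  rw [coact_twist, sw_sw _ _ _ hF]

section

variable (hH : Function.Bijective (HopfAlgebra.antipode k (A := H)))
include hH

theorem twist_bijective : Function.Bijective (twist k H R) := by
  constructor
  · suffices h : ∀ z : R, (sw (ρ (twist k H R z)) fun g w =>
        antipodeInv k H hH (antipodeInv k H hH g) • w) = z from fun a b hab => by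
      rw [← h a, hab, h b]
    intro z
    rw [sw_coact_twist]
    simp only [antipodeInv_antipode, twist_apply, smul_sw, smul_smul]
    rw [← sw_coact_assoc z (F := fun g h w => (g * 𝖲 h) • w)]
    calc _ = sw (ρ z) fun a b => ε a • (1 : H) • b :=
          sw_congr fun a b => sw_mul_antipode a (F := fun m => m • b)
      _ = (1 : H) • z := sw_coact_counit z
      _ = z := one_smul _ _
  · intro y
    refine ⟨sw (ρ y) fun g w => antipodeInv k H hH (antipodeInv k H hH g) • w, ?_⟩
    have e : ∀ (g : H) (w : R), twist k H R (antipodeInv k H hH (antipodeInv k H hH g) • w) =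
        sw (Δ g) fun a b => sw (Δ b) fun b c => sw (ρ w) fun e v =>
          (𝖲 (antipodeInv k H hH (antipodeInv k H hH a) * (e * antipodeInv k H hH c))) •
            antipodeInv k H hH (antipodeInv k H hH b) • v := fun g w => by
      rw [twist_apply, sw_coact_smul, sw_comul_antipodeInv hH _, sw_comul_antipodeInv hH g]
      refine sw_congr fun a b => ?_
      rw [sw_comul_antipodeInv hH _, sw_comul_antipodeInv hH b]
      simp only [antipode_antipodeInv, mul_assoc]
    rw [map_sw]
    simp only [e]
    calc _ = sw (ρ y) fun a w => sw (ρ w) fun b w => sw (Δ b) fun b c => sw (ρ w) fun e v =>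
              (𝖲 (antipodeInv k H hH (antipodeInv k H hH a) * (e * antipodeInv k H hH c))) •
                antipodeInv k H hH (antipodeInv k H hH b) • v := sw_coact_assoc y
      _ = sw (ρ y) fun a w => sw (ρ w) fun b w => sw (ρ w) fun f v => sw (Δ f) fun c e =>
              (𝖲 (antipodeInv k H hH (antipodeInv k H hH a) * (e * antipodeInv k H hH c))) •
                antipodeInv k H hH (antipodeInv k H hH b) • v :=
          sw_congr fun a w => sw_coact_coact w
      _ = sw (ρ y) fun a w => sw (ρ w) fun b w => sw (ρ w) fun f v => ε f •
              (𝖲 (antipodeInv k H hH (antipodeInv k H hH a) * 1)) •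
                antipodeInv k H hH (antipodeInv k H hH b) • v :=
          sw_congr fun a w => sw_congr fun b w => sw_congr fun f v => sw_mul_antipodeInv hH f
            (F := fun m => (𝖲 (antipodeInv k H hH (antipodeInv k H hH a) * m)) •
                antipodeInv k H hH (antipodeInv k H hH b) • v)
      _ = sw (ρ y) fun a w => sw (ρ w) fun b w =>
              (𝖲 (antipodeInv k H hH (antipodeInv k H hH a) * 1)) •
                antipodeInv k H hH (antipodeInv k H hH b) • w :=
          sw_congr fun a w => sw_congr fun b w => sw_coact_counit w
      _ = sw (ρ y) fun a w => sw (Δ a) fun a b =>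
              antipodeInv k H hH (antipodeInv k H hH b * a) • w := by
          simp only [mul_one, antipode_antipodeInv, smul_smul, ← antipodeInv_mul]
          exact (sw_coact_assoc y).symm
      _ = sw (ρ y) fun a w => ε a • antipodeInv k H hH 1 • w :=
          sw_congr fun a w => sw_antipodeInv_mul hH a (F := fun m => antipodeInv k H hH m • w)
      _ = antipodeInv k H hH 1 • y := sw_coact_counit y
      _ = y := by rw [antipodeInv_one, one_smul]

end

end Twist

section BraidedIdentities

variable {k H R Z : Type*} [Field k] [Ring H] [HopfAlgebra k H]
  [Ring R] [Algebra k R] [Coalgebra k R] [Module H R] [IsScalarTower k H R]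
  [YetterDrinfeldModule k H R] [AddCommGroup Z] [Module k Z] [BraidedHopfAlgebra k H R]

local notation "Δ" => comul (R := k)
local notation "ε" => counit (R := k)
local notation "ρ" => LeftComodule.coact (k := k) (C := H)
local notation "𝖲" => HopfAlgebra.antipode k (A := H)
local notation "σ" => BraidedHopfAlgebra.antipode k H (R := R)

theorem sw_coact_mul_comul (x y : R) :
    (sw (ρ y) fun g z => sw (Δ x) fun x₁ x₂ => (g • x₁) ⊗ₜ[k] (z * x₂)) =
      sw (Δ y) fun a b => sw (Δ (b * x)) fun u v => (σ a * u) ⊗ₜ[k] v := by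
  symm
  calc _ = sw (Δ y) fun a b => sw (Δ b) fun b c => sw (Δ x) fun x₁ x₂ => sw (ρ c) fun h z =>
            (σ a * b * (h • x₁)) ⊗ₜ[k] (z * x₂) := by
        simp only [mul_assoc]
        exact sw_congr fun a b => sw_comul_braided b x
    _ = sw (Δ y) fun d c => sw (Δ d) fun a b => sw (Δ x) fun x₁ x₂ => sw (ρ c) fun h z =>
            (σ a * b * (h • x₁)) ⊗ₜ[k] (z * x₂) := (sw_comul_assoc y).symm
    _ = sw (Δ y) fun d c => ε d • sw (Δ x) fun x₁ x₂ => sw (ρ c) fun h z =>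
            (1 * (h • x₁)) ⊗ₜ[k] (z * x₂) :=
        sw_congr fun d c => sw_braidedAntipode_mul d (F := fun m =>
          sw (Δ x) fun x₁ x₂ => sw (ρ c) fun h z => (m * (h • x₁)) ⊗ₜ[k] (z * x₂))
    _ = sw (Δ x) fun x₁ x₂ => sw (ρ y) fun h z => (1 * (h • x₁)) ⊗ₜ[k] (z * x₂) :=
        sw_comul_counit_left y
    _ = _ := by
        simp only [one_mul]
        exact sw_comm _ _ _

/-- The value of `Δ x` after left multiplication of its second leg by `y`. -/
theorem sw_comul_mul_right (x y : R) :
    (sw (Δ x) fun x₁ x₂ => x₁ ⊗ₜ[k] (y * x₂)) =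
      sw (ρ y) fun g z => sw (Δ z) fun a b => sw (Δ (b * x)) fun u v =>
        (𝖲 g • (σ a * u)) ⊗ₜ[k] v := by
  symm
  calc _ = sw (ρ y) fun g z => sw (ρ z) fun h w => sw (Δ x) fun x₁ x₂ =>
            (𝖲 g • h • x₁) ⊗ₜ[k] (w * x₂) := by
        refine sw_congr fun g z => ?_
        have hF : Lin₂ k fun u v : R => (𝖲 g • u) ⊗ₜ[k] v := lin₂_auto
        have := congrArg hF.lift (sw_coact_mul_comul (H := H) x z)
        simpa only [map_sw, hF.lift_tmul] using this.symm
    _ = sw (ρ y) fun f w => sw (Δ f) fun g h => sw (Δ x) fun x₁ x₂ =>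
            ((𝖲 g * h) • x₁) ⊗ₜ[k] (w * x₂) := by
        simp only [smul_smul]
        exact (sw_coact_assoc y).symm
    _ = sw (ρ y) fun f w => ε f • sw (Δ x) fun x₁ x₂ => ((1 : H) • x₁) ⊗ₜ[k] (w * x₂) :=
        sw_congr fun f w => sw_antipode_mul f (F := fun m =>
          sw (Δ x) fun x₁ x₂ => (m • x₁) ⊗ₜ[k] (w * x₂))
    _ = sw (Δ x) fun x₁ x₂ => ((1 : H) • x₁) ⊗ₜ[k] (y * x₂) := sw_coact_counit y
    _ = _ := by simp only [one_smul]

theorem braidedAntipode_twist (z : R) : σ (twist k H R z) = twist k H R (σ z) := by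
  simp only [twist_apply, map_sw, BraidedHopfAlgebra.antipode_smul]
  exact (sw_coact_braidedAntipode z).symm

theorem counit_twist (z : R) : ε (twist k H R z) = ε z := by
  simp only [twist_apply, map_sw, BraidedHopfAlgebra.counit_smul, HopfAlgebra.counit_antipode]
  exact sw_coact_counit z (F := fun w => ε w)

theorem twist_antipode_apply (y : R) :
    twist k H R (σ y) = sw (ρ y) fun g w => 𝖲 g • σ w := by
  rw [twist_apply]
  exact sw_coact_braidedAntipode y

theorem sw_coact_twist_antipode (y : R) {F : H → R → Z} (hF : Lin₂ k F := by
      repeat' first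
        | exact isLinearMap_id | intro _ | apply Lin₂.mk | apply Lin₃.mk
        | apply Lin₄.mk | apply IsLinearMap.sw_right
        | apply IsLinearMap.sw_left | apply IsLinearMap.linearMap_apply
        | apply IsLinearMap.mul_const | apply IsLinearMap.const_mul
        | apply IsLinearMap.smul_const | apply IsLinearMap.const_smul
        | apply IsLinearMap.tmul_const | apply IsLinearMap.const_tmul) :
    sw (ρ (twist k H R (σ y))) F = sw (ρ y) fun g w => F (𝖲 (𝖲 g)) (twist k H R (σ w)) := by
  rw [← hF.lift_eq_sw, coact_twist, map_sw]
  simp only [hF.lift_tmul]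
  have hF' : Lin₂ k fun g w => F (𝖲 (𝖲 g)) (twist k H R w) :=
    ⟨fun _ => ((hF.1 _).mk' _ ∘ₗ 𝖲 ∘ₗ 𝖲).isLinear,
      fun _ => ((hF.2 _).mk' _ ∘ₗ twist k H R).isLinear⟩
  exact sw_coact_braidedAntipode y hF'

theorem sw_coact_mul_antipode (a b : R) :
    (sw (ρ a) fun g a => sw (ρ b) fun h b => sw (Δ (g * h)) fun g₁ g₂ =>
        sw (ρ a) fun h c => (𝖲 g₂ • h • σ b) ⊗ₜ[k] (𝖲 g₁ • σ c)) =
      sw (ρ a) fun g c => sw (ρ b) fun h w =>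
        twist k H R (σ w) ⊗ₜ[k] (𝖲 (g * h) • σ c) := by
  calc _ = sw (ρ a) fun g a => sw (Δ g) fun g₁ g₂ => sw (ρ a) fun e c => sw (ρ b) fun h b =>
            sw (Δ h) fun h₁ h₂ =>
              ((𝖲 h₂ * (𝖲 g₂ * e)) • σ b) ⊗ₜ[k] (𝖲 (g₁ * h₁) • σ c) := by
        refine sw_congr fun g a => ?_
        calc _ = sw (ρ b) fun h b => sw (Δ g) fun g₁ g₂ => sw (Δ h) fun h₁ h₂ =>
                  sw (ρ a) fun e c =>
                    ((𝖲 h₂ * (𝖲 g₂ * e)) • σ b) ⊗ₜ[k] (𝖲 (g₁ * h₁) • σ c) := by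
              refine sw_congr fun h b => ?_
              rw [sw_comul_mul]
              simp only [HopfAlgebra.antipode_mul_antidistrib, smul_smul, mul_assoc]
          _ = _ := by
              rw [sw_comm]
              refine sw_congr fun g₁ g₂ => ?_
              rw [sw_comm (ρ a)]
              exact sw_congr fun h b => sw_comm _ _ _
    _ = sw (ρ a) fun g a => sw (ρ a) fun f c => sw (Δ f) fun g₂ e => sw (ρ b) fun h b =>
            sw (Δ h) fun h₁ h₂ =>
              ((𝖲 h₂ * (𝖲 g₂ * e)) • σ b) ⊗ₜ[k] (𝖲 (g * h₁) • σ c) := sw_coact_coact a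
    _ = sw (ρ a) fun g a => sw (ρ a) fun f c => ε f • sw (ρ b) fun h b =>
            sw (Δ h) fun h₁ h₂ => ((𝖲 h₂ * 1) • σ b) ⊗ₜ[k] (𝖲 (g * h₁) • σ c) :=
        sw_congr fun g a => sw_congr fun f c => sw_antipode_mul f (F := fun m =>
          sw (ρ b) fun h b => sw (Δ h) fun h₁ h₂ =>
            ((𝖲 h₂ * m) • σ b) ⊗ₜ[k] (𝖲 (g * h₁) • σ c))
    _ = sw (ρ a) fun g c => sw (ρ b) fun h b => sw (Δ h) fun h₁ h₂ =>
            ((𝖲 h₂ * 1) • σ b) ⊗ₜ[k] (𝖲 (g * h₁) • σ c) :=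
        sw_congr fun g a => sw_coact_counit a
    _ = _ := by
        simp only [mul_one]
        refine sw_congr fun g c => ?_
        rw [sw_coact_assoc b (F := fun h₁ h₂ b =>
          (𝖲 h₂ • σ b) ⊗ₜ[k] (𝖲 (g * h₁) • σ c))]
        simp only [twist_antipode_apply, sw_tmul_right]

/-- The map `y ↦ S(y₍₋₁₎) • σ(y₍₀₎)` is anti-comultiplicative for a twisted coaction. -/
theorem comul_twist_antipode (y : R) : Δ (twist k H R (σ y)) =
    sw (ρ y) fun g z => sw (Δ z) fun a b => twist k H R (σ b) ⊗ₜ[k] (𝖲 g • σ a) := by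
  calc _ = sw (ρ y) fun g z => sw (Δ z) fun a b => sw (Δ g) fun g₁ g₂ => sw (ρ a) fun h c =>
            (𝖲 g₂ • h • σ b) ⊗ₜ[k] (𝖲 g₁ • σ c) := by
        rw [twist_antipode_apply, map_sw]
        refine sw_congr fun g z => ?_
        rw [← sw_tmul_self (Δ (𝖲 g • σ z)), sw_comul_smul, sw_comul_antipode]
        rw [sw_comm (Δ z)]
        refine sw_congr fun g₁ g₂ => ?_
        rw [sw_comul_braidedAntipode]
        simp only [BraidedHopfAlgebra.antipode_smul]
    _ = sw (Δ y) fun a b => sw (ρ a) fun g a => sw (ρ b) fun h b => sw (Δ (g * h)) fun g₁ g₂ =>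
            sw (ρ a) fun h c => (𝖲 g₂ • h • σ b) ⊗ₜ[k] (𝖲 g₁ • σ c) := sw_coact_comul y
    _ = sw (Δ y) fun a b => sw (ρ a) fun g c => sw (ρ b) fun h w =>
            twist k H R (σ w) ⊗ₜ[k] (𝖲 (g * h) • σ c) :=
        sw_congr fun a b => sw_coact_mul_antipode a b
    _ = _ := (sw_coact_comul y (F := fun g a b => twist k H R (σ b) ⊗ₜ[k] (𝖲 g • σ a))).symm

theorem sw_comul_twist_antipode (y : R) {F : R → R → Z} (hF : Lin₂ k F := by
      repeat' first
        | exact isLinearMap_id | intro _ | apply Lin₂.mk | apply Lin₃.mk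
        | apply Lin₄.mk | apply IsLinearMap.sw_right
        | apply IsLinearMap.sw_left | apply IsLinearMap.linearMap_apply
        | apply IsLinearMap.mul_const | apply IsLinearMap.const_mul
        | apply IsLinearMap.smul_const | apply IsLinearMap.const_smul
        | apply IsLinearMap.tmul_const | apply IsLinearMap.const_tmul) :
    sw (Δ (twist k H R (σ y))) F =
      sw (ρ y) fun g z => sw (Δ z) fun a b => F (twist k H R (σ b)) (𝖲 g • σ a) := by
  rw [← hF.lift_eq_sw, comul_twist_antipode]
  simp only [map_sw, hF.lift_tmul]

theorem comul_antipode_twist_antipode (y : R) : Δ (σ (twist k H R (σ y))) =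
    sw (Δ y) fun a b => σ (twist k H R (σ a)) ⊗ₜ[k] σ (twist k H R (σ b)) := by
  calc _ = sw (ρ y) fun g z => sw (Δ z) fun a b => sw (ρ (twist k H R (σ b))) fun e w =>
            σ (e • 𝖲 g • σ a) ⊗ₜ[k] σ w := by
        rw [comul_braidedAntipode, sw_comul_twist_antipode]
    _ = sw (ρ y) fun g z => sw (Δ z) fun a b => sw (ρ b) fun e w =>
            σ ((𝖲 (𝖲 e) * 𝖲 g) • σ a) ⊗ₜ[k] σ (twist k H R (σ w)) := by
        simp only [← smul_smul]
        exact sw_congr fun g z => sw_congr fun a b => sw_coact_twist_antipode b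
    _ = sw (Δ y) fun a b => sw (ρ a) fun g a => sw (ρ b) fun h b => sw (ρ b) fun e w =>
            σ ((𝖲 (𝖲 e) * 𝖲 (g * h)) • σ a) ⊗ₜ[k] σ (twist k H R (σ w)) := sw_coact_comul y
    _ = sw (Δ y) fun a b => sw (ρ a) fun g a => sw (ρ b) fun f w => sw (Δ f) fun h e =>
            σ ((𝖲 (h * 𝖲 e) * 𝖲 g) • σ a) ⊗ₜ[k] σ (twist k H R (σ w)) := by
        simp only [HopfAlgebra.antipode_mul_antidistrib, mul_assoc]
        exact sw_congr fun a b => sw_congr fun g a => (sw_coact_assoc b).symm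
    _ = sw (Δ y) fun a b => sw (ρ a) fun g a => sw (ρ b) fun f w => ε f •
            σ ((𝖲 1 * 𝖲 g) • σ a) ⊗ₜ[k] σ (twist k H R (σ w)) :=
        sw_congr fun a b => sw_congr fun g a => sw_congr fun f w => sw_mul_antipode f
          (F := fun m => σ ((𝖲 m * 𝖲 g) • σ a) ⊗ₜ[k] σ (twist k H R (σ w)))
    _ = sw (Δ y) fun a b => sw (ρ a) fun g a =>
            σ ((𝖲 1 * 𝖲 g) • σ a) ⊗ₜ[k] σ (twist k H R (σ b)) :=
        sw_congr fun a b => sw_congr fun g a => sw_coact_counit b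
    _ = _ := by
        simp only [HopfAlgebra.antipode_one, one_mul]
        refine sw_congr fun a b => ?_
        rw [twist_antipode_apply a, map_sw, sw_tmul_right]

end BraidedIdentities

section BraidedInverses

variable {k H R Z : Type*} [Field k] [Ring H] [HopfAlgebra k H]
  [Ring R] [Algebra k R] [Coalgebra k R] [Module H R] [IsScalarTower k H R]
  [YetterDrinfeldModule k H R] [AddCommGroup Z] [Module k Z] [BraidedHopfAlgebra k H R]

local notation "Δ" => comul (R := k)
local notation "ε" => counit (R := k)
local notation "ρ" => LeftComodule.coact (k := k) (C := H)
local notation "𝖲" => HopfAlgebra.antipode k (A := H)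
local notation "σ" => BraidedHopfAlgebra.antipode k H (R := R)

variable (hH : Function.Bijective (HopfAlgebra.antipode k (A := H)))
  (hR : Function.Bijective (BraidedHopfAlgebra.antipode k H : R →ₗ[k] R))

/-- The inverse of the antipode of a braided Hopf algebra. -/
noncomputable def braidedAntipodeInv : R →ₗ[k] R := (LinearEquiv.ofBijective σ hR).symm

theorem braidedAntipode_inv (x : R) : σ (braidedAntipodeInv hR x) = x :=
  (LinearEquiv.ofBijective σ hR).apply_symm_apply x

theorem braidedAntipodeInv_antipode (x : R) : braidedAntipodeInv hR (σ x) = x :=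
  (LinearEquiv.ofBijective σ hR).symm_apply_apply x

theorem sw_coact_braidedAntipodeInv (y : R) {F : H → R → Z} (hF : Lin₂ k F := by
      repeat' first
        | exact isLinearMap_id | intro _ | apply Lin₂.mk | apply Lin₃.mk
        | apply Lin₄.mk | apply IsLinearMap.sw_right
        | apply IsLinearMap.sw_left | apply IsLinearMap.linearMap_apply
        | apply IsLinearMap.mul_const | apply IsLinearMap.const_mul
        | apply IsLinearMap.smul_const | apply IsLinearMap.const_smul
        | apply IsLinearMap.tmul_const | apply IsLinearMap.const_tmul) :
    sw (ρ (braidedAntipodeInv hR y)) F = sw (ρ y) fun g z => F g (braidedAntipodeInv hR z) := by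
  have hF' : Lin₂ k fun g z => F g (braidedAntipodeInv hR z) :=
    ⟨fun _ => hF.1 _, fun _ => ((hF.2 _).mk' _ ∘ₗ braidedAntipodeInv hR).isLinear⟩
  conv_rhs => rw [← braidedAntipode_inv hR y, sw_coact_braidedAntipode _ hF']
  simp only [braidedAntipodeInv_antipode]

/-- For `q = σ p`, the opposite comultiplication of `q` twisted by the inverse braiding. -/
theorem sw_comul_antipode_inverse_braiding (p : R) {F : R → R → Z} (hF : Lin₂ k F := by
      repeat' first
        | exact isLinearMap_id | intro _ | apply Lin₂.mk | apply Lin₃.mk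
        | apply Lin₄.mk | apply IsLinearMap.sw_right
        | apply IsLinearMap.sw_left | apply IsLinearMap.linearMap_apply
        | apply IsLinearMap.mul_const | apply IsLinearMap.const_mul
        | apply IsLinearMap.smul_const | apply IsLinearMap.const_smul
        | apply IsLinearMap.tmul_const | apply IsLinearMap.const_tmul) :
    (sw (Δ (σ p)) fun q₁ q₂ => sw (ρ q₂) fun g w =>
      F (braidedAntipodeInv hR w) (antipodeInv k H hH g • q₁)) = sw (Δ p) fun a b => F a (σ b) := by
  have key : (sw (Δ (σ p)) fun q₁ q₂ => sw (ρ q₂) fun g w =>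
      braidedAntipodeInv hR w ⊗ₜ[k] (antipodeInv k H hH g • q₁)) =
      sw (Δ p) fun a b => a ⊗ₜ[k] σ b := by
    rw [sw_comul_braidedAntipode]
    refine sw_congr fun a b => ?_
    calc _ = sw (ρ a) fun g z => sw (ρ z) fun h w =>
              w ⊗ₜ[k] ((antipodeInv k H hH h * g) • σ b) := by
          refine sw_congr fun g z => ?_
          rw [sw_coact_braidedAntipode]
          simp only [braidedAntipodeInv_antipode, BraidedHopfAlgebra.antipode_smul, smul_smul]
      _ = sw (ρ a) fun f w => sw (Δ f) fun g h =>
              w ⊗ₜ[k] ((antipodeInv k H hH h * g) • σ b) := (sw_coact_assoc a).symm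
      _ = sw (ρ a) fun f w => ε f • w ⊗ₜ[k] ((1 : H) • σ b) :=
          sw_congr fun f w => sw_antipodeInv_mul hH f (F := fun m => w ⊗ₜ[k] (m • σ b))
      _ = a ⊗ₜ[k] ((1 : H) • σ b) := sw_coact_counit a
      _ = _ := by rw [one_smul]
  have := congrArg hF.lift key
  simpa only [map_sw, hF.lift_tmul] using this

/-- The bijection `y ↦ S(y₍₋₁₎) • σ(y₍₀₎)` of `R`. -/
noncomputable def thetaEquiv : R ≃ₗ[k] R :=
  (LinearEquiv.ofBijective σ hR).trans (LinearEquiv.ofBijective _ (twist_bijective (R := R) hH))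

theorem thetaEquiv_apply (y : R) : thetaEquiv hH hR y = twist k H R (σ y) := rfl

/-- The bijection of `R` inverse to `y ↦ σ (S(y₍₋₁₎) • σ(y₍₀₎))`. -/
noncomputable def kappa : R →ₗ[k] R := (thetaEquiv hH hR).symm ∘ₗ braidedAntipodeInv hR

theorem kappa_apply (y : R) :
    kappa hH hR y = (thetaEquiv hH hR).symm (braidedAntipodeInv hR y) := rfl

theorem kappa_antipode_twist_antipode (y : R) : kappa hH hR (σ (twist k H R (σ y))) = y := by
  rw [kappa_apply, braidedAntipodeInv_antipode, ← thetaEquiv_apply hH hR,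
    LinearEquiv.symm_apply_apply]

theorem antipode_twist_antipode_kappa (y : R) : σ (twist k H R (σ (kappa hH hR y))) = y := by
  rw [← thetaEquiv_apply hH hR, kappa_apply, LinearEquiv.apply_symm_apply, braidedAntipode_inv]

theorem theta_symm_eq (y : R) : (thetaEquiv hH hR).symm y = σ (kappa hH hR y) := by
  rw [LinearEquiv.symm_apply_eq, thetaEquiv_apply, ← braidedAntipode_twist,
    antipode_twist_antipode_kappa]

theorem counit_kappa (y : R) : ε (kappa hH hR y) = ε y := by
  conv_rhs => rw [← antipode_twist_antipode_kappa hH hR y, counit_braidedAntipode, counit_twist,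
    counit_braidedAntipode]

theorem sw_comul_kappa (y : R) {F : R → R → Z} (hF : Lin₂ k F := by
      repeat' first
        | exact isLinearMap_id | intro _ | apply Lin₂.mk | apply Lin₃.mk
        | apply Lin₄.mk | apply IsLinearMap.sw_right
        | apply IsLinearMap.sw_left | apply IsLinearMap.linearMap_apply
        | apply IsLinearMap.mul_const | apply IsLinearMap.const_mul
        | apply IsLinearMap.smul_const | apply IsLinearMap.const_smul
        | apply IsLinearMap.tmul_const | apply IsLinearMap.const_tmul) :
    sw (Δ (kappa hH hR y)) F = sw (Δ y) fun a b => F (kappa hH hR a) (kappa hH hR b) := by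
  have hF' : Lin₂ k fun a b => F (kappa hH hR a) (kappa hH hR b) :=
    ⟨fun _ => ((hF.1 _).mk' _ ∘ₗ kappa hH hR).isLinear,
      fun _ => ((hF.2 _).mk' _ ∘ₗ kappa hH hR).isLinear⟩
  conv_rhs => rw [← antipode_twist_antipode_kappa hH hR y, ← hF'.lift_eq_sw,
    comul_antipode_twist_antipode]
  simp only [map_sw, hF'.lift_tmul, kappa_antipode_twist_antipode]

theorem sw_kappa_mul_theta (q : R) {F : R → Z} (hF : IsLinearMap k F := by
      repeat' first
        | exact isLinearMap_id | intro _ | apply Lin₂.mk | apply Lin₃.mk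
        | apply Lin₄.mk | apply IsLinearMap.sw_right
        | apply IsLinearMap.sw_left | apply IsLinearMap.linearMap_apply
        | apply IsLinearMap.mul_const | apply IsLinearMap.const_mul
        | apply IsLinearMap.smul_const | apply IsLinearMap.const_smul
        | apply IsLinearMap.tmul_const | apply IsLinearMap.const_tmul) :
    (sw (Δ q) fun a b => F (kappa hH hR a * (thetaEquiv hH hR).symm b)) = ε q • F 1 := by
  have hF' : Lin₂ k fun a b : R => F (a * σ b) :=
    ⟨fun b => ((hF.mk' _) ∘ₗ LinearMap.mulRight k (σ b)).isLinear,
      fun a => ((hF.mk' _) ∘ₗ LinearMap.mulLeft k a ∘ₗ σ).isLinear⟩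
  simp only [theta_symm_eq]
  rw [← sw_comul_kappa hH hR q hF', sw_mul_braidedAntipode _ hF, counit_kappa]

theorem sw_theta_mul_kappa (q : R) {F : R → Z} (hF : IsLinearMap k F := by
      repeat' first
        | exact isLinearMap_id | intro _ | apply Lin₂.mk | apply Lin₃.mk
        | apply Lin₄.mk | apply IsLinearMap.sw_right
        | apply IsLinearMap.sw_left | apply IsLinearMap.linearMap_apply
        | apply IsLinearMap.mul_const | apply IsLinearMap.const_mul
        | apply IsLinearMap.smul_const | apply IsLinearMap.const_smul
        | apply IsLinearMap.tmul_const | apply IsLinearMap.const_tmul) :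
    (sw (Δ q) fun a b => F ((thetaEquiv hH hR).symm a * kappa hH hR b)) = ε q • F 1 := by
  have hF' : Lin₂ k fun a b : R => F (σ a * b) :=
    ⟨fun b => ((hF.mk' _) ∘ₗ LinearMap.mulRight k b ∘ₗ σ).isLinear,
      fun a => ((hF.mk' _) ∘ₗ LinearMap.mulLeft k (σ a)).isLinear⟩
  simp only [theta_symm_eq]
  rw [← sw_comul_kappa hH hR q hF', sw_braidedAntipode_mul _ hF, counit_kappa]

theorem sw_comul_thetaEquiv (y : R) {F : R → R → Z} (hF : Lin₂ k F := by
      repeat' first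
        | exact isLinearMap_id | intro _ | apply Lin₂.mk | apply Lin₃.mk
        | apply Lin₄.mk | apply IsLinearMap.sw_right
        | apply IsLinearMap.sw_left | apply IsLinearMap.linearMap_apply
        | apply IsLinearMap.mul_const | apply IsLinearMap.const_mul
        | apply IsLinearMap.smul_const | apply IsLinearMap.const_smul
        | apply IsLinearMap.tmul_const | apply IsLinearMap.const_tmul) :
    (sw (Δ (thetaEquiv hH hR y)) fun u v => F v ((thetaEquiv hH hR).symm u)) =
      sw (ρ y) fun g z => sw (Δ z) fun a b => F (𝖲 g • σ a) b := by
  have hF' : Lin₂ k fun u v : R => F v ((thetaEquiv hH hR).symm u) :=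
    ⟨fun _ => ((hF.2 _).mk' _ ∘ₗ (thetaEquiv hH hR).symm.toLinearMap).isLinear, fun _ => hF.1 _⟩
  rw [thetaEquiv_apply, sw_comul_twist_antipode y hF']
  simp only [← thetaEquiv_apply hH hR, LinearEquiv.symm_apply_apply]

/-- The Hopf module identity behind the existence of integrals. -/
theorem sw_kappa_coinvariant (q : R) :
    (sw (Δ q) fun q₁ q₂ => sw (ρ (kappa hH hR q₂)) fun g z => sw (Δ z) fun a b =>
      (𝖲 g • (σ a * q₁)) ⊗ₜ[k] b) = 1 ⊗ₜ[k] kappa hH hR q := by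
  have e : ∀ y c : R, (sw (ρ y) fun g z => sw (Δ z) fun a b => (𝖲 g • (σ a * c)) ⊗ₜ[k] b) =
      sw (ρ (thetaEquiv hH hR y)) fun g r => sw (Δ r) fun u v =>
        (v * (antipodeInv k H hH g • c)) ⊗ₜ[k] (thetaEquiv hH hR).symm u := by
    intro y c
    calc _ = sw (ρ y) fun g z => sw (Δ g) fun g₁ g₂ => sw (Δ z) fun a b =>
              ((𝖲 g₂ • σ a) * (𝖲 g₁ • c)) ⊗ₜ[k] b := by
          refine sw_congr fun g z => ?_
          rw [sw_comm]
          refine sw_congr fun a b => ?_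
          rw [smul_mul_eq_sw (k := k), sw_comul_antipode, sw_tmul_right]
      _ = sw (ρ y) fun g y' => sw (ρ y') fun g₂ z => sw (Δ z) fun a b =>
              ((𝖲 g₂ • σ a) * (𝖲 g • c)) ⊗ₜ[k] b := sw_coact_assoc y
      _ = sw (ρ y) fun g y' => sw (Δ (thetaEquiv hH hR y')) fun u v =>
              (v * (𝖲 g • c)) ⊗ₜ[k] (thetaEquiv hH hR).symm u :=
          sw_congr fun g y' => (sw_comul_thetaEquiv hH hR y'
            (F := fun v u => (v * (𝖲 g • c)) ⊗ₜ[k] u)).symm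
      _ = _ := by
          conv_rhs => rw [thetaEquiv_apply, sw_coact_twist_antipode]
          simp only [antipodeInv_antipode, thetaEquiv_apply]
  simp only [e]
  obtain ⟨p, rfl⟩ := hR.2 q
  calc _ = sw (Δ (σ p)) fun q₁ q₂ => sw (ρ q₂) fun g w =>
            sw (Δ (braidedAntipodeInv hR w)) fun u v =>
              (v * (antipodeInv k H hH g • q₁)) ⊗ₜ[k] (thetaEquiv hH hR).symm u := by
        refine sw_congr fun q₁ q₂ => ?_
        rw [kappa_apply, LinearEquiv.apply_symm_apply, sw_coact_braidedAntipodeInv]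
    _ = sw (Δ p) fun a b => sw (Δ a) fun u v =>
            (v * σ b) ⊗ₜ[k] (thetaEquiv hH hR).symm u :=
        sw_comul_antipode_inverse_braiding hH hR p (F := fun r c =>
          sw (Δ r) fun u v => (v * c) ⊗ₜ[k] (thetaEquiv hH hR).symm u)
    _ = sw (Δ p) fun u b => sw (Δ b) fun v b =>
            (v * σ b) ⊗ₜ[k] (thetaEquiv hH hR).symm u := sw_comul_assoc p
    _ = sw (Δ p) fun u b => ε b • (1 : R) ⊗ₜ[k] (thetaEquiv hH hR).symm u :=
        sw_congr fun u b => sw_mul_braidedAntipode b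
          (F := fun m => m ⊗ₜ[k] (thetaEquiv hH hR).symm u)
    _ = (1 : R) ⊗ₜ[k] (thetaEquiv hH hR).symm p := sw_comul_counit_right p
    _ = _ := by rw [kappa_apply, braidedAntipodeInv_antipode]

theorem sw_antipodeInv_inverse_braiding (r : R) :
    (sw (Δ r) fun r₁ r₂ => sw (ρ r₂) fun g w =>
      braidedAntipodeInv hR w * (antipodeInv k H hH g • r₁)) = ε r • 1 := by
  obtain ⟨p, rfl⟩ := hR.2 r
  rw [sw_comul_antipode_inverse_braiding hH hR p (F := fun a b => a * b),
    sw_mul_braidedAntipode p (F := fun m => m), counit_braidedAntipode]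

theorem sw_mul_antipodeInv_smul (b z x : R) :
    (sw (ρ z) fun g z' => sw (ρ z') fun h w => antipodeInv k H hH g •
      ((antipodeInv k H hH (antipodeInv k H hH h) • (b * braidedAntipodeInv hR w)) * x)) =
      sw (ρ z) fun g w => b * braidedAntipodeInv hR w * (antipodeInv k H hH g • x) := by
  calc _ = sw (ρ z) fun g z' => sw (Δ g) fun g₁ g₂ => sw (ρ z') fun h w =>
            (antipodeInv k H hH (antipodeInv k H hH h * g₂) • (b * braidedAntipodeInv hR w)) *
              (antipodeInv k H hH g₁ • x) := by
        refine sw_congr fun g z' => ?_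
        rw [sw_comm]
        refine sw_congr fun h w => ?_
        rw [smul_mul_eq_sw (k := k), sw_comul_antipodeInv]
        simp only [antipodeInv_mul, smul_smul]
    _ = sw (ρ z) fun g z' => sw (ρ z') fun f w => sw (Δ f) fun g₂ h =>
            (antipodeInv k H hH (antipodeInv k H hH h * g₂) • (b * braidedAntipodeInv hR w)) *
              (antipodeInv k H hH g • x) := sw_coact_coact z
    _ = sw (ρ z) fun g z' => sw (ρ z') fun f w => ε f •
            ((antipodeInv k H hH 1 • (b * braidedAntipodeInv hR w)) *
              (antipodeInv k H hH g • x)) :=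
        sw_congr fun g z' => sw_congr fun f w => sw_antipodeInv_mul hH f (F := fun m =>
          (antipodeInv k H hH m • (b * braidedAntipodeInv hR w)) * (antipodeInv k H hH g • x))
    _ = sw (ρ z) fun g w => (antipodeInv k H hH 1 • (b * braidedAntipodeInv hR w)) *
              (antipodeInv k H hH g • x) := sw_congr fun g z' => sw_coact_counit z'
    _ = _ := by simp only [antipodeInv_one, one_smul]

end BraidedInverses

section TensorSubmodule

variable {k V W Z : Type*} [Field k] [AddCommGroup V] [Module k V] [AddCommGroup W] [Module k W]
  [AddCommGroup Z] [Module k Z]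

theorem exists_sum_tmul_of_forall_dual_left {t : V ⊗[k] W} {N : Submodule k W}
    (ht : ∀ f : V →ₗ[k] k, (sw t fun v w => f v • w) ∈ N) :
    t ∈ LinearMap.range (N.subtype.lTensor V) := by
  classical
  let ℬ := Module.Basis.ofVectorSpace k V
  obtain ⟨c, rfl⟩ := TensorProduct.eq_repr_basis_left ℬ t
  have hc : ∀ i, c i ∈ N := fun i => by
    have h := ht (ℬ.coord i)
    have hF : Lin₂ k fun (v : V) (w : W) => ℬ.coord i v • w := lin₂_auto
    have e : ∀ j, hF.lift (ℬ j ⊗ₜ c j) = if j = i then c j else 0 := fun j => by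
      rw [hF.lift_tmul]
      simp [Finsupp.single_apply]
    rw [← hF.lift_eq_sw, Finsupp.sum, map_sum, Finset.sum_congr rfl fun j _ => e j] at h
    by_cases hi : i ∈ c.support
    · rwa [Finset.sum_ite_eq' c.support i, if_pos hi] at h
    · rw [Finsupp.notMem_support_iff.1 hi]
      exact N.zero_mem
  refine Submodule.sum_mem _ fun i _ => ⟨ℬ i ⊗ₜ ⟨c i, hc i⟩, ?_⟩
  simp

/-- A bilinear function vanishing on `V × N` vanishes on a tensor all of whose slices lie in `N`. -/
theorem sw_eq_zero_of_forall_dual_left {t : V ⊗[k] W} {N : Submodule k W}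
    (ht : ∀ f : V →ₗ[k] k, (sw t fun v w => f v • w) ∈ N) {F : V → W → Z} (hF : Lin₂ k F)
    (h : ∀ v, ∀ w ∈ N, F v w = 0) : sw t F = 0 := by
  obtain ⟨s, rfl⟩ := exists_sum_tmul_of_forall_dual_left ht
  rw [← hF.lift_eq_sw]
  suffices hF.lift ∘ₗ N.subtype.lTensor V = 0 from LinearMap.congr_fun this s
  apply TensorProduct.ext'
  intro v w
  simp [hF.lift_tmul, h v w w.2]

theorem sw_eq_zero_of_forall_dual_right {t : V ⊗[k] W} {N : Submodule k V}
    (ht : ∀ f : W →ₗ[k] k, (sw t fun v w => f w • v) ∈ N) {F : V → W → Z} (hF : Lin₂ k F)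
    (h : ∀ v ∈ N, ∀ w, F v w = 0) : sw t F = 0 := by
  have hF' : Lin₂ k fun w v => F v w := ⟨hF.2, hF.1⟩
  have e : ∀ {Z : Type _} [AddCommGroup Z] [Module k Z] {G : W → V → Z}, Lin₂ k G →
      sw (TensorProduct.comm k V W t) G = sw t fun v w => G w v := fun {Z _ _ G} hG => by
    conv_lhs => rw [← sw_tmul_self t, linearEquiv_sw]
    exact sw_sw t _ _ hG
  rw [← e hF']
  refine sw_eq_zero_of_forall_dual_left (N := N) (fun f => ?_) hF' fun w v hv => h v hv w
  have hG : Lin₂ k fun (w : W) (v : V) => f w • v := lin₂_auto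
  rw [← hG.lift_eq_sw, ← sw_tmul_self t, linearEquiv_sw, map_sw]
  simpa only [TensorProduct.comm_tmul, hG.lift_tmul] using ht f

theorem eq_of_forall_dual {v w : V} (h : ∀ f : V →ₗ[k] k, f v = f w) : v = w := by
  rw [← sub_eq_zero, ← Module.forall_dual_apply_eq_zero_iff k]
  intro f
  rw [map_sub, sub_eq_zero]
  exact h f

end TensorSubmodule

section Integrals

variable {k H R X Z : Type*} [Field k] [Ring H] [HopfAlgebra k H]
  [Ring R] [Algebra k R] [Coalgebra k R] [Module H R] [IsScalarTower k H R]
  [YetterDrinfeldModule k H R] [AddCommGroup Z] [Module k Z] [BraidedHopfAlgebra k H R]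

local notation "Δ" => comul (R := k)
local notation "ε" => counit (R := k)
local notation "ρ" => LeftComodule.coact (k := k) (C := H)
local notation "𝖲" => HopfAlgebra.antipode k (A := H)
local notation "σ" => BraidedHopfAlgebra.antipode k H (R := R)

/-- A left integral: `x₍₁₎ l(x₍₂₎) = l(x) 1` for all `x`. -/
def IsLeftIntegral {k R : Type*} [Field k] [Ring R] [Algebra k R] [Coalgebra k R]
    (l : R →ₗ[k] k) : Prop :=
  ∀ x, (sw (comul (R := k) x) fun a b => l b • a) = l x • 1

omit [Module H R] [IsScalarTower k H R] [YetterDrinfeldModule k H R] [BraidedHopfAlgebra k H R]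
  [Ring H] [HopfAlgebra k H] in
theorem dualAlg_mul_apply {C : Type*} [AddCommGroup C] [Module k C] [Coalgebra k C]
    (f g : DualAlg k C) (x : C) :
    (f * g).ofConv x = sw (Δ x) fun a b => f.ofConv a * g.ofConv b := by
  rw [LinearMap.convMul_def, WithConv.ofConv_toConv]
  simp only [LinearMap.comp_apply]
  conv_lhs => rw [← sw_tmul_self (Δ x)]
  simp only [map_sw, TensorProduct.map_tmul, LinearMap.mul'_apply]

omit [Module H R] [IsScalarTower k H R] [YetterDrinfeldModule k H R] [BraidedHopfAlgebra k H R]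
  [Ring H] [HopfAlgebra k H] in
theorem mem_leftIntegrals_iff (l : DualAlg k R) :
    l ∈ leftIntegrals k R ↔ IsLeftIntegral l.ofConv := by
  have e : ∀ (f : R →ₗ[k] k) (x : R), (WithConv.toConv f * l).ofConv x =
      f (sw (Δ x) fun a b => l.ofConv b • a) := fun f x => by
    rw [dualAlg_mul_apply, map_sw]
    simp only [map_smul, smul_eq_mul, mul_comm]
  constructor
  · intro h x
    refine eq_of_forall_dual (k := k) fun f => ?_
    have := LinearMap.congr_fun (congrArg WithConv.ofConv (h (WithConv.toConv f))) x
    rw [e] at this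
    rw [this, map_smul, smul_eq_mul, mul_comm]
    rfl
  · intro h f
    apply WithConv.ofConv_injective
    ext x
    have := e f.ofConv x
    rw [WithConv.toConv_ofConv, h x, map_smul, smul_eq_mul, mul_comm] at this
    exact this

omit [Module H R] [IsScalarTower k H R] [YetterDrinfeldModule k H R] [BraidedHopfAlgebra k H R]
  [Ring H] [HopfAlgebra k H] in
theorem isCoFrobenius_iff : IsCoFrobenius k R ↔ ∃ l : R →ₗ[k] k, IsLeftIntegral l ∧ l ≠ 0 := by
  rw [IsCoFrobenius, Submodule.ne_bot_iff]
  constructor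
  · rintro ⟨l, hl, h0⟩
    exact ⟨l.ofConv, (mem_leftIntegrals_iff l).1 hl, fun h => h0 (WithConv.ofConv_injective h)⟩
  · rintro ⟨l, hl, h0⟩
    exact ⟨WithConv.toConv l, (mem_leftIntegrals_iff _).2 hl, fun h => h0 (WithConv.toConv_injective h)⟩

variable {l : R →ₗ[k] k}

/-- The translate of an integral by an element of `H` is an integral. -/
theorem IsLeftIntegral.comp_smul (hl : IsLeftIntegral l) (h : H) :
    IsLeftIntegral (l ∘ₗ actEnd k H R h) := by
  intro x
  have ha : ∀ y : R, (l ∘ₗ actEnd k H R h) y = l (h • y) := fun y => rfl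
  simp only [ha]
  symm
  calc _ = sw (Δ h) fun a b => ε a • l (b • x) • (1 : R) :=
        (sw_comul_counit_left h (F := fun b => l (b • x) • (1 : R))).symm
    _ = sw (Δ h) fun a b => 𝖲 a • sw (Δ (b • x)) fun u v => l v • u := by
        refine sw_congr fun a b => ?_
        rw [hl (b • x), smul_comm (𝖲 a) (l (b • x)), BraidedHopfAlgebra.smul_one (k := k) (𝖲 a),
          HopfAlgebra.counit_antipode, smul_comm (ε a)]
    _ = sw (Δ h) fun a b => sw (Δ b) fun b c => sw (Δ x) fun u v =>
          l (c • v) • (𝖲 a * b) • u := by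
        refine sw_congr fun a b => ?_
        rw [sw_comul_smul, smul_sw]
        refine sw_congr fun b c => ?_
        rw [smul_sw]
        refine sw_congr fun u v => ?_
        rw [smul_comm (𝖲 a) (l (c • v)), smul_smul]
    _ = sw (Δ h) fun f c => sw (Δ f) fun a b => sw (Δ x) fun u v =>
          l (c • v) • (𝖲 a * b) • u := (sw_comul_assoc h).symm
    _ = sw (Δ h) fun f c => ε f • sw (Δ x) fun u v => l (c • v) • (1 : H) • u :=
        sw_congr fun f c => sw_antipode_mul f (F := fun m => sw (Δ x) fun u v => l (c • v) • m • u)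
    _ = sw (Δ x) fun u v => l (h • v) • (1 : H) • u := sw_comul_counit_left h
    _ = _ := by simp only [one_smul]

/-- Functional form of the expression of `x₍₁₎ ⊗ y x₍₂₎`. -/
theorem sw_comul_mul_right_apply (f : R →ₗ[k] k) (x y : R) :
    (sw (Δ x) fun a b => f (y * b) • a) =
      sw (ρ y) fun g z => sw (Δ z) fun a b => 𝖲 g • (σ a * sw (Δ (b * x)) fun u v => f v • u) := by
  have hF : Lin₂ k fun u v : R => f v • u := lin₂_auto
  have := congrArg hF.lift (sw_comul_mul_right (H := H) x y)
  simp only [map_sw, hF.lift_tmul] at this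
  rw [this]
  simp only [mul_sw, smul_sw, mul_smul_comm]
  refine sw_congr fun g z => sw_congr fun a b => sw_congr fun u v => ?_
  rw [smul_comm]

theorem IsLeftIntegral.sw_comul_mul (hl : IsLeftIntegral l) (x y : R) :
    (sw (Δ x) fun a b => l (y * b) • a) =
      sw (ρ y) fun g z => sw (Δ z) fun a b => l (b * x) • 𝖲 g • σ a := by
  rw [sw_comul_mul_right_apply (H := H)]
  refine sw_congr fun g z => sw_congr fun a b => ?_
  rw [hl (b * x), mul_smul_comm, mul_one, smul_comm]

include H in
/-- A non-zero left integral separates points by left multiplication. -/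
theorem IsLeftIntegral.exists_apply_mul_ne_zero (hl : IsLeftIntegral l) (h0 : l ≠ 0) {c : R}
    (hc : c ≠ 0) : ∃ y, l (y * c) ≠ 0 := by
  by_contra! hcon
  apply hc
  let N : Submodule k R := ⨅ y, LinearMap.ker (l ∘ₗ LinearMap.mulLeft k y)
  have hN : ∀ {c}, c ∈ N ↔ ∀ y, l (y * c) = 0 := by simp [N, Submodule.mem_iInf]
  have slice : ∀ c ∈ N, ∀ f : R →ₗ[k] k, (sw (Δ c) fun a b => f a • b) ∈ N := by
    intro c hc f
    refine hN.2 fun y => ?_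
    have := congrArg f (hl.sw_comul_mul (H := H) c y)
    simp only [hN.1 hc, zero_smul, map_sw, map_smul, smul_eq_mul] at this
    rw [mul_sw, map_sw]
    simp only [mul_smul_comm, map_smul, smul_eq_mul]
    simp only [mul_comm (l _)] at this
    rw [this]
    simp [sw]
  obtain ⟨b, hb⟩ : ∃ b, l b ≠ 0 := by
    by_contra! h
    exact h0 (LinearMap.ext h)
  have counit_zero : ∀ c ∈ N, ε c = 0 := by
    intro c hc
    have h₁ : (sw (Δ c) fun u v => l (b * (σ u * v))) = 0 := by
      refine sw_eq_zero_of_forall_dual_left (N := N) (slice c hc) lin₂_auto fun u v hv => ?_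
      rw [← mul_assoc]
      exact hN.1 hv _
    rw [sw_braidedAntipode_mul c (F := fun m => l (b * m)), mul_one, smul_eq_mul] at h₁
    exact (mul_eq_zero.1 h₁).resolve_right hb
  refine eq_of_forall_dual (k := k) fun f => ?_
  have := counit_zero _ (slice c (hN.2 hcon) f)
  rw [map_sw] at this
  simp only [map_smul, smul_eq_mul, mul_comm (f _)] at this
  rw [map_zero, ← this]
  exact (sw_comul_counit_right c (F := fun a => f a)).symm

variable (hH : Function.Bijective (HopfAlgebra.antipode k (A := H)))
  (hR : Function.Bijective (BraidedHopfAlgebra.antipode k H : R →ₗ[k] R))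

theorem IsLeftIntegral.sw_theta (hl : IsLeftIntegral l) (r x : R) :
    (sw (Δ x) fun a b => l ((thetaEquiv hH hR).symm r * b) • a) =
      sw (Δ r) fun a b => l ((thetaEquiv hH hR).symm a * x) • b := by
  rw [hl.sw_comul_mul (H := H)]
  have := sw_comul_thetaEquiv hH hR ((thetaEquiv hH hR).symm r) (F := fun v u => l (u * x) • v)
  rw [LinearEquiv.apply_symm_apply] at this
  exact this.symm

end Integrals

/-! ### Comodules -/

namespace LeftComodule

section Basic

variable {k C : Type*} [Field k] [AddCommGroup C] [Module k C] [Coalgebra k C]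

local notation "Δ" => comul (R := k)
local notation "ε" => counit (R := k)
local notation "δ" => LeftComodule.coact (k := k) (C := C)

/-- A coalgebra is a left comodule over itself. -/
instance self : LeftComodule k C C where
  coact := comul
  coassoc := Coalgebra.coassoc
  counit_coact := by
    rw [Coalgebra.rTensor_counit_comp_comul]
    ext x
    simp

theorem coact_self (c : C) : δ c = Δ c := rfl

variable {L M N Z : Type*} [AddCommGroup L] [Module k L] [LeftComodule k C L]
  [AddCommGroup M] [Module k M] [LeftComodule k C M]
  [AddCommGroup N] [Module k N] [LeftComodule k C N] [AddCommGroup Z] [Module k Z]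

theorem isColinear_iff {f : M →ₗ[k] N} :
    IsColinear k C f ↔ ∀ m, δ (f m) = sw (δ m) fun c n => c ⊗ₜ[k] f n := by
  simp only [IsColinear, LinearMap.ext_iff, LinearMap.comp_apply, lTensor_eq_sw]

theorem IsColinear.sw_coact {f : M →ₗ[k] N} (hf : IsColinear k C f) (m : M) {F : C → N → Z}
    (hF : Lin₂ k F := by
      repeat' first
        | exact isLinearMap_id | intro _ | apply Lin₂.mk | apply Lin₃.mk
        | apply Lin₄.mk | apply IsLinearMap.sw_right
        | apply IsLinearMap.sw_left | apply IsLinearMap.linearMap_apply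
        | apply IsLinearMap.mul_const | apply IsLinearMap.const_mul
        | apply IsLinearMap.smul_const | apply IsLinearMap.const_smul
        | apply IsLinearMap.tmul_const | apply IsLinearMap.const_tmul) : sw (δ (f m)) F = sw (δ m) fun c n => F c (f n) := by
  rw [isColinear_iff.1 hf, sw_sw _ _ _ hF]

theorem IsColinear.comp {g : M →ₗ[k] N} {f : L →ₗ[k] M} (hg : IsColinear k C g)
    (hf : IsColinear k C f) : IsColinear k C (g ∘ₗ f) := by
  rw [IsColinear, ← LinearMap.comp_assoc, hg, LinearMap.comp_assoc, hf, LinearMap.lTensor_comp,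
    LinearMap.comp_assoc]

theorem isColinear_id : IsColinear k C (LinearMap.id : M →ₗ[k] M) := by
  rw [IsColinear, LinearMap.lTensor_id, LinearMap.id_comp, LinearMap.comp_id]

theorem isColinear_zero : IsColinear k C (0 : M →ₗ[k] N) := by
  rw [IsColinear, LinearMap.lTensor_zero, LinearMap.zero_comp, LinearMap.comp_zero]

theorem IsColinear.add {f g : M →ₗ[k] N} (hf : IsColinear k C f) (hg : IsColinear k C g) :
    IsColinear k C (f + g) := by
  rw [IsColinear, LinearMap.comp_add, hf, hg, LinearMap.lTensor_add, LinearMap.add_comp]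

theorem IsColinear.smul {f : M →ₗ[k] N} (hf : IsColinear k C f) (c : k) :
    IsColinear k C (c • f) := by
  rw [IsColinear, LinearMap.comp_smul, hf, LinearMap.lTensor_smul, LinearMap.smul_comp]

theorem IsColinear.of_comp_injective {g : M →ₗ[k] N} {f : L →ₗ[k] M} (hg : IsColinear k C g)
    (hi : Function.Injective g) (h : IsColinear k C (g ∘ₗ f)) : IsColinear k C f := by
  have hi' : Function.Injective (g.lTensor C) := Module.Flat.lTensor_preserves_injective_linearMap g hi
  rw [IsColinear] at h hg ⊢
  rw [← LinearMap.comp_assoc, hg, LinearMap.lTensor_comp, LinearMap.comp_assoc,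
    LinearMap.comp_assoc] at h
  exact (LinearMap.cancel_left hi').1 h

theorem IsColinear.symm {e : M ≃ₗ[k] N} (he : IsColinear k C (e : M →ₗ[k] N)) :
    IsColinear k C (e.symm : N →ₗ[k] M) := by
  apply he.of_comp_injective e.injective
  rw [LinearEquiv.comp_symm]
  exact isColinear_id

/-- The action of a functional on a comodule, `f ⇀ m = f(m₍₋₁₎) m₍₀₎`. -/
noncomputable def hit (f : C →ₗ[k] k) : M →ₗ[k] M :=
  TensorProduct.lid k M ∘ₗ f.rTensor M ∘ₗ δ

theorem hit_apply (f : C →ₗ[k] k) (m : M) : hit f m = sw (δ m) fun c n => f c • n := by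
  simp only [hit, LinearMap.comp_apply, rTensor_eq_sw, LinearEquiv.coe_coe, linearEquiv_sw,
    TensorProduct.lid_tmul]

theorem IsColinear.map_hit {g : M →ₗ[k] N} (hg : IsColinear k C g) (f : C →ₗ[k] k) (m : M) :
    g (hit f m) = hit f (g m) := by
  rw [hit_apply, hit_apply, hg.sw_coact m, map_sw]
  simp only [map_smul]

theorem isSubcomodule_iff {P : Submodule k M} :
    IsSubcomodule k C P ↔ ∀ (f : C →ₗ[k] k), ∀ m ∈ P, hit f m ∈ P := by
  constructor
  · intro h f m hm
    obtain ⟨t, ht⟩ := h m hm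
    rw [hit, LinearMap.comp_apply, LinearMap.comp_apply, ← ht]
    have : TensorProduct.lid k M ∘ₗ f.rTensor M ∘ₗ P.subtype.lTensor C =
        P.subtype ∘ₗ TensorProduct.lid k P ∘ₗ f.rTensor P := by
      ext
      simp
    exact (LinearMap.congr_fun this t) ▸ (Subtype.prop _)
  · intro h m hm
    refine exists_sum_tmul_of_forall_dual_left fun f => ?_
    rw [← hit_apply]
    exact h f m hm

theorem hit_mul (f g : DualAlg k C) (m : M) :
    hit g.ofConv (hit f.ofConv m) = hit (f * g).ofConv m := by
  conv_lhs => rw [hit_apply f.ofConv, map_sw]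
  simp only [map_smul, hit_apply, smul_sw, smul_smul, dualAlg_mul_apply, sw_smul]
  exact (sw_coact_assoc m (F := fun a b n => (f.ofConv a * g.ofConv b) • n)).symm

theorem hit_counit (m : M) : hit (counit (R := k) (A := C)) m = m := by
  rw [hit_apply]
  exact sw_coact_counit m (F := fun n => n)

theorem isSubcomodule_bot : IsSubcomodule k C (⊥ : Submodule k M) :=
  isSubcomodule_iff.2 fun f m hm => by rw [(Submodule.mem_bot k).1 hm, map_zero]; exact zero_mem _

theorem isSubcomodule_top : IsSubcomodule k C (⊤ : Submodule k M) :=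
  isSubcomodule_iff.2 fun _ _ _ => Submodule.mem_top

theorem IsSubcomodule.sup {P Q : Submodule k M} (hP : IsSubcomodule k C P)
    (hQ : IsSubcomodule k C Q) : IsSubcomodule k C (P ⊔ Q) := by
  rw [isSubcomodule_iff] at *
  intro f m hm
  obtain ⟨a, ha, b, hb, rfl⟩ := Submodule.mem_sup.1 hm
  rw [map_add]
  exact Submodule.add_mem_sup (hP f a ha) (hQ f b hb)

theorem IsSubcomodule.map {g : M →ₗ[k] N} (hg : IsColinear k C g) {P : Submodule k M}
    (hP : IsSubcomodule k C P) : IsSubcomodule k C (P.map g) := by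
  rw [isSubcomodule_iff] at *
  rintro f _ ⟨m, hm, rfl⟩
  exact ⟨_, hP f m hm, hg.map_hit f m⟩

theorem IsSubcomodule.comap {g : M →ₗ[k] N} (hg : IsColinear k C g) {P : Submodule k N}
    (hP : IsSubcomodule k C P) : IsSubcomodule k C (P.comap g) := by
  rw [isSubcomodule_iff] at *
  intro f m hm
  rw [Submodule.mem_comap, hg.map_hit]
  exact hP f _ hm

theorem IsColinear.isSubcomodule_range {g : M →ₗ[k] N} (hg : IsColinear k C g) :
    IsSubcomodule k C (LinearMap.range g) := by
  rw [LinearMap.range_eq_map]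
  exact isSubcomodule_top.map hg

theorem IsColinear.isSubcomodule_ker {g : M →ₗ[k] N} (hg : IsColinear k C g) :
    IsSubcomodule k C (LinearMap.ker g) :=
  isSubcomodule_bot.comap hg

section Sub

variable {P : Submodule k M}

/-- The comodule structure of a subcomodule. -/
@[reducible] noncomputable def IsSubcomodule.comodule (hP : IsSubcomodule k C P) :
    LeftComodule k C P :=
  have hi : Function.Injective (P.subtype.lTensor C) :=
    Module.Flat.lTensor_preserves_injective_linearMap _ P.injective_subtype
  let co : P →ₗ[k] C ⊗[k] P := (LinearEquiv.ofInjective _ hi).symm.toLinearMap ∘ₗ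
    (δ ∘ₗ P.subtype).codRestrict (LinearMap.range (P.subtype.lTensor C)) fun p => hP p p.2
  have hco : P.subtype.lTensor C ∘ₗ co = δ ∘ₗ P.subtype := LinearMap.ext fun p =>
    congrArg Subtype.val (LinearEquiv.apply_symm_apply (LinearEquiv.ofInjective _ hi) _)
  { coact := co
    coassoc := by
      have hi' : Function.Injective ((P.subtype.lTensor C).lTensor C) :=
        Module.Flat.lTensor_preserves_injective_linearMap _ hi
      apply (LinearMap.cancel_left hi').1
      have e₁ : (P.subtype.lTensor C).lTensor C ∘ₗ (TensorProduct.assoc k C C P).toLinearMap =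
          (TensorProduct.assoc k C C M).toLinearMap ∘ₗ P.subtype.lTensor (C ⊗[k] C) := by
        apply TensorProduct.ext_threefold
        intro a b c
        simp
      have e₂ : P.subtype.lTensor (C ⊗[k] C) ∘ₗ (Δ).rTensor P =
          (Δ).rTensor M ∘ₗ P.subtype.lTensor C := by
        rw [LinearMap.lTensor_comp_rTensor, LinearMap.rTensor_comp_lTensor]
      calc _ = ((P.subtype.lTensor C).lTensor C ∘ₗ (TensorProduct.assoc k C C P).toLinearMap) ∘ₗ
              (Δ).rTensor P ∘ₗ co := rfl
        _ = (TensorProduct.assoc k C C M).toLinearMap ∘ₗ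
              (P.subtype.lTensor (C ⊗[k] C) ∘ₗ (Δ).rTensor P) ∘ₗ co := by rw [e₁]; rfl
        _ = ((TensorProduct.assoc k C C M).toLinearMap ∘ₗ (Δ).rTensor M) ∘ₗ
              (P.subtype.lTensor C ∘ₗ co) := by rw [e₂]; rfl
        _ = ((TensorProduct.assoc k C C M).toLinearMap ∘ₗ (Δ).rTensor M ∘ₗ δ) ∘ₗ P.subtype := by
            rw [hco]; rfl
        _ = (δ).lTensor C ∘ₗ δ ∘ₗ P.subtype := by rw [LeftComodule.coassoc]; rfl
        _ = ((δ).lTensor C ∘ₗ P.subtype.lTensor C) ∘ₗ co := by rw [← hco]; rfl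
        _ = (P.subtype.lTensor C).lTensor C ∘ₗ co.lTensor C ∘ₗ co := by
            rw [← LinearMap.lTensor_comp, ← hco, LinearMap.lTensor_comp]; rfl
    counit_coact := by
      apply (LinearMap.cancel_left P.injective_subtype).1
      have e : P.subtype ∘ₗ (TensorProduct.lid k P).toLinearMap ∘ₗ (ε).rTensor P =
          ((TensorProduct.lid k M).toLinearMap ∘ₗ (ε).rTensor M) ∘ₗ P.subtype.lTensor C := by
        ext
        simp
      calc _ = (P.subtype ∘ₗ (TensorProduct.lid k P).toLinearMap ∘ₗ (ε).rTensor P) ∘ₗ co := rfl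
        _ = ((TensorProduct.lid k M).toLinearMap ∘ₗ (ε).rTensor M) ∘ₗ
              (P.subtype.lTensor C ∘ₗ co) := by rw [e]; rfl
        _ = ((TensorProduct.lid k M).toLinearMap ∘ₗ (ε).rTensor M ∘ₗ δ) ∘ₗ P.subtype := by
            rw [hco]; rfl
        _ = _ := by rw [LeftComodule.counit_coact]; rfl }

theorem IsSubcomodule.isColinear_subtype (hP : IsSubcomodule k C P) :
    letI := hP.comodule
    IsColinear k C P.subtype := by
  have hi : Function.Injective (P.subtype.lTensor C) :=
    Module.Flat.lTensor_preserves_injective_linearMap _ P.injective_subtype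
  exact LinearMap.ext fun p => (congrArg Subtype.val
    (LinearEquiv.apply_symm_apply (LinearEquiv.ofInjective _ hi) ⟨δ (p : M), hP p p.2⟩)).symm

/-- The comodule structure of a quotient by a subcomodule. -/
@[reducible] noncomputable def IsSubcomodule.quotientComodule (hP : IsSubcomodule k C P) :
    LeftComodule k C (M ⧸ P) :=
  have hk : P ≤ LinearMap.ker (P.mkQ.lTensor C ∘ₗ δ) := fun p hp => by
    obtain ⟨t, ht⟩ := hP p hp
    have : P.mkQ.lTensor C ∘ₗ P.subtype.lTensor C = 0 := by
      have h0 : P.mkQ ∘ₗ P.subtype = 0 := by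
        ext x
        simp
      rw [← LinearMap.lTensor_comp, h0, LinearMap.lTensor_zero]
    rw [LinearMap.mem_ker, LinearMap.comp_apply, ← ht]
    exact LinearMap.congr_fun this t
  let co : M ⧸ P →ₗ[k] C ⊗[k] (M ⧸ P) := P.liftQ (P.mkQ.lTensor C ∘ₗ δ) hk
  have hco : co ∘ₗ P.mkQ = P.mkQ.lTensor C ∘ₗ δ := Submodule.liftQ_mkQ _ _ _
  { coact := co
    coassoc := by
      apply (LinearMap.cancel_right P.mkQ_surjective).1
      have e₁ : (P.mkQ.lTensor C).lTensor C ∘ₗ (TensorProduct.assoc k C C M).toLinearMap =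
          (TensorProduct.assoc k C C (M ⧸ P)).toLinearMap ∘ₗ P.mkQ.lTensor (C ⊗[k] C) := by
        apply TensorProduct.ext_threefold
        intro a b c
        simp
      have e₂ : P.mkQ.lTensor (C ⊗[k] C) ∘ₗ (Δ).rTensor M =
          (Δ).rTensor (M ⧸ P) ∘ₗ P.mkQ.lTensor C := by
        rw [LinearMap.lTensor_comp_rTensor, LinearMap.rTensor_comp_lTensor]
      calc _ = (TensorProduct.assoc k C C (M ⧸ P)).toLinearMap ∘ₗ (Δ).rTensor (M ⧸ P) ∘ₗ
              (co ∘ₗ P.mkQ) := rfl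
        _ = (TensorProduct.assoc k C C (M ⧸ P)).toLinearMap ∘ₗ
              ((Δ).rTensor (M ⧸ P) ∘ₗ P.mkQ.lTensor C) ∘ₗ δ := by rw [hco]; rfl
        _ = ((TensorProduct.assoc k C C (M ⧸ P)).toLinearMap ∘ₗ P.mkQ.lTensor (C ⊗[k] C)) ∘ₗ
              (Δ).rTensor M ∘ₗ δ := by rw [← e₂]; rfl
        _ = (P.mkQ.lTensor C).lTensor C ∘ₗ
              ((TensorProduct.assoc k C C M).toLinearMap ∘ₗ (Δ).rTensor M ∘ₗ δ) := by rw [← e₁]; rfl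
        _ = ((P.mkQ.lTensor C).lTensor C ∘ₗ (δ).lTensor C) ∘ₗ δ := by
            rw [LeftComodule.coassoc]; rfl
        _ = co.lTensor C ∘ₗ P.mkQ.lTensor C ∘ₗ δ := by
            rw [← LinearMap.lTensor_comp, ← hco, LinearMap.lTensor_comp]; rfl
        _ = _ := by rw [← hco]; rfl
    counit_coact := by
      apply (LinearMap.cancel_right P.mkQ_surjective).1
      have e : P.mkQ ∘ₗ (TensorProduct.lid k M).toLinearMap ∘ₗ (ε).rTensor M =
          ((TensorProduct.lid k (M ⧸ P)).toLinearMap ∘ₗ (ε).rTensor (M ⧸ P)) ∘ₗ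
            P.mkQ.lTensor C := by
        ext
        simp
      calc _ = (TensorProduct.lid k (M ⧸ P)).toLinearMap ∘ₗ (ε).rTensor (M ⧸ P) ∘ₗ
              (co ∘ₗ P.mkQ) := rfl
        _ = (((TensorProduct.lid k (M ⧸ P)).toLinearMap ∘ₗ (ε).rTensor (M ⧸ P)) ∘ₗ
              P.mkQ.lTensor C) ∘ₗ δ := by rw [hco]; rfl
        _ = P.mkQ ∘ₗ ((TensorProduct.lid k M).toLinearMap ∘ₗ (ε).rTensor M ∘ₗ δ) := by
            rw [← e]; rfl
        _ = _ := by rw [LeftComodule.counit_coact]; rfl }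

theorem IsSubcomodule.isColinear_mkQ (hP : IsSubcomodule k C P) :
    letI := hP.quotientComodule
    IsColinear k C P.mkQ :=
  Submodule.liftQ_mkQ P _ _

end Sub

end Basic

end LeftComodule

namespace LeftComodule

section Range

variable {k C : Type*} [Field k] [AddCommGroup C] [Module k C] [Coalgebra k C]
variable {L M N : Type*} [AddCommGroup L] [Module k L] [LeftComodule k C L]
  [AddCommGroup M] [Module k M] [LeftComodule k C M]
  [AddCommGroup N] [Module k N] [LeftComodule k C N]

theorem IsColinear.codRestrict {f : L →ₗ[k] M} (hf : IsColinear k C f) {P : Submodule k M}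
    (hP : IsSubcomodule k C P) (h : ∀ x, f x ∈ P) :
    letI := hP.comodule
    IsColinear k C (f.codRestrict P h) := by
  let _ := hP.comodule
  refine hP.isColinear_subtype.of_comp_injective P.injective_subtype ?_
  rwa [LinearMap.subtype_comp_codRestrict]

theorem IsColinear.rangeRestrict {f : L →ₗ[k] M} (hf : IsColinear k C f) :
    letI := hf.isSubcomodule_range.comodule
    IsColinear k C f.rangeRestrict :=
  hf.codRestrict hf.isSubcomodule_range _

theorem IsSubcomodule.of_map_subtype {P : Submodule k M} (hP : IsSubcomodule k C P)
    {Q : Submodule k P} (hQ : letI := hP.comodule; IsSubcomodule k C Q) :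
    IsSubcomodule k C (Q.map P.subtype) := by
  let _ := hP.comodule
  exact hQ.map hP.isColinear_subtype

theorem IsSimple.injective_of_ne_zero (hM : IsSimple k C M) {f : M →ₗ[k] N}
    (hf : IsColinear k C f) (h0 : f ≠ 0) : Function.Injective f := by
  rw [← LinearMap.ker_eq_bot]
  refine (hM.2 _ hf.isSubcomodule_ker).resolve_right fun h => h0 ?_
  rwa [LinearMap.ker_eq_top] at h

theorem IsSimple.surjective_of_ne_zero (hN : IsSimple k C N) {f : M →ₗ[k] N}
    (hf : IsColinear k C f) (h0 : f ≠ 0) : Function.Surjective f := by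
  rw [← LinearMap.range_eq_top]
  refine (hN.2 _ hf.isSubcomodule_range).resolve_left fun h => h0 ?_
  rwa [LinearMap.range_eq_bot] at h

/-- Every element of a comodule lies in a finite-dimensional subcomodule. -/
theorem exists_finiteDimensional_subcomodule (m : M) :
    ∃ P : Submodule k M, IsSubcomodule k C P ∧ FiniteDimensional k P ∧ m ∈ P := by
  let φ : (C →ₗ[k] k) →ₗ[k] M :=
    { toFun := fun f => hit f m
      map_add' := fun f g => by simp [hit, LinearMap.rTensor_add]
      map_smul' := fun c f => by simp [hit, LinearMap.rTensor_smul] }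
  refine ⟨LinearMap.range φ, ?_, ?_, counit, hit_counit m⟩
  · rw [isSubcomodule_iff]
    rintro f _ ⟨g, rfl⟩
    exact ⟨(WithConv.toConv g * WithConv.toConv f).ofConv,
      (hit_mul (WithConv.toConv g) (WithConv.toConv f) m).symm⟩
  · obtain ⟨n, c, w, h⟩ := TensorProduct.exists_sum_tmul_eq (coact (k := k) (C := C) m)
    have hle : LinearMap.range φ ≤ Submodule.span k (Set.range w) := by
      rintro _ ⟨f, rfl⟩
      have : φ f = ∑ i, f (c i) • w i := by
        simp [φ, hit, h]
      rw [this]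
      exact Submodule.sum_mem _ fun i _ => Submodule.smul_mem _ _ (Submodule.subset_span ⟨i, rfl⟩)
    have := FiniteDimensional.span_of_finite k (Set.finite_range w)
    exact Submodule.finiteDimensional_of_le hle

variable (k C M) in
/-- Every non-zero comodule has a simple subcomodule. -/
theorem exists_simple_subcomodule [Nontrivial M] :
    ∃ (S : Submodule k M) (hS : IsSubcomodule k C S), letI := hS.comodule; IsSimple k C S := by
  classical
  have hex : ∃ n, ∃ S : Submodule k M, IsSubcomodule k C S ∧ FiniteDimensional k S ∧ S ≠ ⊥ ∧
      Module.finrank k S = n := by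
    obtain ⟨m, hm⟩ := exists_ne (0 : M)
    obtain ⟨P, hP, hfd, hmP⟩ := exists_finiteDimensional_subcomodule (k := k) (C := C) m
    exact ⟨_, P, hP, hfd, fun h => hm (by rwa [h, Submodule.mem_bot] at hmP), rfl⟩
  obtain ⟨S, hS, hfd, hne, hr⟩ := Nat.find_spec hex
  refine ⟨S, hS, (Submodule.nontrivial_iff_ne_bot).2 hne, fun N hN => ?_⟩
  by_contra! hcon
  have h₁ := Submodule.finrank_lt hcon.2
  refine Nat.find_min hex (m := Module.finrank k (N.map S.subtype)) ?_
    ⟨_, hS.of_map_subtype hN, inferInstance, ?_, rfl⟩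
  · rwa [← hr, Submodule.finrank_map_subtype_eq]
  · exact fun h => hcon.1 (Submodule.map_injective_of_injective S.injective_subtype
      (h.trans (Submodule.map_bot _).symm))

end Range

section Cofree

variable {k C : Type*} [Field k] [AddCommGroup C] [Module k C] [Coalgebra k C]
variable {M V : Type*} [AddCommGroup M] [Module k M] [LeftComodule k C M] [AddCommGroup V] [Module k V]

local notation "Δ" => comul (R := k)
local notation "ε" => counit (R := k)
local notation "δ" => LeftComodule.coact (k := k) (C := C)

/-- The cofree comodule on a vector space. -/
noncomputable instance cofree : LeftComodule k C (C ⊗[k] V) where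
  coact := (TensorProduct.assoc k C C V).toLinearMap ∘ₗ (Δ).rTensor V
  coassoc := by
    apply TensorProduct.ext'
    intro c v
    have e : ∀ d : C, TensorProduct.assoc k C C V (Δ d ⊗ₜ v) =
        sw (Δ d) fun a b => a ⊗ₜ[k] (b ⊗ₜ[k] v) := fun d => by
      conv_lhs => rw [← sw_tmul_self (Δ d), sw_tmul_right, linearEquiv_sw]
      simp only [TensorProduct.assoc_tmul]
    simp only [LinearMap.comp_apply, LinearMap.rTensor_tmul, LinearEquiv.coe_coe, e, map_sw,
      LinearMap.lTensor_tmul, tmul_sw]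
    have e' : ∀ a b : C, TensorProduct.assoc k C C (C ⊗[k] V) (Δ a ⊗ₜ (b ⊗ₜ v)) =
        sw (Δ a) fun a₁ a₂ => a₁ ⊗ₜ[k] (a₂ ⊗ₜ[k] (b ⊗ₜ[k] v)) := fun a b => by
      conv_lhs => rw [← sw_tmul_self (Δ a), sw_tmul_right, linearEquiv_sw]
      simp only [TensorProduct.assoc_tmul]
    simp only [e']
    exact sw_comul_assoc c
  counit_coact := by
    apply TensorProduct.ext'
    intro c v
    simp only [LinearMap.comp_apply, LinearMap.rTensor_tmul, LinearEquiv.coe_coe]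
    conv_lhs => rw [← sw_tmul_self (Δ c), sw_tmul_right]
    simp only [map_sw, linearEquiv_sw, TensorProduct.assoc_tmul, LinearMap.rTensor_tmul,
      TensorProduct.lid_tmul]
    exact sw_comul_counit_left c (F := fun b => b ⊗ₜ[k] v)

theorem coact_tmul (c : C) (v : V) :
    δ (c ⊗ₜ[k] v) = sw (Δ c) fun a b => a ⊗ₜ[k] (b ⊗ₜ[k] v) := by
  change TensorProduct.assoc k C C V (Δ c ⊗ₜ v) = _
  conv_lhs => rw [← sw_tmul_self (Δ c), sw_tmul_right, linearEquiv_sw]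
  simp only [TensorProduct.assoc_tmul]

theorem isColinear_cofree_iff {f : C ⊗[k] V →ₗ[k] M} :
    IsColinear k C f ↔ ∀ c v, δ (f (c ⊗ₜ v)) = sw (Δ c) fun a b => a ⊗ₜ[k] f (b ⊗ₜ v) := by
  have e : ∀ c v, (f.lTensor C ∘ₗ δ) (c ⊗ₜ[k] v) = sw (Δ c) fun a b => a ⊗ₜ[k] f (b ⊗ₜ v) :=
    fun c v => by
      rw [LinearMap.comp_apply, coact_tmul, map_sw]
      simp only [LinearMap.lTensor_tmul]
  constructor
  · intro h c v
    rw [← e, ← h]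
    rfl
  · intro h
    apply TensorProduct.ext'
    intro c v
    rw [e, ← h]
    rfl

/-- The colinear map `m ↦ m₍₋₁₎ ⊗ f(m₍₀₎)` into a cofree comodule. -/
theorem isColinear_lTensor_coact (f : M →ₗ[k] V) : IsColinear k C (f.lTensor C ∘ₗ δ) := by
  rw [isColinear_iff]
  intro m
  simp only [LinearMap.comp_apply, lTensor_eq_sw]
  rw [map_sw]
  simp only [coact_tmul, tmul_sw]
  exact sw_coact_assoc m

theorem isColinear_coact : IsColinear k C (LeftComodule.coact (k := k) (C := C) (M := M)) := by
  have := isColinear_lTensor_coact (k := k) (C := C) (LinearMap.id : M →ₗ[k] M)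
  rwa [LinearMap.lTensor_id, LinearMap.id_comp] at this

theorem coact_injective : Function.Injective (LeftComodule.coact (k := k) (C := C) (M := M)) := by
  intro a b h
  have := LinearMap.congr_fun (LeftComodule.counit_coact (k := k) (C := C) (M := M))
  rw [← LinearMap.id_apply (R := k) a, ← LinearMap.id_apply (R := k) b, ← this, ← this]
  simp only [LinearMap.comp_apply, h]

end Cofree

section Injective

variable {k : Type*} {C M N : Type u} [Field k] [AddCommGroup C] [Module k C] [Coalgebra k C]
  [AddCommGroup M] [Module k M] [LeftComodule k C M] [AddCommGroup N] [Module k N]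
  [LeftComodule k C N]

theorem IsInjective.of_retract (hM : IsInjective k C M) {i : N →ₗ[k] M} {r : M →ₗ[k] N}
    (hi : IsColinear k C i) (hr : IsColinear k C r) (h : r ∘ₗ i = LinearMap.id) :
    IsInjective k C N := by
  intro X Y _ _ _ _ _ _ j f hj hinj hf
  obtain ⟨g, hg, hgf⟩ := hM X Y j (i ∘ₗ f) hj hinj (hi.comp hf)
  exact ⟨r ∘ₗ g, hr.comp hg, by
    rw [LinearMap.comp_assoc, hgf, ← LinearMap.comp_assoc, h, LinearMap.id_comp]⟩

theorem IsProjective.of_retract (hM : IsProjective k C M) {i : N →ₗ[k] M} {r : M →ₗ[k] N}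
    (hi : IsColinear k C i) (hr : IsColinear k C r) (h : r ∘ₗ i = LinearMap.id) :
    IsProjective k C N := by
  intro X Y _ _ _ _ _ _ p f hp hs hf
  obtain ⟨g, hg, hgf⟩ := hM X Y p (f ∘ₗ r) hp hs (hf.comp hr)
  exact ⟨g ∘ₗ i, hg.comp hi, by
    rw [← LinearMap.comp_assoc, hgf, LinearMap.comp_assoc, h, LinearMap.comp_id]⟩

/-- An injective comodule is a direct summand of a cofree one. -/
theorem IsInjective.exists_retraction (hM : IsInjective k C M) :
    ∃ r : C ⊗[k] M →ₗ[k] M, IsColinear k C r ∧ r ∘ₗ coact (C := C) = LinearMap.id :=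
  hM M (C ⊗[k] M) (coact (C := C)) LinearMap.id isColinear_coact coact_injective isColinear_id

variable (k C) in
theorem isInjective_self : IsInjective k C C := by
  intro X Y _ _ _ _ _ _ i f hi hinj hf
  obtain ⟨r, hr⟩ := LinearMap.exists_leftInverse_of_injective i (LinearMap.ker_eq_bot.2 hinj)
  have e : ∀ φ : Y →ₗ[k] k, ∀ y, ((TensorProduct.rid k C).toLinearMap ∘ₗ φ.lTensor C ∘ₗ
      coact (C := C)) y = sw (coact (k := k) (C := C) y) fun c z => φ z • c := fun φ y => by
    simp only [LinearMap.comp_apply, lTensor_eq_sw, LinearEquiv.coe_coe, linearEquiv_sw,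
      TensorProduct.rid_tmul]
  refine ⟨(TensorProduct.rid k C).toLinearMap ∘ₗ (counit ∘ₗ f ∘ₗ r).lTensor C ∘ₗ coact (C := C),
    ?_, ?_⟩
  · rw [isColinear_iff]
    intro y
    simp only [e, tmul_sw]
    rw [map_sw]
    simp only [map_smul, coact_self]
    rw [← sw_coact_assoc y (F := fun a b z => a ⊗ₜ[k] ((counit ∘ₗ f ∘ₗ r) z • b))]
    refine sw_congr fun c z => ?_
    conv_lhs => rw [← sw_tmul_self (comul (R := k) c), smul_sw]
    simp only [TensorProduct.tmul_smul]
  · ext x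
    rw [LinearMap.comp_apply, e, hi.sw_coact x]
    have : ∀ z, (counit ∘ₗ f ∘ₗ r) (i z) = counit (R := k) (f z) := fun z => by
      have := LinearMap.congr_fun hr z
      simp only [LinearMap.comp_apply, LinearMap.id_apply] at this ⊢
      rw [this]
    simp only [this]
    have h := hf.sw_coact x (F := fun c z => counit (R := k) z • c)
    rw [← h]
    exact sw_comul_counit_right (f x) (F := fun c => c)

theorem hasFiniteQuotient_of_ne_zero {f : M →ₗ[k] N} (hf : IsColinear k C f) (h0 : f ≠ 0)
    (hfin : FiniteDimensional k (LinearMap.range f)) : HasFiniteQuotient k C M :=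
  ⟨LinearMap.range f, inferInstance, inferInstance, hf.isSubcomodule_range.comodule,
    f.rangeRestrict, hf.rangeRestrict, f.surjective_rangeRestrict,
    Submodule.nontrivial_iff_ne_bot.2 fun h => h0 (LinearMap.range_eq_bot.1 h), hfin⟩

end Injective

end LeftComodule

/-! ### Integrals from finite-dimensional quotients -/

theorem sum_sw {k V W Z ι : Type*} [Field k] [AddCommGroup V] [Module k V] [AddCommGroup W]
    [Module k W] [AddCommGroup Z] (s : Finset ι) (t : V ⊗[k] W) (F : ι → V → W → Z) :
    (∑ i ∈ s, sw t (F i)) = sw t fun v w => ∑ i ∈ s, F i v w :=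
  Finset.sum_comm

theorem Module.Basis.map_eq_sum_coord {k V Z ι : Type*} [Field k] [AddCommGroup V] [Module k V]
    [AddCommGroup Z] [Module k Z] [Fintype ι] (ℬ : Module.Basis ι k V) (f : V →ₗ[k] Z) (v : V) :
    f v = ∑ j, ℬ.coord j v • f (ℬ j) := by
  conv_lhs => rw [← ℬ.sum_repr v, map_sum]
  simp only [map_smul, Module.Basis.coord_apply]

section MatrixCoefficients

variable {k C Q ι : Type*} [Field k] [AddCommGroup C] [Module k C] [Coalgebra k C]
  [AddCommGroup Q] [Module k Q] [LeftComodule k C Q]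

local notation "Δ" => comul (R := k)
local notation "ε" => counit (R := k)
local notation "δ" => LeftComodule.coact (k := k) (C := C)

variable (C) in
/-- The matrix coefficient `q₍₋₁₎ ξ(q₍₀₎)` of a comodule. -/
noncomputable def matrixCoeff (ξ : Q →ₗ[k] k) : Q →ₗ[k] C :=
  (TensorProduct.rid k C).toLinearMap ∘ₗ ξ.lTensor C ∘ₗ δ

theorem matrixCoeff_apply (ξ : Q →ₗ[k] k) (q : Q) :
    matrixCoeff C ξ q = sw (δ q) fun c q' => ξ q' • c := by
  simp only [matrixCoeff, LinearMap.comp_apply, lTensor_eq_sw, LinearEquiv.coe_coe, linearEquiv_sw,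
    TensorProduct.rid_tmul]

theorem counit_matrixCoeff (ξ : Q →ₗ[k] k) (q : Q) : ε (matrixCoeff C ξ q) = ξ q := by
  rw [matrixCoeff_apply, map_sw]
  simp only [map_smul, smul_eq_mul, mul_comm (ξ _)]
  exact sw_coact_counit q (F := fun z => ξ z)

theorem comul_matrixCoeff (ξ : Q →ₗ[k] k) (q : Q) :
    Δ (matrixCoeff C ξ q) = sw (δ q) fun c q' => c ⊗ₜ[k] matrixCoeff C ξ q' := by
  simp only [matrixCoeff_apply, map_sw, map_smul, tmul_sw, TensorProduct.tmul_smul]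
  rw [← sw_coact_assoc q (F := fun a b z => ξ z • a ⊗ₜ[k] b)]
  refine sw_congr fun c z => ?_
  conv_lhs => rw [← sw_tmul_self (Δ c), smul_sw]

theorem isColinear_matrixCoeff (ξ : Q →ₗ[k] k) :
    LeftComodule.IsColinear k C (matrixCoeff C ξ) :=
  LeftComodule.isColinear_iff.2 fun q => comul_matrixCoeff ξ q

theorem comul_matrixCoeff_basis [Fintype ι] (ℬ : Module.Basis ι k Q) (ξ : Q →ₗ[k] k) (q : Q) :
    Δ (matrixCoeff C ξ q) = ∑ j, matrixCoeff C (ℬ.coord j) q ⊗ₜ[k] matrixCoeff C ξ (ℬ j) := by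
  rw [comul_matrixCoeff]
  simp only [matrixCoeff_apply _ q, sw_tmul_right]
  rw [sum_sw]
  refine sw_congr fun c z => ?_
  rw [ℬ.map_eq_sum_coord (matrixCoeff C ξ) z, TensorProduct.tmul_sum]
  simp only [TensorProduct.tmul_smul, TensorProduct.smul_tmul']

end MatrixCoefficients

section Integrals

variable {k H R Q ι : Type*} [Field k] [Ring H] [HopfAlgebra k H]
  [Ring R] [Algebra k R] [Coalgebra k R] [Module H R] [IsScalarTower k H R]
  [YetterDrinfeldModule k H R] [BraidedHopfAlgebra k H R]
  [AddCommGroup Q] [Module k Q] [LeftComodule k R Q]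

local notation "Δ" => comul (R := k)
local notation "ε" => counit (R := k)
local notation "ρ" => LeftComodule.coact (k := k) (C := H)
local notation "𝖲" => HopfAlgebra.antipode k (A := H)
local notation "σ" => BraidedHopfAlgebra.antipode k H (R := R)

variable (hH : Function.Bijective (HopfAlgebra.antipode k (A := H)))
  (hR : Function.Bijective (BraidedHopfAlgebra.antipode k H : R →ₗ[k] R))
  [Fintype ι] (ℬ : Module.Basis ι k Q) (φ : R →ₗ[k] Q)

/-- The functional `x ↦ ∑ⱼ qⱼ*(φ(κ(c_ξ(qⱼ)) x))` attached to a map to a finite-dimensional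
comodule with basis `qⱼ`. -/
noncomputable def traceIntegral (ξ : Q →ₗ[k] k) : R →ₗ[k] k :=
  ∑ j, ℬ.coord j ∘ₗ φ ∘ₗ LinearMap.mulLeft k (kappa hH hR (matrixCoeff R ξ (ℬ j)))

theorem traceIntegral_apply (ξ : Q →ₗ[k] k) (x : R) : traceIntegral hH hR ℬ φ ξ x =
    ∑ j, ℬ.coord j (φ (kappa hH hR (matrixCoeff R ξ (ℬ j)) * x)) := by
  simp [traceIntegral]

theorem isLeftIntegral_traceIntegral (hφ : LeftComodule.IsColinear k R φ) (ξ : Q →ₗ[k] k) :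
    IsLeftIntegral (traceIntegral hH hR ℬ φ ξ) := by
  intro x
  have h₁ : ∀ j z, (sw (Δ z) fun a b => (ℬ.coord j ∘ₗ φ) b • a) =
      ∑ i, ℬ.coord i (φ z) • matrixCoeff R (ℬ.coord j) (ℬ i) := fun j z => by
    calc _ = matrixCoeff R (ℬ.coord j) (φ z) := by
          rw [matrixCoeff_apply, hφ.sw_coact z]
          rfl
      _ = _ := ℬ.map_eq_sum_coord _ _
  have h₂ : ∀ i, (∑ j, sw (ρ (kappa hH hR (matrixCoeff R ξ (ℬ j)))) fun g z => sw (Δ z) fun a b =>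
      ℬ.coord i (φ (b * x)) • 𝖲 g • (σ a * matrixCoeff R (ℬ.coord j) (ℬ i))) =
      ℬ.coord i (φ (kappa hH hR (matrixCoeff R ξ (ℬ i)) * x)) • (1 : R) := fun i => by
    have hF : Lin₂ k fun u b : R => (ℬ.coord i ∘ₗ φ) (b * x) • u := lin₂_auto
    have hG : Lin₂ k fun q₁ q₂ : R => sw (ρ (kappa hH hR q₂)) fun g z => sw (Δ z) fun a b =>
      (ℬ.coord i ∘ₗ φ) (b * x) • 𝖲 g • (σ a * q₁) := lin₂_auto
    have h := congrArg hF.lift (sw_kappa_coinvariant hH hR (matrixCoeff R ξ (ℬ i)))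
    simp only [map_sw, hF.lift_tmul] at h
    rw [← hG.lift_eq_sw, comul_matrixCoeff_basis ℬ, map_sum] at h
    simp only [hG.lift_tmul] at h
    exact h
  calc _ = ∑ j, sw (Δ x) fun a b =>
          (ℬ.coord j ∘ₗ φ) (kappa hH hR (matrixCoeff R ξ (ℬ j)) * b) • a := by
        simp only [traceIntegral_apply, Finset.sum_smul, sum_sw]
        rfl
    _ = ∑ j, ∑ i, sw (ρ (kappa hH hR (matrixCoeff R ξ (ℬ j)))) fun g z => sw (Δ z) fun a b =>
          ℬ.coord i (φ (b * x)) • 𝖲 g • (σ a * matrixCoeff R (ℬ.coord j) (ℬ i)) := by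
        refine Finset.sum_congr rfl fun j _ => ?_
        rw [sw_comul_mul_right_apply (H := H)]
        simp only [h₁, sum_sw]
        refine sw_congr fun g z => sw_congr fun a b => ?_
        rw [Finset.mul_sum, Finset.smul_sum]
        refine Finset.sum_congr rfl fun i _ => ?_
        rw [mul_smul_comm, smul_comm]
    _ = _ := by
        rw [Finset.sum_comm, Finset.sum_congr rfl fun i _ => h₂ i, traceIntegral_apply,
          Finset.sum_smul]

theorem sum_traceIntegral (l : ι) (x : R) :
    (∑ i, traceIntegral hH hR ℬ φ (ℬ.coord i)
      ((thetaEquiv hH hR).symm (matrixCoeff R (ℬ.coord l) (ℬ i)) * x)) = ℬ.coord l (φ x) := by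
  have h : ∀ j, (∑ i, ℬ.coord j (φ (kappa hH hR (matrixCoeff R (ℬ.coord i) (ℬ j)) *
      ((thetaEquiv hH hR).symm (matrixCoeff R (ℬ.coord l) (ℬ i)) * x)))) =
      ℬ.coord l (ℬ j) * ℬ.coord j (φ x) := fun j => by
    have hG : Lin₂ k fun a b : R => (ℬ.coord j ∘ₗ φ) (kappa hH hR a *
      (thetaEquiv hH hR).symm b * x) := lin₂_auto
    have h := sw_kappa_mul_theta hH hR (matrixCoeff R (ℬ.coord l) (ℬ j))
      (F := fun m => (ℬ.coord j ∘ₗ φ) (m * x))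
    rw [← hG.lift_eq_sw, comul_matrixCoeff_basis ℬ, map_sum, counit_matrixCoeff, one_mul] at h
    simp only [hG.lift_tmul] at h
    simp only [mul_assoc] at h
    exact h
  simp only [traceIntegral_apply]
  rw [Finset.sum_comm, Finset.sum_congr rfl fun j _ => h j]
  rw [ℬ.map_eq_sum_coord (ℬ.coord l) (φ x)]
  simp only [smul_eq_mul, mul_comm]

include hH hR in
theorem exists_isLeftIntegral_of_finite_quotient [FiniteDimensional k Q]
    (hφ : LeftComodule.IsColinear k R φ) (h0 : φ ≠ 0) :
    ∃ l : R →ₗ[k] k, IsLeftIntegral l ∧ l ≠ 0 := by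
  let ℬ := Module.finBasis k Q
  by_contra! hcon
  refine h0 (LinearMap.ext fun x => ?_)
  refine ℬ.ext_elem fun l => ?_
  have := sum_traceIntegral hH hR ℬ φ l x
  rw [Finset.sum_congr rfl fun i _ => by
    rw [hcon _ (isLeftIntegral_traceIntegral hH hR ℬ φ hφ (ℬ.coord i))]] at this
  simp only [LinearMap.zero_apply, Finset.sum_const_zero] at this
  rw [LinearMap.zero_apply, map_zero, ← Module.Basis.coord_apply, ← this]
  rfl

end Integrals

theorem exists_finiteDimensional_sw_mem {k V W X Z : Type*} [Field k] [AddCommGroup V] [Module k V]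
    [AddCommGroup W] [Module k W] [AddCommGroup Z] [Module k Z] (t : V ⊗[k] W)
    {F : X → V → W → Z}
    (h : ∀ v w, ∃ N : Submodule k Z, FiniteDimensional k N ∧ ∀ x, F x v w ∈ N) :
    ∃ N : Submodule k Z, FiniteDimensional k N ∧ ∀ x, sw t (F x) ∈ N := by
  choose N hfd hN using h
  let a := (TensorProduct.exists_sum_tmul_eq t).choose_spec.choose
  let b := (TensorProduct.exists_sum_tmul_eq t).choose_spec.choose_spec.choose
  refine ⟨⨆ i, N (a i) (b i), ?_, fun x => ?_⟩
  · have : ∀ i, FiniteDimensional k (N (a i) (b i)) := fun i => hfd _ _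
    exact Submodule.finiteDimensional_iSup _
  · exact Submodule.sum_mem _ fun i _ => Submodule.mem_iSup_of_mem i (hN _ _ _)

/-! ### Averaging with respect to an integral -/

section Averaging

variable {k H R X Y : Type*} [Field k] [Ring H] [HopfAlgebra k H]
  [Ring R] [Algebra k R] [Coalgebra k R] [Module H R] [IsScalarTower k H R]
  [YetterDrinfeldModule k H R] [BraidedHopfAlgebra k H R]
  [AddCommGroup X] [Module k X] [LeftComodule k R X]
  [AddCommGroup Y] [Module k Y] [LeftComodule k R Y]

local notation "Δ" => comul (R := k)
local notation "ε" => counit (R := k)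
local notation "ρ" => LeftComodule.coact (k := k) (C := H)
local notation "δ" => LeftComodule.coact (k := k) (C := R)
local notation "𝖲" => HopfAlgebra.antipode k (A := H)
local notation "σ" => BraidedHopfAlgebra.antipode k H (R := R)

variable {l : R →ₗ[k] k}

include H in
theorem IsLeftIntegral.finiteDimensional_range_matrixCoeff (hl : IsLeftIntegral l) (y : R) :
    FiniteDimensional k (LinearMap.range (matrixCoeff R (l ∘ₗ LinearMap.mulLeft k y))) := by
  obtain ⟨N, hfd, hN⟩ : ∃ N : Submodule k R, FiniteDimensional k N ∧ ∀ x : R,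
      (sw (ρ y) fun g z => sw (Δ z) fun a b => l (b * x) • 𝖲 g • σ a) ∈ N :=
    exists_finiteDimensional_sw_mem _ fun g z => exists_finiteDimensional_sw_mem _ fun a b =>
      ⟨Submodule.span k {𝖲 g • σ a}, inferInstance, fun x =>
        Submodule.smul_mem _ _ (Submodule.mem_span_singleton_self _)⟩
  refine Submodule.finiteDimensional_of_le (S₂ := N) ?_
  rintro _ ⟨x, rfl⟩
  rw [matrixCoeff_apply]
  exact (hl.sw_comul_mul (H := H) x y) ▸ hN x

include H in
theorem IsLeftIntegral.exists_matrixCoeff_apply_ne_zero (hl : IsLeftIntegral l) (h0 : l ≠ 0) {x : R}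
    (hx : x ≠ 0) : ∃ y, matrixCoeff R (l ∘ₗ LinearMap.mulLeft k y) x ≠ 0 := by
  obtain ⟨y, hy⟩ := hl.exists_apply_mul_ne_zero (H := H) h0 hx
  refine ⟨y, fun h => hy ?_⟩
  rw [← LinearMap.mulLeft_apply (R := k), ← LinearMap.comp_apply, ← counit_matrixCoeff (C := R), h,
    map_zero]

include H in
omit [LeftComodule k R X] in
theorem IsLeftIntegral.exists_comp_matrixCoeff_ne_zero (hl : IsLeftIntegral l) (h0 : l ≠ 0)
    {p : R →ₗ[k] X} (hp : p ≠ 0) :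
    ∃ y, p ∘ₗ matrixCoeff R (l ∘ₗ LinearMap.mulLeft k y) ≠ 0 := by
  by_contra! hcon
  refine hp (LinearMap.ext fun x => eq_of_forall_dual (k := k) fun ξ => ?_)
  have hz : (sw (Δ x) fun a b => ξ (p a) • b) = 0 := by
    by_contra h
    obtain ⟨y, hy⟩ := hl.exists_apply_mul_ne_zero (H := H) h0 h
    apply hy
    have := congrArg ξ (LinearMap.congr_fun (hcon y) x)
    rw [LinearMap.comp_apply, matrixCoeff_apply, LeftComodule.coact_self, LinearMap.zero_apply,
      map_zero, map_sw, map_sw] at this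
    simp only [map_smul, smul_eq_mul, LinearMap.comp_apply, LinearMap.mulLeft_apply] at this
    rw [mul_sw, map_sw]
    simpa only [mul_smul_comm, map_smul, smul_eq_mul, mul_comm (ξ _)] using this
  have := congrArg ε hz
  rw [map_zero, map_sw] at this
  simp only [map_smul, smul_eq_mul, mul_comm (ξ _)] at this
  rw [LinearMap.zero_apply, map_zero, ← this]
  exact (sw_comul_counit_right x (F := fun a => ξ (p a))).symm

variable (hH : Function.Bijective (HopfAlgebra.antipode k (A := H)))
  (hR : Function.Bijective (BraidedHopfAlgebra.antipode k H : R →ₗ[k] R))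

/-- The averaged map `r ↦ l(θ(x₍₋₁₎) r) x₍₀₎` is colinear. -/
theorem IsLeftIntegral.coact_average (hl : IsLeftIntegral l) (x : X) (r : R) :
    δ (sw (δ x) fun c z => l ((thetaEquiv hH hR).symm c * r) • z) =
      sw (Δ r) fun a b => a ⊗ₜ[k] sw (δ x) fun c z => l ((thetaEquiv hH hR).symm c * b) • z := by
  calc _ = sw (δ x) fun c z => sw (δ z) fun d z =>
            l ((thetaEquiv hH hR).symm c * r) • d ⊗ₜ[k] z := by
        rw [map_sw]
        refine sw_congr fun c z => ?_
        conv_lhs => rw [map_smul, ← sw_tmul_self (δ z), smul_sw]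
    _ = sw (δ x) fun c z => sw (Δ c) fun a d =>
            l ((thetaEquiv hH hR).symm a * r) • d ⊗ₜ[k] z := (sw_coact_assoc x).symm
    _ = sw (δ x) fun c z => sw (Δ r) fun a b =>
            l ((thetaEquiv hH hR).symm c * b) • a ⊗ₜ[k] z := by
        refine sw_congr fun c z => ?_
        have := congrArg (fun t => t ⊗ₜ[k] z) (hl.sw_theta hH hR c r)
        simpa only [sw_tmul_right, TensorProduct.smul_tmul'] using this.symm
    _ = _ := by
        rw [sw_comm]
        simp only [tmul_sw, TensorProduct.tmul_smul]

/-- The averaged map `r ↦ l(θ(x₍₋₁₎) r) x₍₀₎`. -/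
noncomputable def average (l : R →ₗ[k] k) (x : X) : R →ₗ[k] X :=
  IsLinearMap.mk' (fun r => sw (δ x) fun c z => l ((thetaEquiv hH hR).symm c * r) • z)
    isLinearMap_auto

theorem average_apply (x : X) (r : R) : average hH hR l x r =
    sw (δ x) fun c z => l ((thetaEquiv hH hR).symm c * r) • z := rfl

theorem IsLeftIntegral.isColinear_average (hl : IsLeftIntegral l) (x : X) :
    LeftComodule.IsColinear k R (average hH hR l x) :=
  LeftComodule.isColinear_iff.2 fun r => hl.coact_average hH hR x r

theorem average_ne_zero (h0 : l ≠ 0) {x : X} (hx : x ≠ 0) : average hH hR l x ≠ 0 := by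
  intro hcon
  obtain ⟨b, hb⟩ : ∃ b, l b ≠ 0 := by
    by_contra! h
    exact h0 (LinearMap.ext h)
  let N : Submodule k R :=
    ⨅ r, LinearMap.ker (l ∘ₗ LinearMap.mulRight k r ∘ₗ (thetaEquiv hH hR).symm.toLinearMap)
  have hN : ∀ {c}, c ∈ N ↔ ∀ r, l ((thetaEquiv hH hR).symm c * r) = 0 := by
    simp [N, Submodule.mem_iInf]
  have hz : (sw (δ x) fun c y => sw (δ y) fun d z =>
      l ((thetaEquiv hH hR).symm c * (kappa hH hR d * b)) • z) = 0 := by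
    refine sw_eq_zero_of_forall_dual_right (N := N) (fun ξ => ?_) lin₂_auto fun c hc y => ?_
    · refine hN.2 fun r => ?_
      have := congrArg ξ (LinearMap.congr_fun hcon r)
      rw [average_apply, map_sw, LinearMap.zero_apply, map_zero] at this
      rw [linearEquiv_sw, sw_mul, map_sw, ← this]
      refine sw_congr fun c z => ?_
      rw [map_smul, smul_mul_assoc, map_smul, map_smul, smul_eq_mul, smul_eq_mul, mul_comm]
    · simp only [hN.1 hc, zero_smul]
      simp [sw]
  rw [← sw_coact_assoc x (F := fun c d z =>
    l ((thetaEquiv hH hR).symm c * (kappa hH hR d * b)) • z)] at hz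
  have e : ∀ (c : R) (z : X), (sw (Δ c) fun c d =>
      l ((thetaEquiv hH hR).symm c * (kappa hH hR d * b)) • z) = ε c • l b • z := fun c z => by
    have := sw_theta_mul_kappa hH hR c (F := fun m => l (m * b) • z)
    simpa only [mul_assoc, one_mul] using this
  simp only [e] at hz
  rw [sw_coact_counit x (F := fun z => l b • z)] at hz
  exact (smul_ne_zero hb hx) hz

end Averaging

/-! ### Projectivity of injectives -/

section Projective

variable {k H R X Y : Type*} [Field k] [Ring H] [HopfAlgebra k H]
  [Ring R] [Algebra k R] [Coalgebra k R] [Module H R] [IsScalarTower k H R]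
  [YetterDrinfeldModule k H R] [BraidedHopfAlgebra k H R]
  [AddCommGroup X] [Module k X] [LeftComodule k R X]
  [AddCommGroup Y] [Module k Y] [LeftComodule k R Y]

local notation "Δ" => comul (R := k)
local notation "ε" => counit (R := k)
local notation "ρ" => LeftComodule.coact (k := k) (C := H)
local notation "δ" => LeftComodule.coact (k := k) (C := R)

variable {l : R →ₗ[k] k}
variable (hH : Function.Bijective (HopfAlgebra.antipode k (A := H)))
  (hR : Function.Bijective (BraidedHopfAlgebra.antipode k H : R →ₗ[k] R))

theorem map_average {p : X →ₗ[k] Y} (hp : LeftComodule.IsColinear k R p) (x : X) (r : R) :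
    p (average hH hR l x r) = average hH hR l (p x) r := by
  rw [average_apply, average_apply, hp.sw_coact x, map_sw]
  simp only [map_smul]

theorem average_comp_smul_apply (h : H) (x : X) (r : R) :
    average hH hR (l ∘ₗ actEnd k H R h) x r =
      sw (δ x) fun c z => l (h • ((thetaEquiv hH hR).symm c * r)) • z := rfl

theorem lin₂_average_comp_smul (r : R) : Lin₂ k fun (h : H) (x : X) =>
    average hH hR (l ∘ₗ actEnd k H R h) x r := by
  simp only [average_comp_smul_apply]
  exact lin₂_auto

/-- The map `r ↦ ∑ l(hᵢ • (θ(xᵢ₍₋₁₎) r₍₁₎)) xᵢ₍₀₎`, where `u(r₍₂₎) = ∑ hᵢ ⊗ xᵢ`. -/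
noncomputable def averageAlong (l : R →ₗ[k] k) (u : R →ₗ[k] H ⊗[k] X) : R →ₗ[k] X :=
  IsLinearMap.mk' (fun r => sw (Δ r) fun a b => sw (u b) fun h x => sw (δ x) fun c z =>
    l (h • ((thetaEquiv hH hR).symm c * a)) • z) isLinearMap_auto

theorem averageAlong_apply (u : R →ₗ[k] H ⊗[k] X) (r : R) : averageAlong hH hR l u r =
    sw (Δ r) fun a b => sw (u b) fun h x => average hH hR (l ∘ₗ actEnd k H R h) x a := rfl

theorem IsLeftIntegral.isColinear_averageAlong (hl : IsLeftIntegral l) (u : R →ₗ[k] H ⊗[k] X) :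
    LeftComodule.IsColinear k R (averageAlong hH hR l u) := by
  rw [LeftComodule.isColinear_iff]
  intro r
  have e : ∀ (h : H) (x : X) (a : R), δ (average hH hR (l ∘ₗ actEnd k H R h) x a) =
      sw (Δ a) fun a₁ a₂ => a₁ ⊗ₜ[k] average hH hR (l ∘ₗ actEnd k H R h) x a₂ := fun h x a =>
    LeftComodule.isColinear_iff.1 ((hl.comp_smul h).isColinear_average hH hR x) a
  calc _ = sw (Δ r) fun a b => sw (Δ a) fun a₁ a₂ => sw (u b) fun h x => a₁ ⊗ₜ[k]
            average hH hR (l ∘ₗ actEnd k H R h) x a₂ := by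
        rw [averageAlong_apply, map_sw]
        refine sw_congr fun a b => ?_
        rw [map_sw, sw_comm]
        exact sw_congr fun h x => e h x a
    _ = sw (Δ r) fun a b => sw (Δ b) fun b c => sw (u c) fun h x => a ⊗ₜ[k]
            average hH hR (l ∘ₗ actEnd k H R h) x b := by
        simp only [average_comp_smul_apply]
        exact sw_comul_assoc r (F := fun a b c => sw (u c) fun h x => a ⊗ₜ[k]
          sw (δ x) fun c z => l (h • ((thetaEquiv hH hR).symm c * b)) • z)
    _ = _ := by
        simp only [averageAlong_apply, tmul_sw]
        rfl

/-- The map `z ↦ s(z₍₋₂₎) ⊗ θ⁻¹(s²(z₍₋₁₎) • (b T(z₍₀₎)))` inverting the averaging process. -/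
noncomputable def averageSection (b : R) : R →ₗ[k] H ⊗[k] R :=
  IsLinearMap.mk' (fun z => sw (ρ z) fun g z' => sw (ρ z') fun h w => antipodeInv k H hH g ⊗ₜ[k]
    thetaEquiv hH hR (antipodeInv k H hH (antipodeInv k H hH h) • (b * braidedAntipodeInv hR w)))
    isLinearMap_auto

theorem sw_averageSection {Z : Type*} [AddCommGroup Z] [Module k Z] (b z : R) {F : H → R → Z}
    (hF : Lin₂ k F) : sw (averageSection hH hR b z) F = sw (ρ z) fun g z' => sw (ρ z') fun h w =>
      F (antipodeInv k H hH g) (thetaEquiv hH hR (antipodeInv k H hH (antipodeInv k H hH h) •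
        (b * braidedAntipodeInv hR w))) := by
  rw [← hF.lift_eq_sw, averageSection, IsLinearMap.mk'_apply]
  simp only [map_sw, hF.lift_tmul]

theorem IsLeftIntegral.average_thetaEquiv (hl : IsLeftIntegral l) (v r : R) :
    average hH hR l (thetaEquiv hH hR v) r = sw (Δ r) fun a b => l (v * b) • a := by
  have := hl.sw_theta hH hR (thetaEquiv hH hR v) r
  rw [LinearEquiv.symm_apply_apply] at this
  rw [this]
  rfl

theorem IsLeftIntegral.averageAlong_averageSection (hl : IsLeftIntegral l) (b r : R) :
    averageAlong hH hR l (averageSection hH hR b) r = l b • r := by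
  calc _ = sw (Δ r) fun r₁ r₂ => sw (ρ r₂) fun g z => sw (ρ z) fun h w => sw (Δ r₁) fun x y =>
            l (antipodeInv k H hH g • ((antipodeInv k H hH (antipodeInv k H hH h) •
              (b * braidedAntipodeInv hR w)) * y)) • x := by
        rw [averageAlong_apply]
        refine sw_congr fun r₁ r₂ => ?_
        rw [sw_averageSection _ _ _ _ (lin₂_average_comp_smul hH hR r₁)]
        exact sw_congr fun g z => sw_congr fun h w =>
          (hl.comp_smul _).average_thetaEquiv hH hR _ _
    _ = sw (Δ r) fun r₁ r₂ => sw (Δ r₁) fun x y => l (sw (ρ r₂) fun g w =>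
            b * braidedAntipodeInv hR w * (antipodeInv k H hH g • y)) • x := by
        refine sw_congr fun r₁ r₂ => ?_
        simp only [← sw_mul_antipodeInv_smul hH hR, map_sw, sw_smul]
        conv_rhs => rw [sw_comm]
        exact sw_congr fun g z => sw_comm _ _ _
    _ = sw (Δ r) fun x r' => sw (Δ r') fun y r₂ => l (sw (ρ r₂) fun g w =>
            b * braidedAntipodeInv hR w * (antipodeInv k H hH g • y)) • x := sw_comul_assoc r
    _ = sw (Δ r) fun x r' => ε r' • l b • x := by
        refine sw_congr fun x r' => ?_
        have := congrArg (fun t => l (b * t) • x) (sw_antipodeInv_inverse_braiding hH hR r')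
        simpa only [mul_sw, map_sw, sw_smul, mul_smul_comm, mul_one, map_smul, smul_assoc,
          mul_assoc] using this
    _ = _ := sw_comul_counit_right r (F := fun x => l b • x)

theorem averageAlong_comp (p : X →ₗ[k] Y) (hp : LeftComodule.IsColinear k R p)
    (u : R →ₗ[k] H ⊗[k] X) (r : R) :
    p (averageAlong hH hR l u r) = averageAlong hH hR l (p.lTensor H ∘ₗ u) r := by
  rw [averageAlong_apply, averageAlong_apply, map_sw]
  refine sw_congr fun a b => ?_
  rw [map_sw, LinearMap.comp_apply, LinearMap.lTensor,
    sw_map _ _ _ (lin₂_average_comp_smul hH hR a)]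
  exact sw_congr fun h x => map_average hH hR hp x a

end Projective

section Projective

variable {k R : Type u} {H : Type v} [Field k] [Ring H] [HopfAlgebra k H]
  [Ring R] [Algebra k R] [Coalgebra k R] [Module H R] [IsScalarTower k H R]
  [YetterDrinfeldModule k H R] [BraidedHopfAlgebra k H R]

theorem IsLeftIntegral.isProjective_self
    (hH : Function.Bijective (HopfAlgebra.antipode k (A := H)))
    (hR : Function.Bijective (BraidedHopfAlgebra.antipode k H : R →ₗ[k] R))
    {l : R →ₗ[k] k} (hl : IsLeftIntegral l) (h0 : l ≠ 0) : LeftComodule.IsProjective k R R := by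
  intro X Y _ _ _ _ _ _ p f hp hs hf
  obtain ⟨b, hb⟩ : ∃ b, l b ≠ 0 := by
    by_contra! h
    exact h0 (LinearMap.ext h)
  obtain ⟨q, hq⟩ := LinearMap.exists_rightInverse_of_surjective p (LinearMap.range_eq_top.2 hs)
  refine ⟨averageAlong hH hR ((l b)⁻¹ • l) ((q ∘ₗ f).lTensor H ∘ₗ averageSection hH hR b), ?_, ?_⟩
  · refine IsLeftIntegral.isColinear_averageAlong hH hR (fun x => ?_) _
    have := congrArg (fun t => (l b)⁻¹ • t) (hl x)
    simpa only [smul_sw, LinearMap.smul_apply, smul_assoc] using this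
  · have hl' : IsLeftIntegral ((l b)⁻¹ • l) := fun x => by
      have := congrArg (fun t => (l b)⁻¹ • t) (hl x)
      simpa only [smul_sw, LinearMap.smul_apply, smul_assoc] using this
    ext r
    rw [LinearMap.comp_apply, averageAlong_comp hH hR p hp, ← LinearMap.comp_assoc,
      ← LinearMap.lTensor_comp, ← LinearMap.comp_assoc, hq, LinearMap.id_comp,
      ← averageAlong_comp hH hR f hf, hl'.averageAlong_averageSection hH hR, LinearMap.smul_apply,
      smul_eq_mul, inv_mul_cancel₀ hb, one_smul]

end Projective

namespace LeftComodule

variable {k C : Type u} [Field k] [AddCommGroup C] [Module k C] [Coalgebra k C]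

/-- If the coalgebra is a projective comodule, so are all cofree comodules. -/
theorem IsProjective.cofree (hC : IsProjective k C C) (V : Type u) [AddCommGroup V] [Module k V] :
    IsProjective k C (C ⊗[k] V) := by
  intro X Y _ _ _ _ _ _ p f hp hs hf
  let ℬ := Module.Basis.ofVectorSpace k V
  have hf' : ∀ v, IsColinear k C (f ∘ₗ (TensorProduct.mk k C V).flip v) := fun v =>
    isColinear_iff.2 fun c => isColinear_cofree_iff.1 hf c v
  choose g hg hpg using fun j => hC X Y p _ hp hs (hf' (ℬ j))
  let G : V →ₗ[k] C →ₗ[k] X := ℬ.constr k g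
  have hGℬ : ∀ j, G (ℬ j) = g j := fun j => ℬ.constr_basis k g j
  have hG : ∀ v, IsColinear k C (G v) := fun v => by
    refine Submodule.span_induction (p := fun v _ => IsColinear k C (G v)) ?_ ?_ ?_ ?_ (ℬ.mem_span v)
    · rintro _ ⟨j, rfl⟩
      rw [hGℬ]
      exact hg j
    · rw [map_zero]
      exact isColinear_zero
    · intro x y _ _ hx hy
      rw [map_add]
      exact hx.add hy
    · intro c x _ hx
      rw [map_smul]
      exact hx.smul c
  refine ⟨TensorProduct.lift G.flip, isColinear_cofree_iff.2 fun c v => ?_, ?_⟩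
  · simp only [TensorProduct.lift.tmul, LinearMap.flip_apply]
    exact isColinear_iff.1 (hG v) c
  · have : p.compRight k ∘ₗ G = (TensorProduct.mk k C V).flip.compr₂ f := by
      refine ℬ.ext fun j => ?_
      rw [LinearMap.comp_apply, hGℬ]
      exact hpg j
    apply TensorProduct.ext'
    intro c v
    exact LinearMap.congr_fun (LinearMap.congr_fun this v) c

theorem IsInjective.isProjective (hC : IsProjective k C C) {M : Type u} [AddCommGroup M]
    [Module k M] [LeftComodule k C M] (hM : IsInjective k C M) : IsProjective k C M := by
  obtain ⟨r, hr, h⟩ := hM.exists_retraction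
  exact (hC.cofree M).of_retract isColinear_coact hr h

end LeftComodule

/-! ### Hulls and covers from endomorphisms of finite rank -/

namespace LeftComodule

section Minimal

variable {k C : Type u} [Field k] [AddCommGroup C] [Module k C] [Coalgebra k C]
  {I S : Type u} [AddCommGroup I] [Module k I] [LeftComodule k C I]
  [AddCommGroup S] [Module k S] [LeftComodule k C S]

/-- The range of an endomorphism of finite rank is a retract if the rank does not drop on
squaring. -/
theorem IsColinear.exists_retraction_range {g : I →ₗ[k] I} (hg : IsColinear k C g)
    (hfd : FiniteDimensional k (LinearMap.range g))
    (hle : Module.finrank k (LinearMap.range g) ≤ Module.finrank k (LinearMap.range (g ∘ₗ g))) :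
    letI := hg.isSubcomodule_range.comodule
    ∃ r : I →ₗ[k] LinearMap.range g, IsColinear k C r ∧
      r ∘ₗ (LinearMap.range g).subtype = LinearMap.id := by
  let _ := hg.isSubcomodule_range.comodule
  let e₀ : LinearMap.range g →ₗ[k] LinearMap.range g :=
    g.rangeRestrict ∘ₗ (LinearMap.range g).subtype
  have he₀ : IsColinear k C e₀ :=
    hg.rangeRestrict.comp hg.isSubcomodule_range.isColinear_subtype
  have hrange : LinearMap.range (g ∘ₗ g) = LinearMap.range g :=
    Submodule.eq_of_le_of_finrank_le (LinearMap.range_comp_le_range g g) hle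
  have hsurj : Function.Surjective e₀ := by
    rintro ⟨y, hy⟩
    rw [← hrange] at hy
    obtain ⟨x, rfl⟩ := hy
    exact ⟨⟨g x, x, rfl⟩, rfl⟩
  let e := LinearEquiv.ofBijective e₀ ⟨LinearMap.injective_iff_surjective.2 hsurj, hsurj⟩
  have he : IsColinear k C (e : LinearMap.range g →ₗ[k] LinearMap.range g) := he₀
  refine ⟨e.symm.toLinearMap ∘ₗ g.rangeRestrict, he.symm.comp hg.rangeRestrict, ?_⟩
  ext x : 1
  exact e.symm_apply_apply x

theorem IsInjective.hasFiniteInjectiveHull (hI : IsInjective k C I) {i : S →ₗ[k] I}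
    (hi : IsColinear k C i) (hinj : Function.Injective i) {g : I →ₗ[k] I} (hg : IsColinear k C g)
    (hfd : FiniteDimensional k (LinearMap.range g)) (hgi : g ∘ₗ i = i) :
    HasFiniteInjectiveHull k C S := by
  classical
  have hex : ∃ n, ∃ g : I →ₗ[k] I, IsColinear k C g ∧ FiniteDimensional k (LinearMap.range g) ∧
      g ∘ₗ i = i ∧ Module.finrank k (LinearMap.range g) = n := ⟨_, g, hg, hfd, hgi, rfl⟩
  obtain ⟨g, hg, hfd, hgi, hn⟩ := Nat.find_spec hex
  have hmin : ∀ g' : I →ₗ[k] I, IsColinear k C g' → FiniteDimensional k (LinearMap.range g') →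
      g' ∘ₗ i = i → Module.finrank k (LinearMap.range g) ≤ Module.finrank k (LinearMap.range g') :=
    fun g' h₁ h₂ h₃ => hn ▸ Nat.find_min' hex ⟨g', h₁, h₂, h₃, rfl⟩
  let _ := hg.isSubcomodule_range.comodule
  have hsub := hg.isSubcomodule_range.isColinear_subtype
  have hgg : FiniteDimensional k (LinearMap.range (g ∘ₗ g)) :=
    Submodule.finiteDimensional_of_le (LinearMap.range_comp_le_range g g)
  obtain ⟨r, hr, hrid⟩ := hg.exists_retraction_range hfd
    (hmin _ (hg.comp hg) hgg (by rw [LinearMap.comp_assoc, hgi, hgi]))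
  have hmem : ∀ s, i s ∈ LinearMap.range g := fun s => ⟨i s, LinearMap.congr_fun hgi s⟩
  let j := i.codRestrict (LinearMap.range g) hmem
  have hj : IsColinear k C j := hi.codRestrict hg.isSubcomodule_range hmem
  have hjinj : Function.Injective j := fun a b h => hinj (congrArg Subtype.val h)
  refine ⟨LinearMap.range g, inferInstance, inferInstance, inferInstance, j,
    ⟨hj, hjinj, hI.of_retract hsub hr hrid, fun N hN hNj => ?_⟩, hfd⟩
  let _ := hN.quotientComodule
  have hqinj : Function.Injective (N.mkQ ∘ₗ j) := by
    rw [← LinearMap.ker_eq_bot, LinearMap.ker_eq_bot']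
    intro s hs
    have : j s ∈ N ⊓ LinearMap.range j := ⟨(Submodule.Quotient.mk_eq_zero N).1 hs, s, rfl⟩
    rw [hNj, Submodule.mem_bot] at this
    exact hjinj (this.trans (map_zero j).symm)
  obtain ⟨h, hh, hhi⟩ := hI S (LinearMap.range g ⧸ N) (N.mkQ ∘ₗ j) i (hN.isColinear_mkQ.comp hj)
    hqinj hi
  have hle := hmin (h ∘ₗ N.mkQ ∘ₗ g.rangeRestrict)
    (hh.comp (hN.isColinear_mkQ.comp hg.rangeRestrict))
    (Submodule.finiteDimensional_of_le (LinearMap.range_comp_le_range _ h)) (by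
      have : g.rangeRestrict ∘ₗ i = j := LinearMap.ext fun s =>
        Subtype.ext (LinearMap.congr_fun hgi s)
      rw [LinearMap.comp_assoc, LinearMap.comp_assoc, this, hhi])
  have h₁ : Module.finrank k (LinearMap.range (h ∘ₗ N.mkQ ∘ₗ g.rangeRestrict)) ≤
      Module.finrank k (LinearMap.range g ⧸ N) :=
    (Submodule.finrank_mono (LinearMap.range_comp_le_range _ h)).trans (LinearMap.finrank_range_le h)
  have h₂ := Submodule.finrank_quotient_add_finrank N
  exact Submodule.finrank_eq_zero.1 (by omega)

/-- The projective cover of a quotient `p` of a projective comodule `I` factoring through an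
endomorphism of finite rank. -/
theorem IsProjective.exists_projectiveCover (hI : IsProjective k C I) {p : I →ₗ[k] S}
    (hp : IsColinear k C p) (hs : Function.Surjective p) {g : I →ₗ[k] I} (hg : IsColinear k C g)
    (hfd : FiniteDimensional k (LinearMap.range g)) (hpg : p ∘ₗ g = p) :
    HasProjectiveCover k C S := by
  classical
  have hex : ∃ n, ∃ g : I →ₗ[k] I, IsColinear k C g ∧ FiniteDimensional k (LinearMap.range g) ∧
      p ∘ₗ g = p ∧ Module.finrank k (LinearMap.range g) = n := ⟨_, g, hg, hfd, hpg, rfl⟩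
  obtain ⟨g, hg, hfd, hpg, hn⟩ := Nat.find_spec hex
  have hmin : ∀ g' : I →ₗ[k] I, IsColinear k C g' → FiniteDimensional k (LinearMap.range g') →
      p ∘ₗ g' = p → Module.finrank k (LinearMap.range g) ≤ Module.finrank k (LinearMap.range g') :=
    fun g' h₁ h₂ h₃ => hn ▸ Nat.find_min' hex ⟨g', h₁, h₂, h₃, rfl⟩
  let _ := hg.isSubcomodule_range.comodule
  have hsub := hg.isSubcomodule_range.isColinear_subtype
  have hgg : FiniteDimensional k (LinearMap.range (g ∘ₗ g)) :=
    Submodule.finiteDimensional_of_le (LinearMap.range_comp_le_range g g)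
  obtain ⟨r, hr, hrid⟩ := hg.exists_retraction_range hfd
    (hmin _ (hg.comp hg) hgg (by rw [← LinearMap.comp_assoc, hpg, hpg]))
  let q := p ∘ₗ (LinearMap.range g).subtype
  have hq : IsColinear k C q := hp.comp hsub
  have hqs : Function.Surjective q := fun s => by
    obtain ⟨x, rfl⟩ := hs s
    exact ⟨⟨g x, x, rfl⟩, LinearMap.congr_fun hpg x⟩
  refine ⟨LinearMap.range g, inferInstance, inferInstance, inferInstance, q, hq, hqs,
    hI.of_retract hsub hr hrid, fun N hN hNq => ?_⟩
  let _ := hN.comodule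
  have hNs : Function.Surjective (q ∘ₗ N.subtype) := fun s => by
    obtain ⟨x, rfl⟩ := hqs s
    obtain ⟨a, ha, b, hb, rfl⟩ := Submodule.mem_sup.1 (hNq ▸ Submodule.mem_top : x ∈ N ⊔ LinearMap.ker q)
    refine ⟨⟨a, ha⟩, ?_⟩
    rw [map_add, LinearMap.mem_ker.1 hb, add_zero]
    rfl
  obtain ⟨h, hh, hhp⟩ := hI N S (q ∘ₗ N.subtype) p (hq.comp hN.isColinear_subtype) hNs hp
  let m := (LinearMap.range g).subtype ∘ₗ N.subtype
  have hfm : FiniteDimensional k (LinearMap.range (m ∘ₗ h)) :=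
    Submodule.finiteDimensional_of_le (LinearMap.range_comp_le_range h m)
  have hle := hmin (m ∘ₗ h) ((hsub.comp hN.isColinear_subtype).comp hh) hfm hhp
  have h₁ : Module.finrank k (LinearMap.range (m ∘ₗ h)) ≤ Module.finrank k N :=
    (Submodule.finrank_mono (LinearMap.range_comp_le_range h m)).trans (LinearMap.finrank_range_le m)
  exact Submodule.eq_top_of_finrank_eq (le_antisymm (Submodule.finrank_le N) (hle.trans h₁))

end Minimal

end LeftComodule

section Simple

variable {k R : Type u} {H : Type v} [Field k] [Ring H] [HopfAlgebra k H]
  [Ring R] [Algebra k R] [Coalgebra k R] [Module H R] [IsScalarTower k H R]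
  [YetterDrinfeldModule k H R] [BraidedHopfAlgebra k H R]
  {S : Type u} [AddCommGroup S] [Module k S] [LeftComodule k R S]
  {l : R →ₗ[k] k}

open LeftComodule

include H in
theorem IsLeftIntegral.hasFiniteInjectiveHull (hl : IsLeftIntegral l) (h0 : l ≠ 0)
    (hS : IsSimple k R S) : HasFiniteInjectiveHull k R S := by
  obtain ⟨_, hS'⟩ := id hS
  obtain ⟨s, hs⟩ := exists_ne (0 : S)
  obtain ⟨ξ, hξ⟩ : ∃ ξ : S →ₗ[k] k, ξ s ≠ 0 := by
    by_contra! h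
    exact hs (eq_of_forall_dual (k := k) fun f => by rw [h f, map_zero])
  have his : matrixCoeff R ξ s ≠ 0 := fun h => hξ (by
    rw [← counit_matrixCoeff (C := R), h, map_zero])
  have hi := isColinear_matrixCoeff (C := R) ξ
  obtain ⟨y, hy⟩ := hl.exists_matrixCoeff_apply_ne_zero (H := H) h0 his
  have hφ := isColinear_matrixCoeff (C := R) (l ∘ₗ LinearMap.mulLeft k y)
  have hinj := hS.injective_of_ne_zero hi fun h => his (LinearMap.congr_fun h s)
  obtain ⟨g, hg, hgi⟩ := isInjective_self k R S R
    (matrixCoeff R (l ∘ₗ LinearMap.mulLeft k y) ∘ₗ matrixCoeff R ξ) (matrixCoeff R ξ) (hφ.comp hi)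
    (hS.injective_of_ne_zero (hφ.comp hi) fun h => hy (LinearMap.congr_fun h s)) hi
  have hfd := hl.finiteDimensional_range_matrixCoeff (H := H) y
  refine (isInjective_self k R).hasFiniteInjectiveHull hi hinj (hg.comp hφ) ?_
    (by rw [LinearMap.comp_assoc, hgi])
  rw [LinearMap.range_comp]
  infer_instance

theorem IsLeftIntegral.hasProjectiveCover_of_isSimple
    (hH : Function.Bijective (HopfAlgebra.antipode k (A := H)))
    (hR : Function.Bijective (BraidedHopfAlgebra.antipode k H : R →ₗ[k] R))
    (hl : IsLeftIntegral l) (h0 : l ≠ 0) (hS : IsSimple k R S) : HasProjectiveCover k R S := by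
  obtain ⟨_, hS'⟩ := id hS
  obtain ⟨s, hs⟩ := exists_ne (0 : S)
  have hp := hl.isColinear_average hH hR s
  have hp0 := average_ne_zero hH hR h0 hs
  obtain ⟨y, hy⟩ := hl.exists_comp_matrixCoeff_ne_zero (H := H) h0 hp0
  have hφ := isColinear_matrixCoeff (C := R) (l ∘ₗ LinearMap.mulLeft k y)
  have hproj := hl.isProjective_self hH hR h0
  obtain ⟨g, hg, hpg⟩ := hproj R S _ _ (hp.comp hφ) (hS.surjective_of_ne_zero (hp.comp hφ) hy) hp
  have hfd := hl.finiteDimensional_range_matrixCoeff (H := H) y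
  exact hproj.exists_projectiveCover hp (hS.surjective_of_ne_zero hp hp0) (hφ.comp hg)
    (Submodule.finiteDimensional_of_le (LinearMap.range_comp_le_range g _)) hpg

end Simple

/-! ### Direct sums of comodules -/

namespace LeftComodule

section DirectSum

variable {k C : Type*} [Field k] [AddCommGroup C] [Module k C] [Coalgebra k C]
  {ι : Type*} [DecidableEq ι] {P : ι → Type*} [∀ i, AddCommGroup (P i)] [∀ i, Module k (P i)]
  [∀ i, LeftComodule k C (P i)] {M : Type*} [AddCommGroup M] [Module k M] [LeftComodule k C M]

local notation "Δ" => comul (R := k)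
local notation "ε" => counit (R := k)

variable (k C P) in
/-- The coaction of a direct sum of comodules. -/
noncomputable def directSumCoact : DirectSum ι P →ₗ[k] C ⊗[k] DirectSum ι P :=
  DirectSum.toModule k ι _ fun i => (DirectSum.lof k ι P i).lTensor C ∘ₗ coact (C := C)

theorem directSumCoact_comp_lof (i : ι) : directSumCoact k C P ∘ₗ DirectSum.lof k ι P i =
    (DirectSum.lof k ι P i).lTensor C ∘ₗ coact (C := C) := by
  ext x
  simp [directSumCoact]

noncomputable instance directSum : LeftComodule k C (DirectSum ι P) where
  coact := directSumCoact k C P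
  coassoc := by
    refine DirectSum.linearMap_ext k fun i => ?_
    have e₁ : ((DirectSum.lof k ι P i).lTensor C).lTensor C ∘ₗ
        (TensorProduct.assoc k C C (P i)).toLinearMap =
        (TensorProduct.assoc k C C (DirectSum ι P)).toLinearMap ∘ₗ
          (DirectSum.lof k ι P i).lTensor (C ⊗[k] C) := by
      apply TensorProduct.ext_threefold
      intro a b c
      simp
    have e₂ : (DirectSum.lof k ι P i).lTensor (C ⊗[k] C) ∘ₗ (Δ).rTensor (P i) =
        (Δ).rTensor (DirectSum ι P) ∘ₗ (DirectSum.lof k ι P i).lTensor C := by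
      rw [LinearMap.lTensor_comp_rTensor, LinearMap.rTensor_comp_lTensor]
    have e₃ : ((DirectSum.lof k ι P i).lTensor C).lTensor C ∘ₗ (coact (C := C)).lTensor C =
        (directSumCoact k C P).lTensor C ∘ₗ (DirectSum.lof k ι P i).lTensor C := by
      rw [← LinearMap.lTensor_comp, ← directSumCoact_comp_lof, LinearMap.lTensor_comp]
    calc _ = (TensorProduct.assoc k C C (DirectSum ι P)).toLinearMap ∘ₗ
            (Δ).rTensor (DirectSum ι P) ∘ₗ (directSumCoact k C P ∘ₗ DirectSum.lof k ι P i) := rfl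
      _ = (TensorProduct.assoc k C C (DirectSum ι P)).toLinearMap ∘ₗ
            ((Δ).rTensor (DirectSum ι P) ∘ₗ (DirectSum.lof k ι P i).lTensor C) ∘ₗ
              coact (C := C) := by rw [directSumCoact_comp_lof]; rfl
      _ = ((TensorProduct.assoc k C C (DirectSum ι P)).toLinearMap ∘ₗ
            (DirectSum.lof k ι P i).lTensor (C ⊗[k] C)) ∘ₗ (Δ).rTensor (P i) ∘ₗ
              coact (C := C) := by rw [← e₂]; rfl
      _ = ((DirectSum.lof k ι P i).lTensor C).lTensor C ∘ₗ
            ((TensorProduct.assoc k C C (P i)).toLinearMap ∘ₗ (Δ).rTensor (P i) ∘ₗ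
              coact (C := C)) := by rw [← e₁]; rfl
      _ = (((DirectSum.lof k ι P i).lTensor C).lTensor C ∘ₗ (coact (C := C)).lTensor C) ∘ₗ
            coact (C := C) := by rw [LeftComodule.coassoc]; rfl
      _ = (directSumCoact k C P).lTensor C ∘ₗ (DirectSum.lof k ι P i).lTensor C ∘ₗ
            coact (C := C) := by rw [e₃]; rfl
      _ = _ := by rw [← directSumCoact_comp_lof]; rfl
  counit_coact := by
    refine DirectSum.linearMap_ext k fun i => ?_
    have e : DirectSum.lof k ι P i ∘ₗ (TensorProduct.lid k (P i)).toLinearMap ∘ₗ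
        (ε).rTensor (P i) = ((TensorProduct.lid k (DirectSum ι P)).toLinearMap ∘ₗ
          (ε).rTensor (DirectSum ι P)) ∘ₗ (DirectSum.lof k ι P i).lTensor C := by
      ext
      simp
    calc _ = ((TensorProduct.lid k (DirectSum ι P)).toLinearMap ∘ₗ
            (ε).rTensor (DirectSum ι P)) ∘ₗ (directSumCoact k C P ∘ₗ DirectSum.lof k ι P i) := rfl
      _ = (((TensorProduct.lid k (DirectSum ι P)).toLinearMap ∘ₗ
            (ε).rTensor (DirectSum ι P)) ∘ₗ (DirectSum.lof k ι P i).lTensor C) ∘ₗ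
              coact (C := C) := by rw [directSumCoact_comp_lof]; rfl
      _ = DirectSum.lof k ι P i ∘ₗ ((TensorProduct.lid k (P i)).toLinearMap ∘ₗ
            (ε).rTensor (P i) ∘ₗ coact (C := C)) := by rw [← e]; rfl
      _ = _ := by rw [LeftComodule.counit_coact]; rfl

theorem isColinear_lof (i : ι) : IsColinear k C (DirectSum.lof k ι P i) :=
  directSumCoact_comp_lof i

theorem isColinear_directSum {f : DirectSum ι P →ₗ[k] M}
    (h : ∀ i, IsColinear k C (f ∘ₗ DirectSum.lof k ι P i)) : IsColinear k C f := by
  refine DirectSum.linearMap_ext k fun i => ?_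
  rw [LinearMap.comp_assoc, h i, LinearMap.comp_assoc, isColinear_lof i, LinearMap.lTensor_comp,
    LinearMap.comp_assoc]

theorem isColinear_toModule {f : ∀ i, P i →ₗ[k] M} (hf : ∀ i, IsColinear k C (f i)) :
    IsColinear k C (DirectSum.toModule k ι M f) :=
  isColinear_directSum fun i => by
    have : DirectSum.toModule k ι M f ∘ₗ DirectSum.lof k ι P i = f i := by
      ext x
      simp
    rw [this]
    exact hf i

theorem isColinear_component (i : ι) : IsColinear k C (DirectSum.component k ι P i) :=
  isColinear_directSum fun j => by
    by_cases h : j = i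
    · subst h
      have : DirectSum.component k ι P j ∘ₗ DirectSum.lof k ι P j = LinearMap.id := by
        ext x
        simp
      rw [this]
      exact isColinear_id
    · have : DirectSum.component k ι P i ∘ₗ DirectSum.lof k ι P j = 0 := by
        ext x
        simp [DirectSum.component.of, h]
      rw [this]
      exact isColinear_zero

end DirectSum

section Projective

variable {k C : Type u} [Field k] [AddCommGroup C] [Module k C] [Coalgebra k C]

theorem IsProjective.directSum {ι : Type u} [DecidableEq ι] {P : ι → Type u}
    [∀ i, AddCommGroup (P i)] [∀ i, Module k (P i)] [∀ i, LeftComodule k C (P i)]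
    (hP : ∀ i, IsProjective k C (P i)) : IsProjective k C (DirectSum ι P) := by
  intro X Y _ _ _ _ _ _ p f hp hs hf
  choose g hg hpg using fun i => hP i X Y p _ hp hs (hf.comp (isColinear_lof i))
  refine ⟨DirectSum.toModule k ι X g, isColinear_toModule hg, DirectSum.linearMap_ext k fun i => ?_⟩
  rw [← hpg]
  ext x
  simp

/-- A non-zero projective comodule has a finite-dimensional quotient. -/
theorem IsProjective.hasFiniteQuotient {P : Type u} [AddCommGroup P] [Module k P]
    [LeftComodule k C P] [Nontrivial P] (hP : IsProjective k C P) : HasFiniteQuotient k C P := by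
  classical
  let ι := {F : Submodule k P // IsSubcomodule k C F ∧ FiniteDimensional k F}
  let _ : ∀ i : ι, LeftComodule k C i.1 := fun i => i.2.1.comodule
  let π : DirectSum ι (fun i => i.1) →ₗ[k] P := DirectSum.toModule k ι P fun i => i.1.subtype
  have hπ : IsColinear k C π := isColinear_toModule fun i => i.2.1.isColinear_subtype
  have hs : Function.Surjective π := fun x => by
    obtain ⟨F, hF, hfd, hx⟩ := exists_finiteDimensional_subcomodule (k := k) (C := C) x
    refine ⟨DirectSum.lof k ι (fun i => i.1) ⟨F, hF, hfd⟩ ⟨x, hx⟩, ?_⟩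
    rw [DirectSum.toModule_lof]
    rfl
  obtain ⟨s, hsl, hsid⟩ := hP _ P π LinearMap.id hπ hs isColinear_id
  obtain ⟨x, hx⟩ := exists_ne (0 : P)
  have hsx : s x ≠ 0 := fun h => hx (by
    rw [← LinearMap.id_apply (R := k) x, ← hsid, LinearMap.comp_apply, h, map_zero])
  obtain ⟨i, hi⟩ : ∃ i, s x i ≠ 0 := by
    by_contra! h
    exact hsx (DFinsupp.ext h)
  have := i.2.2
  exact hasFiniteQuotient_of_ne_zero ((isColinear_component i).comp hsl)
    (fun h => hi (LinearMap.congr_fun h x)) inferInstance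

end Projective

/-! ### Maximal subcomodules and semisimplicity -/

section Semisimple

variable {k C : Type*} {M : Type u} [Field k] [AddCommGroup C] [Module k C] [Coalgebra k C]
  [AddCommGroup M] [Module k M] [LeftComodule k C M]

variable (k C) in
/-- A maximal proper subcomodule. -/
structure IsMaximalSubcomodule (N : Submodule k M) : Prop where
  isSubcomodule : IsSubcomodule k C N
  ne_top : N ≠ ⊤
  eq_top_of_lt : ∀ L, IsSubcomodule k C L → N < L → L = ⊤

variable (k C M) in
/-- A comodule is a module over the opposite of the dual algebra. -/
@[reducible] noncomputable def dualModule : Module (DualAlg k C)ᵐᵒᵖ M where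
  smul a m := hit a.unop.ofConv m
  one_smul m := by
    have : ((1 : DualAlg k C).ofConv : C →ₗ[k] k) = counit := rfl
    exact (congrArg (fun f => hit f m) this).trans (hit_counit m)
  mul_smul a b m := (hit_mul b.unop a.unop m).symm
  smul_zero a := map_zero _
  smul_add a := map_add _
  add_smul a b m := by
    change hit (a.unop.ofConv + b.unop.ofConv) m = hit a.unop.ofConv m + hit b.unop.ofConv m
    simp [hit, LinearMap.rTensor_add]
  zero_smul m := by
    change hit (0 : C →ₗ[k] k) m = 0
    simp [hit]

/-- A comodule whose maximal subcomodules intersect trivially is a direct sum of simple ones. -/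
theorem exists_directSum_simple (hM : sInf {N : Submodule k M | IsMaximalSubcomodule k C N} = ⊥) :
    ∃ (ι : Type u) (_ : DecidableEq ι) (S : ι → Submodule k M) (hS : ∀ i, IsSubcomodule k C (S i)),
      (∀ i, letI := (hS i).comodule; IsSimple k C (S i)) ∧
      Function.Bijective (DirectSum.toModule k ι M fun i => (S i).subtype) := by
  classical
  let A := (DualAlg k C)ᵐᵒᵖ
  let _ : Module A M := dualModule k C M
  have smul_def : ∀ (a : A) (m : M), a • m = hit a.unop.ofConv m := fun a m => rfl
  have : IsScalarTower k A M := ⟨fun c a m => by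
    rw [smul_def, smul_def]
    change hit (c • a.unop.ofConv) m = _
    simp [hit, LinearMap.rTensor_smul]⟩
  have sub_restrict : ∀ N : Submodule A M, IsSubcomodule k C (N.restrictScalars k) := fun N =>
    isSubcomodule_iff.2 fun f m hm => N.smul_mem (MulOpposite.op (WithConv.toConv f)) hm
  let lift : ∀ N : Submodule k M, IsSubcomodule k C N → Submodule A M := fun N hN =>
    { N with smul_mem' := fun a m hm => isSubcomodule_iff.1 hN a.unop.ofConv m hm }
  have hjac : Module.jacobson A M = ⊥ := by
    rw [eq_bot_iff]
    intro x hx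
    have hx' : x ∈ sInf {N : Submodule k M | IsMaximalSubcomodule k C N} := by
      rw [Submodule.mem_sInf]
      intro N hN
      refine (Submodule.mem_sInf.1 hx) (lift N hN.1) ⟨fun h => hN.ne_top ?_, fun L hL => ?_⟩
      · exact Submodule.ext fun y => SetLike.ext_iff.1 h y
      · have := hN.eq_top_of_lt (L.restrictScalars k) (sub_restrict L) hL
        exact Submodule.ext fun y => SetLike.ext_iff.1 this y
    rw [hM] at hx'
    exact hx'
  have hss : IsSemisimpleModule A M := by
    choose F hF hfd hmem using exists_finiteDimensional_subcomodule (k := k) (C := C) (M := M)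
    refine isSemisimpleModule_of_isSemisimpleModule_submodule' (p := fun m => lift (F m) (hF m))
      (fun m => ?_) ?_
    · have : IsArtinian k (lift (F m) (hF m)) := by
        have : IsArtinian k (F m) := inferInstance
        exact this
      have : IsArtinian A (lift (F m) (hF m)) := isArtinian_of_tower k this
      rw [IsArtinian.isSemisimpleModule_iff_jacobson]
      exact Module.jacobson_eq_bot_of_injective _ (Submodule.injective_subtype _) hjac
    · rw [eq_top_iff]
      exact fun m _ => Submodule.mem_iSup_of_mem m (hmem m)
  obtain ⟨s, hind, hsup, hsimple⟩ := IsSemisimpleModule.exists_sSupIndep_sSup_simples_eq_top A M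
  refine ⟨s, inferInstance, fun N => N.1.restrictScalars k, fun N => sub_restrict N.1, fun N => ?_,
    ?_, ?_⟩
  · have hat := isSimpleModule_iff_isAtom.1 (hsimple N.1 N.2)
    refine ⟨Submodule.nontrivial_iff_ne_bot.2 fun h => hat.1 ?_, fun L hL => ?_⟩
    · exact Submodule.ext fun y => SetLike.ext_iff.1 h y
    · have hL' := (sub_restrict N.1).of_map_subtype hL
      have hle : lift _ hL' ≤ N.1 := by
        rintro _ ⟨y, _, rfl⟩
        exact y.2
      rcases hat.le_iff.1 hle with h | h
      · refine Or.inl (eq_bot_iff.2 fun y hy => ?_)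
        have : (y : M) ∈ lift _ hL' := ⟨y, hy, rfl⟩
        rw [h] at this
        exact Subtype.ext this
      · refine Or.inr (eq_top_iff.2 fun y _ => ?_)
        have : (y : M) ∈ lift _ hL' := h.ge y.2
        obtain ⟨z, hz, hzy⟩ := this
        rwa [← Subtype.ext hzy]
  · exact ((sSupIndep_iff s).1 hind).dfinsupp_lsum_injective
  · intro m
    have hm : m ∈ ⨆ N : s, N.1 := by
      rw [← sSup_eq_iSup', hsup]
      trivial
    obtain ⟨f, hf⟩ := (Submodule.mem_iSup_iff_exists_dfinsupp _ m).1 hm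
    exact ⟨f, hf⟩

end Semisimple

end LeftComodule

/-! ### Projective covers -/

namespace LeftComodule

variable {k C : Type u} [Field k] [AddCommGroup C] [Module k C] [Coalgebra k C]

theorem exists_maximalSubcomodule
    (h : ∀ (M : Type u) [AddCommGroup M] [Module k M] [LeftComodule k C M],
      Nontrivial M → HasFiniteQuotient k C M)
    {M : Type u} [AddCommGroup M] [Module k M] [LeftComodule k C M] {N : Submodule k M}
    (hN : IsSubcomodule k C N) (hne : N ≠ ⊤) :
    ∃ L, IsMaximalSubcomodule k C L ∧ N ≤ L := by
  classical
  have hex : ∃ n, ∃ L : Submodule k M, IsSubcomodule k C L ∧ L ≠ ⊤ ∧ N ≤ L ∧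
      FiniteDimensional k (M ⧸ L) ∧ Module.finrank k (M ⧸ L) = n := by
    let _ := hN.quotientComodule
    obtain ⟨Q, _, _, _, q, hq, hs, hn, hfd⟩ := h (M ⧸ N) (Submodule.Quotient.nontrivial_iff.2 hne)
    refine ⟨_, LinearMap.ker (q ∘ₗ N.mkQ), (hq.comp hN.isColinear_mkQ).isSubcomodule_ker,
      fun ht => ?_, fun x hx => ?_, ?_, rfl⟩
    · obtain ⟨y, hy⟩ := exists_ne (0 : Q)
      obtain ⟨x, rfl⟩ := (hs.comp N.mkQ_surjective) y
      exact hy (LinearMap.congr_fun (LinearMap.ker_eq_top.1 ht) x)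
    · rw [LinearMap.mem_ker, LinearMap.comp_apply, Submodule.mkQ_apply,
        (Submodule.Quotient.mk_eq_zero N).2 hx, map_zero]
    · exact ((q ∘ₗ N.mkQ).quotKerEquivRange).symm.finiteDimensional
  obtain ⟨L, hL, hLne, hNL, hfd, hn⟩ := Nat.find_spec hex
  refine ⟨L, ⟨hL, hLne, fun L' hL' hlt => ?_⟩, hNL⟩
  by_contra hne'
  have hfd' : FiniteDimensional k (M ⧸ L') :=
    Module.Finite.of_surjective _ (Submodule.factor_surjective hlt.le)
  refine Nat.find_min hex (m := Module.finrank k (M ⧸ L')) ?_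
    ⟨L', hL', hne', hNL.trans hlt.le, hfd', rfl⟩
  rw [← hn]
  obtain ⟨x, hx, hxL⟩ := SetLike.exists_of_lt hlt
  have hrn := LinearMap.finrank_range_add_finrank_ker (Submodule.factor hlt.le)
  rw [LinearMap.range_eq_top.2 (Submodule.factor_surjective hlt.le), finrank_top] at hrn
  have hpos : 0 < Module.finrank k (LinearMap.ker (Submodule.factor hlt.le)) := by
    rw [Module.finrank_pos_iff, Submodule.nontrivial_iff_ne_bot, Submodule.ne_bot_iff]
    refine ⟨Submodule.Quotient.mk x, ?_, fun h0 => hxL ((Submodule.Quotient.mk_eq_zero L).1 h0)⟩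
    exact (Submodule.Quotient.mk_eq_zero L').2 hx
  omega

theorem isSubcomodule_sInf {M : Type u} [AddCommGroup M] [Module k M] [LeftComodule k C M]
    {s : Set (Submodule k M)} (hs : ∀ N ∈ s, IsSubcomodule k C N) : IsSubcomodule k C (sInf s) := by
  refine isSubcomodule_iff.2 fun f m hm => Submodule.mem_sInf.2 fun N hN => ?_
  exact isSubcomodule_iff.1 (hs N hN) f m (Submodule.mem_sInf.1 hm N hN)

theorem IsMaximalSubcomodule.map_mkQ {M : Type u} [AddCommGroup M] [Module k M]
    [LeftComodule k C M] {J L : Submodule k M} (hJ : IsSubcomodule k C J)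
    (hL : IsMaximalSubcomodule k C L) (hJL : J ≤ L) :
    letI := hJ.quotientComodule
    IsMaximalSubcomodule k C (L.map J.mkQ) := by
  let _ := hJ.quotientComodule
  have hcm : (L.map J.mkQ).comap J.mkQ = L := by
    rw [Submodule.comap_map_eq, Submodule.ker_mkQ, sup_eq_left.2 hJL]
  refine ⟨hL.1.map hJ.isColinear_mkQ, fun h => hL.2 ?_, fun N hN hlt => ?_⟩
  · rw [← hcm, h, Submodule.comap_top]
  · have hlt' : L < N.comap J.mkQ := by
      conv_lhs => rw [← hcm]
      exact Submodule.comap_strictMono_of_surjective J.mkQ_surjective hlt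
    have := hL.3 _ (hN.comap hJ.isColinear_mkQ) hlt'
    rw [← Submodule.map_comap_eq_of_surjective J.mkQ_surjective N, this, Submodule.map_top,
      Submodule.range_mkQ]

theorem hasProjectiveCover_of_simple
    (h : ∀ (M : Type u) [AddCommGroup M] [Module k M] [LeftComodule k C M],
      Nontrivial M → HasFiniteQuotient k C M)
    (hsimple : ∀ (S : Type u) [AddCommGroup S] [Module k S] [LeftComodule k C S],
      IsSimple k C S → HasProjectiveCover k C S)
    (M : Type u) [AddCommGroup M] [Module k M] [LeftComodule k C M] :
    HasProjectiveCover k C M := by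
  let J : Submodule k M := sInf {N | IsMaximalSubcomodule k C N}
  have hJ : IsSubcomodule k C J := isSubcomodule_sInf fun N hN => hN.1
  let _ := hJ.quotientComodule
  have hrad : sInf {N : Submodule k (M ⧸ J) | IsMaximalSubcomodule k C N} = ⊥ := by
    rw [eq_bot_iff]
    intro x hx
    obtain ⟨x, rfl⟩ := J.mkQ_surjective x
    rw [Submodule.mem_bot, Submodule.mkQ_apply, Submodule.Quotient.mk_eq_zero]
    refine Submodule.mem_sInf.2 fun L hL => ?_
    have hJL : J ≤ L := sInf_le hL
    have hxL : x ∈ (L.map J.mkQ).comap J.mkQ :=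
      Submodule.mem_sInf.1 hx _ (IsMaximalSubcomodule.map_mkQ hJ hL hJL)
    rwa [Submodule.comap_map_eq, Submodule.ker_mkQ, sup_eq_left.2 hJL] at hxL
  obtain ⟨ι, _, S, hS, hSs, hinj, hsurj⟩ := exists_directSum_simple hrad
  let _ : ∀ i, LeftComodule k C (S i) := fun i => (hS i).comodule
  choose P i₁ i₂ i₃ q hq using fun i => hsimple (S i) (hSs i)
  let π : DirectSum ι P →ₗ[k] M ⧸ J := DirectSum.toModule k ι _ fun i => (S i).subtype ∘ₗ q i
  have hπ : IsColinear k C π := isColinear_toModule fun i =>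
    (hS i).isColinear_subtype.comp (hq i).1
  have hfac : π = DirectSum.toModule k ι (M ⧸ J) (fun i => (S i).subtype) ∘ₗ
      DFinsupp.mapRange.linearMap q := by
    refine DirectSum.linearMap_ext k fun i => ?_
    ext x : 1
    have e : DFinsupp.mapRange.linearMap q (DirectSum.lof k ι P i x) =
        DirectSum.lof k ι (fun i => S i) i (q i x) :=
      DFinsupp.mapRange_single (hf := fun i => map_zero (q i))
    rw [LinearMap.comp_apply, LinearMap.comp_apply, LinearMap.comp_apply, e,
      DirectSum.toModule_lof, DirectSum.toModule_lof, LinearMap.comp_apply]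
  have hπs : Function.Surjective π := by
    rw [hfac]
    exact hsurj.comp ((DFinsupp.mapRange_surjective _ fun i => map_zero (q i)).2 fun i => (hq i).2.1)
  have hker : ∀ L, IsMaximalSubcomodule k C L → LinearMap.ker π ≤ L := by
    intro L hL x hx
    have hx0 : ∀ i, q i (x i) = 0 := by
      rw [LinearMap.mem_ker, hfac] at hx
      have := hinj (hx.trans (map_zero _).symm)
      exact fun i => DFinsupp.ext_iff.1 this i
    have hi : ∀ i, LinearMap.ker (q i) ≤ L.comap (DirectSum.lof k ι P i) := by
      intro i
      by_contra hcon
      have hlt : L < L ⊔ (LinearMap.ker (q i)).map (DirectSum.lof k ι P i) :=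
        left_lt_sup.2 fun hle => hcon (Submodule.map_le_iff_le_comap.1 hle)
      have htop := hL.3 _ (hL.1.sup ((hq i).1.isSubcomodule_ker.map (isColinear_lof i))) hlt
      refine hcon (le_top.trans_eq ((hq i).2.2.2 _ (hL.1.comap (isColinear_lof i)) ?_).symm)
      rw [eq_top_iff]
      intro y _
      obtain ⟨a, ha, _, ⟨b, hb, rfl⟩, hab⟩ := Submodule.mem_sup.1
        (htop ▸ Submodule.mem_top : DirectSum.lof k ι P i y ∈ _)
      refine Submodule.mem_sup.2 ⟨y - b, ?_, b, hb, sub_add_cancel _ _⟩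
      rw [Submodule.mem_comap, map_sub, ← hab, add_sub_cancel_right]
      exact ha
    classical
    rw [← DirectSum.sum_support_of x]
    exact Submodule.sum_mem _ fun i _ => hi i (hx0 i)
  obtain ⟨g, hg, hgπ⟩ := IsProjective.directSum (fun i => (hq i).2.2.1) M (M ⧸ J) J.mkQ π
    hJ.isColinear_mkQ J.mkQ_surjective hπ
  have hgs : LinearMap.range g = ⊤ := by
    by_contra hne
    obtain ⟨L, hL, hle⟩ := exists_maximalSubcomodule h hg.isSubcomodule_range hne
    refine hL.2 (eq_top_iff.2 fun m _ => ?_)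
    obtain ⟨x, hx⟩ := hπs (J.mkQ m)
    rw [← hgπ] at hx
    have : m - g x ∈ J := by
      rw [← Submodule.Quotient.mk_eq_zero, ← Submodule.mkQ_apply, map_sub, ← hx]
      exact sub_self _
    have := L.add_mem ((sInf_le hL : J ≤ L) this) (hle ⟨x, rfl⟩)
    rwa [sub_add_cancel] at this
  refine ⟨DirectSum ι P, inferInstance, inferInstance, inferInstance, g, hg,
    LinearMap.range_eq_top.1 hgs, IsProjective.directSum fun i => (hq i).2.2.1, fun N hN hNg => ?_⟩
  by_contra hne
  obtain ⟨L, hL, hle⟩ := exists_maximalSubcomodule h hN hne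
  refine hL.2 (top_le_iff.1 (hNg ▸ sup_le hle fun x hx => hker L hL ?_))
  rw [LinearMap.mem_ker, ← hgπ, LinearMap.comp_apply, LinearMap.mem_ker.1 hx, map_zero]

/-- A non-zero comodule with a projective cover has a finite-dimensional quotient. -/
theorem HasProjectiveCover.hasFiniteQuotient {M : Type u} [AddCommGroup M] [Module k M]
    [LeftComodule k C M] [Nontrivial M] (hM : HasProjectiveCover k C M) :
    HasFiniteQuotient k C M := by
  obtain ⟨P, _, _, _, p, hp, hs, hP, hsup⟩ := hM
  have : Nontrivial P := hs.nontrivial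
  obtain ⟨Q, _, _, _, q, hq, hqs, hn, hfd⟩ := hP.hasFiniteQuotient
  have hL := hq.isSubcomodule_ker
  have hpL := hL.map hp
  let _ := hpL.quotientComodule
  have hne : (LinearMap.ker q).map p ≠ ⊤ := fun htop => by
    have : LinearMap.ker q = ⊤ := hsup _ hL (by
      rw [← Submodule.comap_map_eq, htop, Submodule.comap_top])
    obtain ⟨y, hy⟩ := exists_ne (0 : Q)
    obtain ⟨x, rfl⟩ := hqs y
    exact hy (LinearMap.congr_fun (LinearMap.ker_eq_top.1 this) x)
  refine ⟨M ⧸ (LinearMap.ker q).map p, inferInstance, inferInstance, inferInstance, Submodule.mkQ _,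
    hpL.isColinear_mkQ, Submodule.mkQ_surjective _, Submodule.Quotient.nontrivial_iff.2 hne, ?_⟩
  have hfd' : FiniteDimensional k (P ⧸ LinearMap.ker q) := q.quotKerEquivRange.symm.finiteDimensional
  refine Module.Finite.of_surjective ((LinearMap.ker q).mapQ _ p (Submodule.le_comap_map _ _)) ?_
  rw [← LinearMap.range_eq_top, Submodule.range_mapQ, LinearMap.range_eq_top.2 hs, Submodule.map_top,
    Submodule.range_mkQ]

end LeftComodule

section Rational

variable {k R : Type*} [Field k] [Ring R] [Algebra k R] [Coalgebra k R]

/-- A left integral spans a rational ideal of the dual algebra. -/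
theorem ratDual_ne_bot_of_isLeftIntegral {l : DualAlg k R} (hl : l ∈ leftIntegrals k R)
    (h0 : l ≠ 0) : ratDual k R ≠ ⊥ := by
  let N : Submodule (DualAlg k R) (DualAlg k R) :=
    { carrier := {f | ∃ c : k, f = c • l}
      add_mem' := by
        rintro _ _ ⟨a, rfl⟩ ⟨b, rfl⟩
        exact ⟨a + b, (add_smul a b l).symm⟩
      zero_mem' := ⟨0, (zero_smul k l).symm⟩
      smul_mem' := by
        rintro f _ ⟨c, rfl⟩
        refine ⟨c * f.ofConv 1, ?_⟩
        rw [smul_eq_mul, mul_smul_comm, hl f, smul_smul] }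
  have hN : IsRational k R N := by
    rintro ⟨_, c, rfl⟩
    refine ⟨⟨c • l, c, rfl⟩ ⊗ₜ 1, fun f => Subtype.ext ?_⟩
    rw [LinearMap.lTensor_tmul, TensorProduct.rid_tmul]
    change f * c • l = f.ofConv 1 • c • l
    rw [mul_smul_comm, hl f, smul_comm]
  intro hbot
  have hle : N ≤ ratDual k R := le_sSup hN
  rw [hbot] at hle
  exact h0 (hle ⟨1, (one_smul k l).symm⟩)

end Rational

section Rational

variable {k C : Type u} [Field k] [AddCommGroup C] [Module k C] [Coalgebra k C]

theorem IsRational.exists_sum {M : Type*} [AddCommGroup M] [Module k M] [Module (DualAlg k C) M]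
    (hM : IsRational k C M) (m : M) : ∃ (n : ℕ) (a : Fin n → M) (c : Fin n → C),
      ∀ f : DualAlg k C, f • m = ∑ i, f.ofConv (c i) • a i := by
  obtain ⟨t, ht⟩ := hM m
  obtain ⟨n, a, c, rfl⟩ := TensorProduct.exists_sum_tmul_eq t
  exact ⟨n, a, c, fun f => by simp [ht f]⟩

/-- A non-zero rational functional gives a finite-dimensional quotient of the coalgebra. -/
theorem hasFiniteQuotient_of_ratDual_ne_bot (h : ratDual k C ≠ ⊥) :
    LeftComodule.HasFiniteQuotient k C C := by
  obtain ⟨N, hN, hne⟩ : ∃ N : Submodule (DualAlg k C) (DualAlg k C), IsRational k C N ∧ N ≠ ⊥ := by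
    by_contra! hcon
    exact h (sSup_eq_bot.2 hcon)
  obtain ⟨f, hf, hf0⟩ := (Submodule.ne_bot_iff N).1 hne
  obtain ⟨n, a, c, ht⟩ := hN.exists_sum ⟨f, hf⟩
  have key : ∀ x, matrixCoeff C f.ofConv x = ∑ i, (a i).1.ofConv x • c i := fun x => by
    refine eq_of_forall_dual (k := k) fun g => ?_
    have h₁ := ht (WithConv.toConv g)
    let E : N →ₗ[k] k :=
      { toFun := fun s => s.1.ofConv x
        map_add' := fun _ _ => rfl
        map_smul' := fun _ _ => rfl }
    have h₂ := congrArg E h₁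
    rw [map_sum] at h₂
    have h₃ : E (WithConv.toConv g • (⟨f, hf⟩ : N)) = g (matrixCoeff C f.ofConv x) := by
      change (WithConv.toConv g * f).ofConv x = _
      rw [dualAlg_mul_apply, matrixCoeff_apply, map_sw]
      refine sw_congr fun a b => ?_
      rw [map_smul, smul_eq_mul, mul_comm]
    rw [← h₃, h₂, map_sum]
    refine Finset.sum_congr rfl fun i _ => ?_
    rw [map_smul, map_smul, smul_eq_mul, smul_eq_mul, mul_comm]
    rfl
  refine LeftComodule.hasFiniteQuotient_of_ne_zero (isColinear_matrixCoeff f.ofConv)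
    (fun h0 => hf0 ?_) ?_
  · apply WithConv.ofConv_injective
    ext x
    rw [← counit_matrixCoeff (C := C), h0]
    simp
  · have := FiniteDimensional.span_of_finite k (Set.finite_range c)
    refine Submodule.finiteDimensional_of_le (S₂ := Submodule.span k (Set.range c)) ?_
    rintro _ ⟨x, rfl⟩
    rw [key]
    exact Submodule.sum_mem _ fun i _ => Submodule.smul_mem _ _ (Submodule.subset_span ⟨i, rfl⟩)

end Rational

section Main

open LeftComodule

/-- If an injective comodule maps non-trivially to `Q`, so does the coalgebra. -/
theorem exists_colinear_ne_zero_of_injective {k C M Q : Type u} [Field k] [AddCommGroup C]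
    [Module k C] [Coalgebra k C] [AddCommGroup M] [Module k M] [LeftComodule k C M]
    [AddCommGroup Q] [Module k Q] [LeftComodule k C Q] (hM : IsInjective k C M) {q : M →ₗ[k] Q}
    (hq : IsColinear k C q) (h0 : q ≠ 0) : ∃ φ : C →ₗ[k] Q, IsColinear k C φ ∧ φ ≠ 0 := by
  obtain ⟨r, hr, hid⟩ := hM.exists_retraction
  by_contra! hcon
  have hz : q ∘ₗ r = 0 := by
    apply TensorProduct.ext'
    intro c m
    exact LinearMap.congr_fun (hcon ((q ∘ₗ r) ∘ₗ (TensorProduct.mk k C M).flip m)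
      (isColinear_iff.2 fun c => isColinear_cofree_iff.1 (hq.comp hr) c m)) c
  apply h0
  rw [← LinearMap.comp_id q, ← hid, ← LinearMap.comp_assoc, hz, LinearMap.zero_comp]

theorem HasFiniteInjectiveHull.hasFiniteQuotient {k C M : Type u} [Field k] [AddCommGroup C]
    [Module k C] [Coalgebra k C] [AddCommGroup M] [Module k M] [LeftComodule k C M]
    {S : Submodule k M} (hS : IsSubcomodule k C S) (hne : S ≠ ⊥)
    (h : letI := hS.comodule; HasFiniteInjectiveHull k C S) : HasFiniteQuotient k C M := by
  let _ := hS.comodule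
  obtain ⟨E, _, _, _, i, ⟨hi, hinj, hE, _⟩, hfd⟩ := h
  obtain ⟨g, hg, hgi⟩ := hE S M S.subtype i hS.isColinear_subtype S.injective_subtype hi
  refine hasFiniteQuotient_of_ne_zero hg (fun h0 => ?_) inferInstance
  obtain ⟨s, hs, hs0⟩ := (Submodule.ne_bot_iff S).1 hne
  rw [h0, LinearMap.zero_comp] at hgi
  exact hs0 (congrArg Subtype.val
    (hinj (((LinearMap.congr_fun hgi ⟨s, hs⟩).symm).trans (map_zero i).symm)))

theorem mainTheorem2 {k R : Type u} {H : Type v} [Field k]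
    [Ring H] [HopfAlgebra k H] (hH : Function.Bijective (HopfAlgebra.antipode k (A := H)))
    [Ring R] [Algebra k R] [Coalgebra k R] [Module H R] [IsScalarTower k H R]
    [YetterDrinfeldModule k H R] [BraidedHopfAlgebra k H R]
    (hR : Function.Bijective (BraidedHopfAlgebra.antipode k H : R →ₗ[k] R)) :
    List.TFAE [
      -- (i)
      IsCoFrobenius k R,
      -- (ii)
      ∀ (S : Type u) [AddCommGroup S] [Module k S] [LeftComodule k R S],
        LeftComodule.IsSimple k R S → LeftComodule.HasFiniteInjectiveHull k R S,
      -- (iii)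
      ∀ (M : Type u) [AddCommGroup M] [Module k M] [LeftComodule k R M],
        Nontrivial M → LeftComodule.HasFiniteQuotient k R M,
      -- (iv)
      ∀ (M : Type u) [AddCommGroup M] [Module k M] [LeftComodule k R M],
        Nontrivial M → LeftComodule.IsInjective k R M → LeftComodule.HasFiniteQuotient k R M,
      -- (v)
      ∃ (M : Type u) (_ : AddCommGroup M) (_ : Module k M) (_ : LeftComodule k R M),
        Nontrivial M ∧ LeftComodule.IsInjective k R M ∧ LeftComodule.HasFiniteQuotient k R M,
      -- (vi)
      ∀ (M : Type u) [AddCommGroup M] [Module k M] [LeftComodule k R M],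
        LeftComodule.HasProjectiveCover k R M,
      -- (vii)
      ∀ (M : Type u) [AddCommGroup M] [Module k M] [LeftComodule k R M],
        LeftComodule.IsInjective k R M → LeftComodule.IsProjective k R M,
      -- (viii)
      ratDual k R ≠ ⊥] := by
  have hnt : Nontrivial R := ⟨1, 0, fun h => by
    have h1 := BraidedHopfAlgebra.counit_one (k := k) (H := H) (R := R)
    rw [h, map_zero] at h1
    exact zero_ne_one h1⟩
  tfae_have 1 → 2 := by
    rw [isCoFrobenius_iff]
    rintro ⟨l, hl, h0⟩ S _ _ _ hS
    exact hl.hasFiniteInjectiveHull (H := H) h0 hS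
  tfae_have 2 → 3 := by
    intro h M _ _ _ hM
    obtain ⟨S, hS, hsimple⟩ := exists_simple_subcomodule k R M
    let _ := hS.comodule
    exact HasFiniteInjectiveHull.hasFiniteQuotient hS
      (Submodule.nontrivial_iff_ne_bot.1 hsimple.1) (h S hsimple)
  tfae_have 3 → 4 := fun h M _ _ _ hM _ => h M hM
  tfae_have 4 → 5 := fun h =>
    ⟨R, inferInstance, inferInstance, inferInstance, hnt, isInjective_self k R,
      h R hnt (isInjective_self k R)⟩
  tfae_have 5 → 1 := by
    rintro ⟨M, _, _, _, -, hM, Q, _, _, _, q, hq, hs, hn, hfd⟩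
    rw [isCoFrobenius_iff]
    obtain ⟨φ, hφ, h0⟩ := exists_colinear_ne_zero_of_injective hM hq fun h => by
      obtain ⟨y, hy⟩ := exists_ne (0 : Q)
      obtain ⟨x, rfl⟩ := hs y
      exact hy (LinearMap.congr_fun h x)
    exact exists_isLeftIntegral_of_finite_quotient hH hR φ hφ h0
  tfae_have 1 → 7 := by
    rw [isCoFrobenius_iff]
    rintro ⟨l, hl, h0⟩ M _ _ _ hM
    exact hM.isProjective (hl.isProjective_self hH hR h0)
  tfae_have 7 → 5 := fun h =>
    ⟨R, inferInstance, inferInstance, inferInstance, hnt, isInjective_self k R,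
      (h R (isInjective_self k R)).hasFiniteQuotient⟩
  tfae_have 1 → 8 := by
    intro h
    obtain ⟨l, hl, h0⟩ := (Submodule.ne_bot_iff _).1 h
    exact ratDual_ne_bot_of_isLeftIntegral hl h0
  tfae_have 8 → 5 := fun h =>
    ⟨R, inferInstance, inferInstance, inferInstance, hnt, isInjective_self k R,
      hasFiniteQuotient_of_ratDual_ne_bot h⟩
  tfae_have 1 → 6 := by
    intro h M _ _ _
    have h3 := tfae_2_to_3 (tfae_1_to_2 h)
    obtain ⟨l, hl, h0⟩ := isCoFrobenius_iff.1 h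
    exact hasProjectiveCover_of_simple h3
      (fun S _ _ _ hS => hl.hasProjectiveCover_of_isSimple hH hR h0 hS) M
  tfae_have 6 → 3 := fun h M _ _ _ _ => (h M).hasFiniteQuotient
  tfae_finish

end Main
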